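/- Let $\mathcal Y$ be a unitary fusion category and $F:Z(\mathcal Y)\to\mathcal Y$ the forgetful functor from its Drinfeld center. Let $(A,m,i_A)$ be a condensable algebra in $Z(\mathcal Y)$: its half-braidings are unitary, it is commutative, unitarily separable ($mm^\dagger=\mathrm{id}_A$ and $(m\otimes 1)(1\otimes m^\dagger)=m^\dagger m$), and connected ($\dim Z(\mathcal Y)(1\to A)=1$). Choose representatives $x\in\operatorname{Irr}(\mathcal Y)$ of the simple objects, for each $x$ a dual $\overline x\in\operatorname{Irr}(\mathcal Y)$ with a standard solution of the conjugate equations, and for all $x,y,z\in\operatorname{Irr}(\mathcal Y)$ a basis of $\mathcal Y(z\to x\otimes y)$ consisting of isometries with mutually orthogonal ranges. Let $Y=\bigoplus_{x\in\operatorname{Irr}(\mathcal Y)}x$ (orthogonal direct sum), and let $$\operatorname{Tube}(\mathcal Y)=\bigoplus_{x\in\operatorname{Irr}(\mathcal Y)}\mathcal Y(x\otimes Y\to Y\otimes x),\qquad \operatorname{Tube}_A(\mathcal Y)=\bigoplus_{x\in\operatorname{Irr}(\mathcal Y)}\mathcal Y(x\otimes Y\to F(A)\otimes Y\otimes x),$$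 with the usual $*$-algebra structures. In the product $fg$, the tube of $f$ is stacked on that of $g$, the strings $x,y$ of $f,g$ are resolved into simple strings $z$ by summing over the chosen bases, and, for $\operatorname{Tube}_A$, the $A$-strand of $g$ crosses the string $x$ by the half-braiding and is multiplied with the $A$-strand of $f$. The adjoint applies $\dagger$ and bends the $x$-strings around and, for $\operatorname{Tube}_A$, bends the $A$-strand by $m^\dagger i_A$ across the string. For $z\in Z(\mathcal Y)$ let $\operatorname{Tube}(\mathcal Y)$ act on the right on $K_z=\mathcal Y(Y\to F(z))$ by closing the $x$-string up around $\xi\in K_z$ through the half-braiding of $z$. For an $A$-module $M\in Z(\mathcal Y)_A$ let $\operatorname{Tube}_A(\mathcal Y)$ act on the right on $K_M=\mathcal Y(Y\to F(M))$ in the same way, with the $A$-strand acting on $M$. A minimal projection in one of the two algebras $T$ is an element $q\neq0$ with $q=q^2=q^*$ and $qTq=\mathbb Cq$. A projection $q\in\operatorname{Tube}(\mathcal Y)$ corresponds to $z$ if $q\operatorname{Tube}(\mathcal Y)\cong K_z$ as right modules, and $p\in\operatorname{Tube}_A(\mathcal Y)$ corresponds to $M$ if $p\operatorname{Tube}_A(\mathcal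 Y)\cong K_M$ as right modules. The map $i_A\otimes-:\operatorname{Tube}(\mathcal Y)\to\operatorname{Tube}_A(\mathcal Y)$ is an injective $*$-homomorphism and implements the free module functor $z\mapsto Az=A\otimes z$: 1. For every $z\in Z(\mathcal Y)$, every projection $q\in\operatorname{Tube}(\mathcal Y)$ and every isomorphism of right $\operatorname{Tube}(\mathcal Y)$-modules $\varphi:K_z\to q\operatorname{Tube}(\mathcal Y)$, there is an isomorphism of right $\operatorname{Tube}_A(\mathcal Y)$-modules $\psi:K_{Az}\to(i_A\otimes q)\operatorname{Tube}_A(\mathcal Y)$ with $\psi(i_A\otimes\xi)=i_A\otimes\varphi(\xi)$ for all $\xi\in K_z$. 2. If $z\in Z(\mathcal Y)$ is simple and $q_z\in\operatorname{Tube}(\mathcal Y)$ is a minimal projection corresponding to $z$, then $i_A\otimes q_z$ is a projection in $\operatorname{Tube}_A(\mathcal Y)$, and for every simple $M\in Z(\mathcal Y)_A$ and every minimal projection $p_M\in\operatorname{Tube}_A(\mathcal Y)$ corresponding to $M$, the number of copies of $M$ in $Az$ (the largest $k$ such that $M^{\oplus k}$ is a direct summand of $Az$) equals $$\dim\bigl((i_A\otimes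 q_z)\,\operatorname{Tube}_A(\mathcal Y)\,p_M\bigr).$$ -/

import Mathlib

open CategoryTheory MonoidalCategory MonObj

universe v u

noncomputable section

/-! ### The Drinfeld center of a linear monoidal category is linear -/

section CenterLinear

variable {C : Type u} [Category.{v} C] [MonoidalCategory C] [Preadditive C] [MonoidalPreadditive C]

instance centerHomZero (X Y : Center C) : Zero (X ⟶ Y) :=
  ⟨{ f := (0 : X.1 ⟶ Y.1), comm := fun U => by simp }⟩

instance centerHomAdd (X Y : Center C) : Add (X ⟶ Y) :=
  ⟨fun g h =>
    { f := g.f + h.f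
      comm := fun U => by
        rw [MonoidalPreadditive.add_whiskerRight, MonoidalPreadditive.whiskerLeft_add,
          Preadditive.add_comp, Preadditive.comp_add, g.comm, h.comm] }⟩

instance centerHomNeg (X Y : Center C) : Neg (X ⟶ Y) :=
  ⟨fun g =>
    { f := - g.f
      comm := fun U => by
        have h1 : (- g.f) ▷ U = - (g.f ▷ U) := ((tensoringRight C).obj U).map_neg
        have h2 : U ◁ (- g.f) = - (U ◁ g.f) := ((tensoringLeft C).obj U).map_neg
        rw [h1, h2, Preadditive.neg_comp, Preadditive.comp_neg, g.comm] }⟩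

@[simp] theorem center_zero_f (X Y : Center C) : (0 : X ⟶ Y).f = 0 := rfl
@[simp] theorem center_add_f {X Y : Center C} (g h : X ⟶ Y) : (g + h).f = g.f + h.f := rfl
@[simp] theorem center_neg_f {X Y : Center C} (g : X ⟶ Y) : (-g).f = -g.f := rfl

instance centerHomGroup (X Y : Center C) : AddCommGroup (X ⟶ Y) where
  add_assoc f g h := by apply Center.ext; simp [add_assoc]
  zero_add f := by apply Center.ext; simp
  add_zero f := by apply Center.ext; simp
  add_comm f g := by apply Center.ext; simp [add_comm]
  neg_add_cancel f := by apply Center.ext; simp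
  nsmul := nsmulRec
  zsmul := zsmulRec

instance centerPreadditive : Preadditive (Center C) where
  homGroup := centerHomGroup
  add_comp _ _ _ _ _ _ := by apply Center.ext; simp
  comp_add _ _ _ _ _ _ := by apply Center.ext; simp

variable [Linear ℂ C] [MonoidalLinear ℂ C]

instance centerHomSMul (X Y : Center C) : SMul ℂ (X ⟶ Y) :=
  ⟨fun c g =>
    { f := c • g.f
      comm := fun U => by
        rw [MonoidalLinear.smul_whiskerRight, MonoidalLinear.whiskerLeft_smul,
          Linear.smul_comp, Linear.comp_smul, g.comm] }⟩

@[simp] theorem center_smul_f {X Y : Center C} (c : ℂ) (g : X ⟶ Y) : (c • g).f = c • g.f := rfl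

instance centerHomModule (X Y : Center C) : Module ℂ (X ⟶ Y) where
  one_smul f := by apply Center.ext; simp
  mul_smul a b f := by apply Center.ext; simp [mul_smul]
  smul_zero a := by apply Center.ext; simp
  smul_add a f g := by apply Center.ext; simp
  add_smul a b f := by apply Center.ext; simp [add_smul]
  zero_smul f := by apply Center.ext; simp

instance centerLinear : Linear ℂ (Center C) where
  homModule := centerHomModule
  smul_comp _ _ _ _ _ _ := by apply Center.ext; simp
  comp_smul _ _ _ _ _ _ := by apply Center.ext; simp

end CenterLinear

/-! ### Modules over an algebra in the center -/

section Modules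

variable {C : Type u} [Category.{v} C] [MonoidalCategory C]

/-- The unit `i_A : 1 ⟶ F(A)` as a morphism of `C`. -/
def unitHom (A : Center C) [MonObj A] : 𝟙_ C ⟶ A.1 := η[A].f

/-- The multiplication `m_A : F(A) ⊗ F(A) ⟶ F(A)` as a morphism of `C`. -/
def multHom (A : Center C) [MonObj A] : A.1 ⊗ A.1 ⟶ A.1 := μ[A].f

/-- The objects of `Z(C)_A` are the objects `M` of `Z(C)` with an `A`-action; this is the action
`F(A) ⊗ F(M) ⟶ F(M)` as a morphism of `C`. -/
def actionHom {A : Center C} [MonObj A] (M : Mod (Center C) A) : A.1 ⊗ M.X.1 ⟶ M.X.1 :=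
  (ModObj.smul (M := A) (X := M.X)).f

theorem free_one_smul {B : Type*} [Category B] [MonoidalCategory B] (A z : B) [MonObj A] :
    η[A] ▷ (A ⊗ z) ≫ (α_ A A z).inv ≫ μ[A] ▷ z = (λ_ (A ⊗ z)).hom := by
  simp [← comp_whiskerRight]

theorem free_mul_smul {B : Type*} [Category B] [MonoidalCategory B] (A z : B) [MonObj A] :
    μ[A] ▷ (A ⊗ z) ≫ (α_ A A z).inv ≫ μ[A] ▷ z =
      (α_ A A (A ⊗ z)).hom ≫ A ◁ ((α_ A A z).inv ≫ μ[A] ▷ z) ≫ (α_ A A z).inv ≫ μ[A] ▷ z := by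
  have h : μ[A] ▷ (A ⊗ z) ≫ (α_ A A z).inv ≫ μ[A] ▷ z =
      (α_ (A ⊗ A) A z).inv ≫ (μ[A] ▷ A ≫ μ[A]) ▷ z := by
    rw [comp_whiskerRight, associator_inv_naturality_left_assoc]
  rw [h, MonObj.mul_assoc]
  monoidal

/-- The free `A`-module `Az = A ⊗ z` on an object `z` of the center, with action `m_A ⊗ z`. -/
def freeModule (A : Center C) [MonObj A] (z : Center C) : Mod (Center C) A :=
  letI : ModObj A (A ⊗ z) :=
    { smul := (α_ A A z).inv ≫ μ[A] ▷ z
      one_smul := free_one_smul A z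
      mul_smul := free_mul_smul A z }
  ⟨A ⊗ z⟩

variable [Preadditive C] [MonoidalPreadditive C]

/-- The zero morphisms of `Z(C)_A`. -/
instance moduleZeroMorphisms (A : Center C) [MonObj A] :
    Limits.HasZeroMorphisms (Mod (Center C) A) where
  zero M N := ⟨Mod.Hom.mk' (0 : M.X ⟶ N.X) (by
    have h : A ◁ (0 : M.X ⟶ N.X) = 0 := by
      apply Center.ext
      exact MonoidalPreadditive.whiskerLeft_zero
    change ModObj.smul (M := A) (X := M.X) ≫ (0 : M.X ⟶ N.X) =
      (A ◁ (0 : M.X ⟶ N.X)) ≫ ModObj.smul (M := A) (X := N.X)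
    rw [h, Limits.comp_zero, Limits.zero_comp])⟩
  comp_zero f K := by
    apply Mod.hom_ext
    exact Limits.comp_zero
  zero_comp M _ _ f := by
    apply Mod.hom_ext
    exact Limits.zero_comp

end Modules

/-! ### Unitary fusion categories -/

/-- A unitary fusion category: a `ℂ`-linear monoidal category with a `†`-structure that is
positive (so that, homs being finite dimensional and direct sums existing, it is a `C*`-category),
compatible with `⊗`, having orthogonal direct sums and split projections, semisimple with finitely
many simple objects, with simple unit and with duals. -/
class UnitaryFusionCategory (C : Type u) [Category.{v} C] [MonoidalCategory C] [Preadditive C]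
    [Linear ℂ C] [MonoidalPreadditive C] [MonoidalLinear ℂ C] where
  /-- the adjoint `f ↦ f†` -/
  dag : ∀ {X Y : C}, (X ⟶ Y) → (Y ⟶ X)
  dag_dag : ∀ {X Y : C} (f : X ⟶ Y), dag (dag f) = f
  dag_id : ∀ X : C, dag (𝟙 X) = 𝟙 X
  dag_comp : ∀ {X Y Z : C} (f : X ⟶ Y) (g : Y ⟶ Z), dag (f ≫ g) = dag g ≫ dag f
  dag_add : ∀ {X Y : C} (f g : X ⟶ Y), dag (f + g) = dag f + dag g
  dag_smul : ∀ {X Y : C} (c : ℂ) (f : X ⟶ Y), dag (c • f) = (starRingEnd ℂ c) • dag f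
  positive : ∀ {X Y : C} (f : X ⟶ Y), f ≫ dag f = 0 → f = 0
  dag_whiskerLeft : ∀ (X : C) {Y Z : C} (f : Y ⟶ Z), dag (X ◁ f) = X ◁ dag f
  dag_whiskerRight : ∀ {X Y : C} (f : X ⟶ Y) (Z : C), dag (f ▷ Z) = dag f ▷ Z
  dag_associator : ∀ X Y Z : C, dag (α_ X Y Z).hom = (α_ X Y Z).inv
  dag_leftUnitor : ∀ X : C, dag (λ_ X).hom = (λ_ X).inv
  dag_rightUnitor : ∀ X : C, dag (ρ_ X).hom = (ρ_ X).inv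
  finite_hom : ∀ X Y : C, Module.Finite ℂ (X ⟶ Y)
  exists_sum : ∀ (n : ℕ) (S : Fin n → C), ∃ (Z : C) (u : ∀ i, S i ⟶ Z),
    (∀ i, u i ≫ dag (u i) = 𝟙 (S i)) ∧ (∀ i j, i ≠ j → u i ≫ dag (u j) = 0) ∧
      ∑ i, dag (u i) ≫ u i = 𝟙 Z
  exists_split : ∀ {X : C} (p : X ⟶ X), p ≫ p = p → dag p = p →
    ∃ (Z : C) (u : Z ⟶ X), u ≫ dag u = 𝟙 Z ∧ dag u ≫ u = p
  semisimple : ∀ X : C, ∃ (n : ℕ) (S : Fin n → C) (u : ∀ i, S i ⟶ X), (∀ i, Simple (S i)) ∧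
    (∀ i, u i ≫ dag (u i) = 𝟙 (S i)) ∧ (∀ i j, i ≠ j → u i ≫ dag (u j) = 0) ∧
      ∑ i, dag (u i) ≫ u i = 𝟙 X
  finite_simples : ∃ (n : ℕ) (S : Fin n → C), ∀ X : C, Simple X → ∃ i, Nonempty (X ≅ S i)
  simple_unit : Simple (𝟙_ C)
  exists_dual : ∀ X : C, ∃ X' : C, Nonempty (ExactPairing X X')

open UnitaryFusionCategory (dag)

section UFC

variable {C : Type u} [Category.{v} C] [MonoidalCategory C] [Preadditive C] [Linear ℂ C]
  [MonoidalPreadditive C] [MonoidalLinear ℂ C] [UnitaryFusionCategory C]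

/-- A condensable algebra in the center: an algebra with unitary half-braidings that is commutative,
unitarily separable (`m m† = 1`, `†`-Frobenius) and connected. -/
structure IsCondensable (A : Center C) [MonObj A] : Prop where
  unitary : ∀ U : C, dag (A.2.β U).hom = (A.2.β U).inv
  comm : (β_ A A).hom ≫ μ[A] = μ[A]
  separable : dag (multHom A) ≫ multHom A = 𝟙 A.1
  frobenius : (A.1 ◁ dag (multHom A)) ≫ (α_ A.1 A.1 A.1).inv ≫ (multHom A ▷ A.1) =
    multHom A ≫ dag (multHom A)
  connected : Module.finrank ℂ (𝟙_ (Center C) ⟶ A) = 1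

variable (C) in
/-- The choices entering the tube algebra: representatives `obj i` of `Irr(C)`, for each of them
a dual `obj (bar i)` in the list with a standard (balanced) solution `R, Rb` of the conjugate
equations, the orthogonal direct sum `Y` of all of them, and orthonormal bases `v` of the trivalent
vertex spaces, normalized to be isometries. Every unitary fusion category admits such choices. -/
structure IrrData where
  /-- the number of isomorphism classes of simple objects -/
  n : ℕ
  /-- the representatives of the simple objects -/
  obj : Fin n → C
  simple : ∀ i, Simple (obj i)
  eq_of_iso : ∀ i j, Nonempty (obj i ≅ obj j) → i = j
  exists_iso : ∀ X : C, Simple X → ∃ i, Nonempty (X ≅ obj i)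
  /-- `obj (bar i)` is dual to `obj i` -/
  bar : Fin n → Fin n
  /-- the coevaluation `1 ⟶ x̄ ⊗ x` -/
  R : ∀ i, 𝟙_ C ⟶ obj (bar i) ⊗ obj i
  /-- the coevaluation `1 ⟶ x ⊗ x̄` -/
  Rb : ∀ i, 𝟙_ C ⟶ obj i ⊗ obj (bar i)
  conj_left : ∀ i, (ρ_ (obj i)).inv ≫ (obj i ◁ R i) ≫ (α_ _ _ _).inv ≫
    (dag (Rb i) ▷ obj i) ≫ (λ_ (obj i)).hom = 𝟙 (obj i)
  conj_right : ∀ i, (ρ_ (obj (bar i))).inv ≫ (obj (bar i) ◁ Rb i) ≫ (α_ _ _ _).inv ≫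
    (dag (R i) ▷ obj (bar i)) ≫ (λ_ (obj (bar i))).hom = 𝟙 (obj (bar i))
  balanced : ∀ i, R i ≫ dag (R i) = Rb i ≫ dag (Rb i)
  /-- the orthogonal direct sum of the representatives -/
  Y : C
  /-- the inclusions of the summands of `Y` -/
  inc : ∀ i, obj i ⟶ Y
  inc_isometry : ∀ i, inc i ≫ dag (inc i) = 𝟙 (obj i)
  inc_orthogonal : ∀ i j, i ≠ j → inc i ≫ dag (inc j) = 0
  inc_complete : ∑ i, dag (inc i) ≫ inc i = 𝟙 Y
  /-- the fusion multiplicities -/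
  N : Fin n → Fin n → Fin n → ℕ
  /-- the trivalent vertices `z ⟶ x ⊗ y` -/
  v : ∀ i j k, Fin (N i j k) → (obj k ⟶ obj i ⊗ obj j)
  v_orthonormal : ∀ i j k (a b : Fin (N i j k)),
    v i j k a ≫ dag (v i j k b) = if a = b then 𝟙 (obj k) else 0
  v_complete : ∀ i j, ∑ k, ∑ a, dag (v i j k a) ≫ v i j k a = 𝟙 (obj i ⊗ obj j)

/-! ### The tube algebra and the `A`-tube algebra -/

/-- The tube algebra `⨁_x C(x ⊗ Y ⟶ Y ⊗ x)`. -/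
def Tube (D : IrrData C) : Type v := ∀ i : Fin D.n, (D.obj i ⊗ D.Y ⟶ D.Y ⊗ D.obj i)

/-- The `A`-tube algebra `⨁_x C(x ⊗ Y ⟶ F(A) ⊗ Y ⊗ x)`. -/
def TubeA (D : IrrData C) (A : Center C) : Type v :=
  ∀ i : Fin D.n, (D.obj i ⊗ D.Y ⟶ A.1 ⊗ (D.Y ⊗ D.obj i))

section TubeStructure

variable (D : IrrData C)

instance : AddCommGroup (Tube D) :=
  inferInstanceAs (AddCommGroup (∀ i : Fin D.n, (D.obj i ⊗ D.Y ⟶ D.Y ⊗ D.obj i)))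

instance : Module ℂ (Tube D) :=
  inferInstanceAs (Module ℂ (∀ i : Fin D.n, (D.obj i ⊗ D.Y ⟶ D.Y ⊗ D.obj i)))

/-- For `f` with string `x` and `g` with string `y`, the composite
`(x ⊗ y) ⊗ Y ⟶ Y ⊗ (x ⊗ y)` with `g` below and `f` on top. -/
def tubeStack {i j : Fin D.n} (f : D.obj i ⊗ D.Y ⟶ D.Y ⊗ D.obj i)
    (g : D.obj j ⊗ D.Y ⟶ D.Y ⊗ D.obj j) :
    (D.obj i ⊗ D.obj j) ⊗ D.Y ⟶ D.Y ⊗ (D.obj i ⊗ D.obj j) :=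
  (α_ _ _ _).hom ≫ (D.obj i ◁ g) ≫ (α_ _ _ _).inv ≫ (f ▷ D.obj j) ≫ (α_ _ _ _).hom

/-- The multiplication: stack the tubes and resolve the pair of strings `x, y` into the simple
strings `z` by the fusion relation. -/
instance : Mul (Tube D) :=
  ⟨fun f g k => ∑ i, ∑ j, ∑ a, (D.v i j k a ▷ D.Y) ≫ tubeStack D (f i) (g j) ≫
    (D.Y ◁ dag (D.v i j k a))⟩

/-- The adjoint: the component at `y` is the `†` of the component at `ȳ`, with both `ȳ`-strings
bent around. -/
instance : Star (Tube D) :=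
  ⟨fun f j => (D.obj j ◁ ((ρ_ D.Y).inv ≫ (D.Y ◁ D.R j) ≫ (α_ _ _ _).inv)) ≫
    (D.obj j ◁ (dag (f (D.bar j)) ▷ D.obj j)) ≫
    (D.obj j ◁ (α_ _ _ _).hom) ≫ (α_ _ _ _).inv ≫
    (dag (D.Rb j) ▷ (D.Y ⊗ D.obj j)) ≫ (λ_ _).hom⟩

theorem tube_mul_apply (f g : Tube D) (k : Fin D.n) :
    (f * g) k = ∑ i, ∑ j, ∑ a, (D.v i j k a ▷ D.Y) ≫ tubeStack D (f i) (g j) ≫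
      (D.Y ◁ dag (D.v i j k a)) := rfl

theorem tube_add_apply (f g : Tube D) (k : Fin D.n) : (f + g) k = f k + g k := rfl
theorem tube_zero_apply (k : Fin D.n) : (0 : Tube D) k = 0 := rfl
theorem tube_smul_apply (c : ℂ) (f : Tube D) (k : Fin D.n) : (c • f) k = c • f k := rfl

instance : NonUnitalNonAssocRing (Tube D) where
  left_distrib f g h := by
    funext k
    simp [tube_mul_apply, tube_add_apply, tubeStack, Finset.sum_add_distrib]
  right_distrib f g h := by
    funext k
    simp [tube_mul_apply, tube_add_apply, tubeStack, Finset.sum_add_distrib]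
  zero_mul f := by
    funext k
    simp [tube_mul_apply, tube_zero_apply, tubeStack]
  mul_zero f := by
    funext k
    simp [tube_mul_apply, tube_zero_apply, tubeStack]

instance : SMulCommClass ℂ (Tube D) (Tube D) where
  smul_comm c f g := by
    funext k
    simp [tube_mul_apply, tube_smul_apply, tubeStack, Finset.smul_sum]

instance : IsScalarTower ℂ (Tube D) (Tube D) where
  smul_assoc c f g := by
    funext k
    simp [tube_mul_apply, tube_smul_apply, tubeStack, Finset.smul_sum]

/-- The right action of `f ∈ Tube` on `ξ ∈ C(Y ⟶ F(z)) ≅ Z(C)(Tr(Y) ⟶ z)`: the `x`-string is closed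
up around `ξ`, passing the `z`-strand by the half-braiding of `z`. -/
def tubeAct (z : Center C) (ξ : D.Y ⟶ z.1) (f : Tube D) : D.Y ⟶ z.1 :=
  ∑ i, (λ_ D.Y).inv ≫ (D.R i ▷ D.Y) ≫ (α_ _ _ _).hom ≫
    (D.obj (D.bar i) ◁ (f i ≫ (ξ ▷ D.obj i) ≫ (z.2.β (D.obj i)).hom)) ≫
    (α_ _ _ _).inv ≫ (dag (D.R i) ▷ z.1) ≫ (λ_ z.1).hom

end TubeStructure

section TubeAStructure

variable (D : IrrData C) (A : Center C)

instance : AddCommGroup (TubeA D A) :=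
  inferInstanceAs (AddCommGroup (∀ i : Fin D.n, (D.obj i ⊗ D.Y ⟶ A.1 ⊗ (D.Y ⊗ D.obj i))))

instance : Module ℂ (TubeA D A) :=
  inferInstanceAs (Module ℂ (∀ i : Fin D.n, (D.obj i ⊗ D.Y ⟶ A.1 ⊗ (D.Y ⊗ D.obj i))))

theorem tubeA_add_apply (f g : TubeA D A) (k : Fin D.n) : (f + g) k = f k + g k := rfl
theorem tubeA_zero_apply (k : Fin D.n) : (0 : TubeA D A) k = 0 := rfl
theorem tubeA_smul_apply (c : ℂ) (f : TubeA D A) (k : Fin D.n) : (c • f) k = c • f k := rfl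

variable [MonObj A]

/-- For `f` with string `x` and `g` with string `y`, the composite
`(x ⊗ y) ⊗ Y ⟶ F(A) ⊗ Y ⊗ (x ⊗ y)` with `g` below and `f` on top: the `A`-strand of `g` crosses
over the string `x` and is then multiplied with the `A`-strand of `f`. -/
def tubeAStack {i j : Fin D.n} (f : D.obj i ⊗ D.Y ⟶ A.1 ⊗ (D.Y ⊗ D.obj i))
    (g : D.obj j ⊗ D.Y ⟶ A.1 ⊗ (D.Y ⊗ D.obj j)) :
    (D.obj i ⊗ D.obj j) ⊗ D.Y ⟶ A.1 ⊗ (D.Y ⊗ (D.obj i ⊗ D.obj j)) :=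
  (α_ _ _ _).hom ≫ (D.obj i ◁ g) ≫ (α_ _ _ _).inv ≫
    ((A.2.β (D.obj i)).inv ▷ (D.Y ⊗ D.obj j)) ≫ (α_ _ _ _).hom ≫
    (A.1 ◁ ((α_ _ _ _).inv ≫ (f ▷ D.obj j) ≫ (α_ _ _ _).hom)) ≫ (α_ _ _ _).inv ≫
    (multHom A ▷ ((D.Y ⊗ D.obj i) ⊗ D.obj j)) ≫ (A.1 ◁ (α_ _ _ _).hom)

/-- The multiplication: stack the tubes and resolve the pair of strings `x, y` into the simple
strings `z` by the fusion relation. -/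
instance : Mul (TubeA D A) :=
  ⟨fun f g k => ∑ i, ∑ j, ∑ a, (D.v i j k a ▷ D.Y) ≫ tubeAStack D A (f i) (g j) ≫
    (A.1 ◁ (D.Y ◁ dag (D.v i j k a)))⟩

/-- The adjoint: the component at `y` is the `†` of the component at `ȳ`, with both `ȳ`-strings
bent around, and the `A`-strand bent up by the cup `m† ∘ i`, crossing over the string `y`. -/
instance : Star (TubeA D A) :=
  ⟨fun f j => (λ_ _).inv ≫ ((unitHom A ≫ dag (multHom A)) ▷ (D.obj j ⊗ D.Y)) ≫ (α_ _ _ _).hom ≫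
    (A.1 ◁ ((α_ _ _ _).inv ≫ ((A.2.β (D.obj j)).hom ▷ D.Y) ≫ (α_ _ _ _).hom ≫
      (D.obj j ◁ (A.1 ◁ ((ρ_ D.Y).inv ≫ (D.Y ◁ D.R j) ≫ (α_ _ _ _).inv))) ≫
      (D.obj j ◁ ((α_ _ _ _).inv ≫ (dag (f (D.bar j)) ▷ D.obj j) ≫ (α_ _ _ _).hom)) ≫
      (α_ _ _ _).inv ≫ (dag (D.Rb j) ▷ (D.Y ⊗ D.obj j)) ≫ (λ_ _).hom))⟩

theorem tubeA_mul_apply (f g : TubeA D A) (k : Fin D.n) :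
    (f * g) k = ∑ i, ∑ j, ∑ a, (D.v i j k a ▷ D.Y) ≫ tubeAStack D A (f i) (g j) ≫
      (A.1 ◁ (D.Y ◁ dag (D.v i j k a))) := rfl

instance : NonUnitalNonAssocRing (TubeA D A) where
  left_distrib f g h := by
    funext k
    simp [tubeA_mul_apply, tubeA_add_apply, tubeAStack, Finset.sum_add_distrib]
  right_distrib f g h := by
    funext k
    simp [tubeA_mul_apply, tubeA_add_apply, tubeAStack, Finset.sum_add_distrib]
  zero_mul f := by
    funext k
    simp [tubeA_mul_apply, tubeA_zero_apply, tubeAStack]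
  mul_zero f := by
    funext k
    simp [tubeA_mul_apply, tubeA_zero_apply, tubeAStack]

instance : SMulCommClass ℂ (TubeA D A) (TubeA D A) where
  smul_comm c f g := by
    funext k
    simp [tubeA_mul_apply, tubeA_smul_apply, tubeAStack, Finset.smul_sum]

instance : IsScalarTower ℂ (TubeA D A) (TubeA D A) where
  smul_assoc c f g := by
    funext k
    simp [tubeA_mul_apply, tubeA_smul_apply, tubeAStack, Finset.smul_sum]

/-- The inclusion `i_A ⊗ - : Tube ⟶ Tube_A`. -/
def tubeIncl : Tube D →ₗ[ℂ] TubeA D A where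
  toFun f := fun i => f i ≫ (λ_ _).inv ≫ (unitHom A ▷ (D.Y ⊗ D.obj i))
  map_add' f g := by
    funext i
    exact Preadditive.add_comp _ _ _ (f i) (g i) _
  map_smul' c f := by
    funext i
    exact Linear.smul_comp _ _ _ c (f i) _

variable {A}

/-- The right action of `f ∈ Tube_A` on `ξ ∈ C(Y ⟶ F(M))` for an `A`-module `M` in the center:
the `A`-strand of `f` acts on `M`, and the `x`-string is closed up around `ξ`, passing the
`M`-strand by the half-braiding of `M` (as the action of `A` on `M` is a morphism of the center, it
does not matter whether it is applied above or below that crossing). -/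
def tubeAAct (M : Mod (Center C) A) (ξ : D.Y ⟶ M.X.1) (f : TubeA D A) : D.Y ⟶ M.X.1 :=
  ∑ i, (λ_ D.Y).inv ≫ (D.R i ▷ D.Y) ≫ (α_ _ _ _).hom ≫
    (D.obj (D.bar i) ◁ (f i ≫ (A.1 ◁ (ξ ▷ D.obj i)) ≫ (α_ _ _ _).inv ≫
      (actionHom M ▷ D.obj i) ≫ (M.X.2.β (D.obj i)).hom)) ≫
    (α_ _ _ _).inv ≫ (dag (D.R i) ▷ M.X.1) ≫ (λ_ M.X.1).hom

variable (A)

/-- For `ξ : Y ⟶ F(z)`, the morphism `i_A ⊗ ξ : Y ⟶ F(A ⊗ z)`. -/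
def unitTensor {z : Center C} (ξ : D.Y ⟶ z.1) : D.Y ⟶ (freeModule A z).X.1 :=
  (ξ ≫ (λ_ z.1).inv ≫ unitHom A ▷ z.1 : D.Y ⟶ A.1 ⊗ z.1)

end TubeAStructure

/-! ### Projections, modules and multiplicities -/

/-- The right ideal `q T`. -/
def rightIdeal {T : Type v} [NonUnitalNonAssocRing T] [Module ℂ T] [SMulCommClass ℂ T T] (q : T) :
    Submodule ℂ T :=
  LinearMap.range (LinearMap.mulLeft ℂ q)

/-- The subspace `(e T) p`. -/
def corner {T : Type v} [NonUnitalNonAssocRing T] [Module ℂ T] [SMulCommClass ℂ T T]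
    [IsScalarTower ℂ T T] (e p : T) : Submodule ℂ T :=
  LinearMap.range (LinearMap.mulRight ℂ p ∘ₗ LinearMap.mulLeft ℂ e)

/-- A minimal projection: a nonzero projection `q` with `q T q = ℂ q`. -/
def IsMinimalProjection {T : Type v} [NonUnitalNonAssocRing T] [Module ℂ T] [Star T] (q : T) :
    Prop :=
  IsStarProjection q ∧ q ≠ 0 ∧ ∀ f : T, ∃ c : ℂ, q * f * q = c • q

/-- An isomorphism of right `Tube`-modules `C(Y ⟶ F(z)) ≅ q Tube`. -/
structure TubeModuleIso (D : IrrData C) (z : Center C) (q : Tube D) where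
  /-- the underlying linear isomorphism -/
  toEquiv : (D.Y ⟶ z.1) ≃ₗ[ℂ] rightIdeal q
  map_act : ∀ (ξ : D.Y ⟶ z.1) (f : Tube D),
    (toEquiv (tubeAct D z ξ f) : Tube D) = (toEquiv ξ : Tube D) * f

/-- An isomorphism of right `Tube_A`-modules `C(Y ⟶ F(M)) ≅ p Tube_A`. -/
structure TubeAModuleIso (D : IrrData C) {A : Center C} [MonObj A] (M : Mod (Center C) A)
    (p : TubeA D A) where
  /-- the underlying linear isomorphism -/
  toEquiv : (D.Y ⟶ M.X.1) ≃ₗ[ℂ] rightIdeal p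
  map_act : ∀ (ξ : D.Y ⟶ M.X.1) (f : TubeA D A),
    (toEquiv (tubeAAct D M ξ f) : TubeA D A) = (toEquiv ξ : TubeA D A) * f

end UFC

/-- `k` is the number of copies of `M` in `X`: the largest `k` such that the direct sum of `k`
copies of `M` is a direct summand of `X`. -/
def IsMultiplicity {B : Type*} [Category B] [Limits.HasZeroMorphisms B] (M X : B) (k : ℕ) : Prop :=
  IsGreatest {l : ℕ | ∃ (s : Fin l → (M ⟶ X)) (r : Fin l → (X ⟶ M)),
    (∀ a, s a ≫ r a = 𝟙 M) ∧ ∀ a b, a ≠ b → s a ≫ r b = 0} k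

end

/-!
The argument rests on a `T`-valued pairing, for `T` the tube algebra or the `A`-tube algebra. For
`z` in the center, `a : Y ⟶ F(z)` and `b : F(z) ⟶ Y`, let `⟨b|a⟩` be the tube whose `x`-component
is the crossing of the `x`-string and the `z`-strand between `a` and `b`, weighted by the quantum
dimension of `x` (`tubePairing`). Fusing a closed string into a parallel string
(`IrrData.sum_vertex_whiskerLeft`) gives `⟨b|a⟩ * f = ⟨b|a·f⟩` (`pairing_mul`), while acting by
`⟨b|a⟩` on `c` amounts to averaging `b ≫ c` over all encircling strings (`objAct_pairing`). As
the average of the identity is the global dimension, which is nonzero, the modules `K_z` are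
reconstructed from these pairings. The fusion identity needs that bending a string preserves
orthogonality of vertices. This holds because the left and right traces agree: by this the Gram
matrix of the bent vertices, which is positive, squares to the identity, so that it is the identity
(`trace_dag_comp`).

The `A`-tube algebra is treated by linearization: a tube `x ⊗ Y ⟶ F(A) ⊗ Y ⊗ x` is the same as an
`A`-linear tube over the free module `F(A) ⊗ Y` (`linearize`), and the product of `A`-tubes becomes
the product of tubes over `F(A) ⊗ Y`. This yields the associativity of the product, and the pairing
of `a : Y ⟶ F(M)` with an `A`-linear `b : F(M) ⟶ F(A) ⊗ Y` with the same two properties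
(`tubeAPairing_mul`, `tubeAAct_pairing`). Separability provides enough such `b`, through the
`A`-linear splitting `coaction` of the action of `M`. Consequences are that every
`Tube_A`-linear map `K_M ⟶ K_N` is composition with a morphism of modules `M ⟶ N`
(`exists_moduleHom_of_intertwiner`), and that the category of modules is von Neumann regular
(`exists_regular_moduleHom`).

The inclusion `i_A ⊗ -` maps `⟨b|a⟩` to the pairing of `i_A ⊗ a` with the `A`-linear map `A ⊗ b`
(`tubeIncl_pairing`). If `K_z ≅ q Tube`, the vector `a` corresponding to `q` is cyclic,
and `h ↦ (i_A ⊗ a)·h` is an isomorphism `(i_A ⊗ q) Tube_A ≅ K_{Az}`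
(`exists_freeModule_iso`). Finally, for `K_M ≅ p Tube_A` and `K_N ≅ e Tube_A`, evaluating morphisms
`M ⟶ N` at the cyclic vector of `K_M` identifies them with `e Tube_A p` (`finrank_corner_eq`).
Minimality of `p` makes the endomorphisms of `M` scalar, so by regularity the composition pairing
between morphisms `M ⟶ N` and `N ⟶ M` is nondegenerate, and a basis of the former with a dual
family of the latter exhibits the maximal number of copies of `M` in `N` (`isMultiplicity_finrank`).
-/

noncomputable section

open UnitaryFusionCategory (dag)

set_option linter.unusedSectionVars false

/-! ### Regular inverses and Schur's lemma -/

section Dagger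

variable {C : Type u} [Category.{v} C] [MonoidalCategory C] [Preadditive C] [Linear ℂ C]
  [MonoidalPreadditive C] [MonoidalLinear ℂ C] [UnitaryFusionCategory C]

attribute [local simp] UnitaryFusionCategory.dag_dag UnitaryFusionCategory.dag_id
  UnitaryFusionCategory.dag_comp UnitaryFusionCategory.dag_add
  UnitaryFusionCategory.dag_smul UnitaryFusionCategory.dag_whiskerLeft
  UnitaryFusionCategory.dag_whiskerRight UnitaryFusionCategory.dag_associator
  UnitaryFusionCategory.dag_leftUnitor UnitaryFusionCategory.dag_rightUnitor

theorem dag_zero (X Y : C) : dag (0 : X ⟶ Y) = 0 := by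
  simpa using UnitaryFusionCategory.dag_smul (0 : ℂ) (0 : X ⟶ Y)

theorem dag_neg {X Y : C} (f : X ⟶ Y) : dag (-f) = -dag f := by
  simpa using UnitaryFusionCategory.dag_smul (-1 : ℂ) f

theorem dag_sub {X Y : C} (f g : X ⟶ Y) : dag (f - g) = dag f - dag g := by
  rw [sub_eq_add_neg, UnitaryFusionCategory.dag_add, dag_neg, sub_eq_add_neg]

theorem dag_sum {X Y : C} {J : Type*} (s : Finset J) (f : J → (X ⟶ Y)) :
    dag (∑ i ∈ s, f i) = ∑ i ∈ s, dag (f i) := by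
  classical
  induction s using Finset.induction_on with
  | empty => simp [dag_zero]
  | insert a s ha ih => rw [Finset.sum_insert ha, Finset.sum_insert ha,
      UnitaryFusionCategory.dag_add, ih]

theorem dag_associator_inv (X Y Z : C) : dag (α_ X Y Z).inv = (α_ X Y Z).hom := by
  rw [← UnitaryFusionCategory.dag_associator, UnitaryFusionCategory.dag_dag]

theorem dag_leftUnitor_inv (X : C) : dag (λ_ X).inv = (λ_ X).hom := by
  rw [← UnitaryFusionCategory.dag_leftUnitor, UnitaryFusionCategory.dag_dag]

theorem dag_rightUnitor_inv (X : C) : dag (ρ_ X).inv = (ρ_ X).hom := by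
  rw [← UnitaryFusionCategory.dag_rightUnitor, UnitaryFusionCategory.dag_dag]

/-- In a finite-dimensional algebra, an element whose square has no larger annihilator than the
element itself has a commuting regular inverse. -/
theorem exists_commute_regular {T : Type*} [Ring T] [Algebra ℂ T] [Module.Finite ℂ T] (k : T)
    (hk : ∀ p : T, k * (k * p) = 0 → k * p = 0) : ∃ r : T, k * r = r * k ∧ k * (k * r) = k := by
  have hmem : k ∈ Algebra.adjoin ℂ {k} := Algebra.self_mem_adjoin_singleton ℂ k
  let k' : Algebra.adjoin ℂ {k} := ⟨k, hmem⟩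
  have hfin : Module.Finite ℂ (Algebra.adjoin ℂ {k}) :=
    FiniteDimensional.finiteDimensional_submodule (Subalgebra.toSubmodule (Algebra.adjoin ℂ {k}))
  let S : Algebra.adjoin ℂ {k} →ₗ[ℂ] Algebra.adjoin ℂ {k} := LinearMap.mulLeft ℂ k'
  have hker : LinearMap.ker (S ∘ₗ S) = LinearMap.ker S := by
    apply le_antisymm
    · intro p hp
      rw [LinearMap.mem_ker] at hp ⊢
      exact Subtype.ext (hk p.1 (congrArg Subtype.val hp))
    · exact LinearMap.ker_le_ker_comp S S
  have hrange : LinearMap.range (S ∘ₗ S) = LinearMap.range S := by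
    apply Submodule.eq_of_le_of_finrank_eq (LinearMap.range_comp_le_range S S)
    have h1 := LinearMap.finrank_range_add_finrank_ker (S ∘ₗ S)
    have h2 := LinearMap.finrank_range_add_finrank_ker S
    rw [hker] at h1
    omega
  have hmemr : k' ∈ LinearMap.range S := ⟨1, mul_one k'⟩
  rw [← hrange] at hmemr
  obtain ⟨r, hr⟩ := hmemr
  exact ⟨r.1, (Algebra.commute_of_mem_adjoin_self r.2).eq, congrArg Subtype.val hr⟩

/-- Every morphism of a unitary fusion category is von Neumann regular. -/
theorem exists_regular_inverse {X Y : C} (f : X ⟶ Y) :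
    ∃ t : Y ⟶ X, f ≫ t ≫ f = f ∧ dag (f ≫ t) = f ≫ t := by
  have : Module.Finite ℂ (End X) := UnitaryFusionCategory.finite_hom X X
  let k : X ⟶ X := f ≫ dag f
  have hk : dag k = k := by simp [k]
  obtain ⟨r, hr1, hr2⟩ := exists_commute_regular (T := End X) k (by
    intro p hp
    apply UnitaryFusionCategory.positive (X := X) (Y := X)
    have hp' : (p ≫ k) ≫ k = 0 := hp
    change (p ≫ k) ≫ dag (p ≫ k) = 0
    rw [UnitaryFusionCategory.dag_comp, hk, ← Category.assoc, hp', Limits.zero_comp])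
  change X ⟶ X at r
  have hr1' : r ≫ k = k ≫ r := hr1
  have hr2' : (r ≫ k) ≫ k = k := hr2
  have hf : (k ≫ r) ≫ f = f := by
    have h0 : (f - (k ≫ r) ≫ f) ≫ dag f = 0 := by
      rw [Preadditive.sub_comp, Category.assoc]
      change k - (k ≫ r) ≫ (f ≫ dag f) = 0
      rw [← hr1']
      exact sub_eq_zero.mpr hr2'.symm
    have h1 : f - (k ≫ r) ≫ f = 0 := by
      apply UnitaryFusionCategory.positive
      rw [dag_sub, UnitaryFusionCategory.dag_comp, Preadditive.comp_sub, h0, zero_sub,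
        ← Category.assoc, h0, Limits.zero_comp, neg_zero]
    exact (sub_eq_zero.mp h1).symm
  refine ⟨dag f ≫ r, ?_, ?_⟩
  · simpa [k] using hf
  · have h1 : dag (k ≫ r) = dag r ≫ k := by
      rw [UnitaryFusionCategory.dag_comp, hk]
    have h2 : dag (k ≫ r) = k ≫ dag r := by
      rw [← hr1', UnitaryFusionCategory.dag_comp, hk]
    -- the idempotent `e = k ≫ r` satisfies `e ≫ e† = e†`, hence is self-adjoint
    have h3 : (k ≫ r) ≫ dag (k ≫ r) = dag (k ≫ r) := by
      rw [h2, ← Category.assoc, ← hr1', hr2']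
    have h4 : dag (k ≫ r) = k ≫ r := by
      conv_rhs => rw [← UnitaryFusionCategory.dag_dag (k ≫ r), ← h3,
        UnitaryFusionCategory.dag_comp, UnitaryFusionCategory.dag_dag, h3]
    simpa [k] using h4

/-- A nonzero morphism out of a simple object is a split monomorphism. -/
theorem exists_retraction {X Y : C} (hX : Simple X) (f : X ⟶ Y) (hf : f ≠ 0) :
    ∃ t : Y ⟶ X, f ≫ t = 𝟙 X := by
  obtain ⟨t, h1, h2⟩ := exists_regular_inverse f
  refine ⟨t, ?_⟩
  obtain ⟨Z, w, hw1, hw2⟩ := UnitaryFusionCategory.exists_split (f ≫ t)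
    (by rw [Category.assoc, ← Category.assoc t, ← Category.assoc f, h1]) h2
  have hmono : Mono w := ⟨fun a b hab => by
    rw [← Category.comp_id a, ← Category.comp_id b, ← hw1, ← Category.assoc, hab, Category.assoc]⟩
  have hw0 : w ≠ 0 := by
    rintro rfl
    apply hf
    rw [← h1, ← Category.assoc, ← hw2, Limits.comp_zero, Limits.zero_comp]
  have := (hX.mono_isIso_iff_nonzero w).mpr hw0
  have hd : dag w = inv w := by
    rw [← cancel_epi w, hw1, IsIso.hom_inv_id]
  rw [← hw2, hd, IsIso.inv_hom_id]

/-- Schur's lemma for endomorphisms. -/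
theorem exists_eq_smul_id {X : C} (hX : Simple X) (f : X ⟶ X) : ∃ c : ℂ, f = c • 𝟙 X := by
  have := UnitaryFusionCategory.finite_hom X X
  have hnt : Nontrivial (X ⟶ X) := ⟨⟨𝟙 X, 0, id_nonzero X⟩⟩
  obtain ⟨c, hc⟩ := Module.End.exists_eigenvalue (Linear.rightComp ℂ X f)
  obtain ⟨g, hg⟩ := hc.exists_hasEigenvector
  refine ⟨c, ?_⟩
  by_contra hne
  obtain ⟨t, ht⟩ := exists_retraction hX (f - c • 𝟙 X) (sub_ne_zero.mpr hne)
  apply hg.2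
  have h1 : g ≫ f = c • g := hg.apply_eq_smul
  rw [← Category.comp_id g, ← ht, ← Category.assoc, Preadditive.comp_sub, h1, Linear.comp_smul,
    Category.comp_id, sub_self, Limits.zero_comp]

theorem smul_id_injective {X : C} [Simple X] {a b : ℂ} (h : a • 𝟙 X = b • 𝟙 X) : a = b :=
  smul_left_injective ℂ (id_nonzero X) h

/-- Schur's lemma for morphisms between different simple objects. -/
theorem isIso_of_simple {X Y : C} (hX : Simple X) (hY : Simple Y) (f : X ⟶ Y) (hf : f ≠ 0) :
    Nonempty (X ≅ Y) := by
  obtain ⟨t, ht⟩ := exists_retraction hX f hf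
  have ht0 : t ≠ 0 := by
    rintro rfl
    rw [Limits.comp_zero] at ht
    exact id_nonzero X ht.symm
  obtain ⟨s, hs⟩ := exists_retraction hY t ht0
  have : f = s := by rw [← Category.comp_id f, ← hs, ← Category.assoc, ht, Category.id_comp]
  exact ⟨⟨f, t, ht, this ▸ hs⟩⟩

/-- If `f f†` is a scalar then this scalar is a nonnegative real number: otherwise `f` together with
a multiple of the identity would be a morphism `F` into a direct sum with `F F† = 0`. -/
theorem scalar_nonneg {X Y : C} (hX : 𝟙 X ≠ 0) (f : X ⟶ Y) (c : ℂ) (h : f ≫ dag f = c • 𝟙 X) :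
    (c.re : ℂ) = c ∧ 0 ≤ c.re := by
  have hinj := smul_left_injective ℂ hX
  have hreal : (starRingEnd ℂ) c = c := by
    apply hinj
    have h' : dag (f ≫ dag f) = f ≫ dag f := by simp
    rw [h, UnitaryFusionCategory.dag_smul, UnitaryFusionCategory.dag_id] at h'
    exact h'
  have hre : (c.re : ℂ) = c := Complex.conj_eq_iff_re.mp hreal
  refine ⟨hre, ?_⟩
  by_contra hneg
  push Not at hneg
  obtain ⟨Z, w, hw1, hw2, -⟩ := UnitaryFusionCategory.exists_sum 2 ![Y, X]
  let w0 : Y ⟶ Z := w 0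
  let w1 : X ⟶ Z := w 1
  have h00 : w0 ≫ dag w0 = 𝟙 Y := hw1 0
  have h11 : w1 ≫ dag w1 = 𝟙 X := hw1 1
  have h01 : w0 ≫ dag w1 = 0 := hw2 0 1 (by decide)
  have h10 : w1 ≫ dag w0 = 0 := hw2 1 0 (by decide)
  let s : ℂ := (Real.sqrt (-c.re) : ℂ)
  have hs : s * s = -c := by
    rw [← Complex.ofReal_mul, Real.mul_self_sqrt (by linarith)]
    simp [hre]
  have hsc : (starRingEnd ℂ) s = s := Complex.conj_ofReal _
  have hF : f ≫ w0 + s • w1 = 0 := by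
    apply UnitaryFusionCategory.positive
    simp only [UnitaryFusionCategory.dag_add, UnitaryFusionCategory.dag_comp,
      UnitaryFusionCategory.dag_smul, hsc, Preadditive.comp_add, Preadditive.add_comp,
      Category.assoc, Linear.smul_comp, Linear.comp_smul, h11, h01]
    rw [← Category.assoc w0, h00, Category.id_comp, h, ← Category.assoc w1, h10]
    simp [smul_smul, hs]
  have h2 : s • 𝟙 X = 0 := by
    have := congrArg (· ≫ dag w1) hF
    simpa [h01, h11] using this
  have h3 : s = 0 := by
    apply hinj
    simpa using h2
  rw [h3, mul_zero] at hs
  have : c = 0 := by simpa using hs.symm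
  rw [this] at hneg
  simp at hneg

end Dagger

/-! ### Conjugate equations and traces -/

section Conjugates

variable {C : Type u} [Category.{v} C] [MonoidalCategory C] [Preadditive C] [Linear ℂ C]
  [MonoidalPreadditive C] [MonoidalLinear ℂ C] [UnitaryFusionCategory C]

attribute [local simp] UnitaryFusionCategory.dag_dag UnitaryFusionCategory.dag_id
  UnitaryFusionCategory.dag_comp UnitaryFusionCategory.dag_add
  UnitaryFusionCategory.dag_smul UnitaryFusionCategory.dag_whiskerLeft
  UnitaryFusionCategory.dag_whiskerRight UnitaryFusionCategory.dag_associator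
  UnitaryFusionCategory.dag_leftUnitor UnitaryFusionCategory.dag_rightUnitor
  dag_associator_inv dag_leftUnitor_inv dag_rightUnitor_inv

/-- The conjugate equations: `R` and `Rb` exhibit `xb` as a two-sided dual of `x`, with evaluations
`Rb†` and `R†`. -/
structure ConjEquations {x xb : C} (R : 𝟙_ C ⟶ xb ⊗ x) (Rb : 𝟙_ C ⟶ x ⊗ xb) : Prop where
  left : x ◁ R ≫ (α_ _ _ _).inv ≫ dag Rb ▷ x = (ρ_ x).hom ≫ (λ_ x).inv
  right : xb ◁ Rb ≫ (α_ _ _ _).inv ≫ dag R ▷ xb = (ρ_ xb).hom ≫ (λ_ xb).inv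

namespace ConjEquations

theorem symm {x xb : C} {R : 𝟙_ C ⟶ xb ⊗ x} {Rb : 𝟙_ C ⟶ x ⊗ xb} (h : ConjEquations R Rb) :
    ConjEquations Rb R := ⟨h.right, h.left⟩

theorem left_dag {x xb : C} {R : 𝟙_ C ⟶ xb ⊗ x} {Rb : 𝟙_ C ⟶ x ⊗ xb} (h : ConjEquations R Rb) :
    Rb ▷ x ≫ (α_ _ _ _).hom ≫ x ◁ dag R = (λ_ x).hom ≫ (ρ_ x).inv := by
  simpa using congrArg dag h.left

/-- A solution of the conjugate equations as an exact pairing. -/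
@[reducible] def exactPairing {x xb : C} {R : 𝟙_ C ⟶ xb ⊗ x} {Rb : 𝟙_ C ⟶ x ⊗ xb}
    (h : ConjEquations R Rb) : ExactPairing xb x where
  coevaluation' := R
  evaluation' := dag Rb
  coevaluation_evaluation' := h.left
  evaluation_coevaluation' := h.symm.left_dag

end ConjEquations

/-- The coevaluation of `x ⊗ y` obtained by nesting those of `x` and `y`. -/
def nestedCoev {x xb y yb : C} (R : 𝟙_ C ⟶ xb ⊗ x) (S : 𝟙_ C ⟶ yb ⊗ y) :
    𝟙_ C ⟶ (yb ⊗ xb) ⊗ (x ⊗ y) :=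
  S ≫ yb ◁ ((λ_ y).inv ≫ R ▷ y ≫ (α_ _ _ _).hom) ≫ (α_ _ _ _).inv

theorem ConjEquations.nested {x xb y yb : C} {R : 𝟙_ C ⟶ xb ⊗ x} {Rb : 𝟙_ C ⟶ x ⊗ xb}
    {S : 𝟙_ C ⟶ yb ⊗ y} {Sb : 𝟙_ C ⟶ y ⊗ yb} (h : ConjEquations R Rb) (k : ConjEquations S Sb) :
    ConjEquations (nestedCoev R S) (nestedCoev Sb Rb) := by
  have key : ∀ {x xb y yb : C} {R : 𝟙_ C ⟶ xb ⊗ x} {Rb : 𝟙_ C ⟶ x ⊗ xb}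
      {S : 𝟙_ C ⟶ yb ⊗ y} {Sb : 𝟙_ C ⟶ y ⊗ yb} (_ : ConjEquations R Rb) (_ : ConjEquations S Sb),
      (x ⊗ y) ◁ nestedCoev R S ≫ (α_ _ _ _).inv ≫ dag (nestedCoev Sb Rb) ▷ (x ⊗ y) =
        (ρ_ (x ⊗ y)).hom ≫ (λ_ (x ⊗ y)).inv := by
    intro x xb y yb R Rb S Sb h k
    let := h.exactPairing
    let := k.exactPairing
    have e := ExactPairing.coevaluation_evaluation (yb ⊗ xb) (x ⊗ y)
    rw [ExactPairing.tensor_coevaluation, ExactPairing.tensor_evaluation] at e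
    rw [← e]
    have h1 : nestedCoev R S = η_ yb y ⊗≫ (yb ◁ η_ xb x) ▷ y ⊗≫ 𝟙 _ := by
      change nestedCoev R S = S ⊗≫ (yb ◁ R) ▷ y ⊗≫ 𝟙 _
      unfold nestedCoev
      monoidal
    have h2 : dag (nestedCoev Sb Rb) = 𝟙 _ ⊗≫ x ◁ (ε_ yb y ▷ xb) ⊗≫ ε_ xb x := by
      change dag (nestedCoev Sb Rb) = 𝟙 _ ⊗≫ x ◁ (dag Sb ▷ xb) ⊗≫ dag Rb
      unfold nestedCoev
      simp only [UnitaryFusionCategory.dag_comp, UnitaryFusionCategory.dag_whiskerLeft,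
        UnitaryFusionCategory.dag_whiskerRight, UnitaryFusionCategory.dag_associator,
        dag_associator_inv, dag_leftUnitor_inv]
      monoidal
    rw [h1, h2]
  exact ⟨key h k, key k.symm h.symm⟩

/-- The left partial trace over `x` of a morphism `x ⊗ P ⟶ x ⊗ Q`. -/
def leftClosure {x xb : C} (R : 𝟙_ C ⟶ xb ⊗ x) {P Q : C} (f : x ⊗ P ⟶ x ⊗ Q) : P ⟶ Q :=
  (λ_ P).inv ≫ (R ▷ P) ≫ (α_ _ _ _).hom ≫ (xb ◁ f) ≫ (α_ _ _ _).inv ≫ (dag R ▷ Q) ≫ (λ_ Q).hom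

/-- The right partial trace over `x` of a morphism `P ⊗ x ⟶ Q ⊗ x`. -/
def rightClosure {x xb : C} (Rb : 𝟙_ C ⟶ x ⊗ xb) {P Q : C} (f : P ⊗ x ⟶ Q ⊗ x) : P ⟶ Q :=
  (ρ_ P).inv ≫ (P ◁ Rb) ≫ (α_ _ _ _).inv ≫ (f ▷ xb) ≫ (α_ _ _ _).hom ≫ (Q ◁ dag Rb) ≫ (ρ_ Q).hom

theorem trace_nested_left {x xb y yb : C} (R : 𝟙_ C ⟶ xb ⊗ x) (S : 𝟙_ C ⟶ yb ⊗ y)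
    (f : x ⊗ y ⟶ x ⊗ y) :
    nestedCoev R S ≫ (yb ⊗ xb) ◁ f ≫ dag (nestedCoev R S) =
      S ≫ yb ◁ leftClosure R f ≫ dag S := by
  simp only [nestedCoev, leftClosure, UnitaryFusionCategory.dag_comp,
    UnitaryFusionCategory.dag_whiskerLeft, UnitaryFusionCategory.dag_whiskerRight,
    UnitaryFusionCategory.dag_associator, dag_associator_inv, dag_leftUnitor_inv]
  monoidal

theorem trace_nested_right {x xb y yb : C} (Rb : 𝟙_ C ⟶ x ⊗ xb) (Sb : 𝟙_ C ⟶ y ⊗ yb)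
    (f : x ⊗ y ⟶ x ⊗ y) :
    nestedCoev Sb Rb ≫ f ▷ (yb ⊗ xb) ≫ dag (nestedCoev Sb Rb) =
      Rb ≫ rightClosure Sb f ▷ xb ≫ dag Rb := by
  simp only [nestedCoev, rightClosure, UnitaryFusionCategory.dag_comp,
    UnitaryFusionCategory.dag_whiskerLeft, UnitaryFusionCategory.dag_whiskerRight,
    UnitaryFusionCategory.dag_associator, dag_associator_inv, dag_leftUnitor_inv]
  monoidal

theorem trace_exchange {x xb y yb : C} (R : 𝟙_ C ⟶ xb ⊗ x) (Sb : 𝟙_ C ⟶ y ⊗ yb)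
    (f : x ⊗ y ⟶ x ⊗ y) :
    Sb ≫ leftClosure R f ▷ yb ≫ dag Sb = R ≫ xb ◁ rightClosure Sb f ≫ dag R := by
  unfold leftClosure rightClosure
  calc
    _ = 𝟙 _ ⊗≫ (𝟙_ C ◁ Sb ≫ R ▷ (y ⊗ yb)) ⊗≫ (xb ◁ f ▷ yb) ⊗≫
        (dag R ▷ (y ⊗ yb) ≫ 𝟙_ C ◁ dag Sb) ⊗≫ 𝟙 _ := by monoidal
    _ = _ := by
      rw [whisker_exchange R Sb, ← whisker_exchange (dag R) (dag Sb)]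
      monoidal

end Conjugates

/-! ### Mates and orthonormal vertices -/

section Mates

variable {C : Type u} [Category.{v} C] [MonoidalCategory C] [Preadditive C] [Linear ℂ C]
  [MonoidalPreadditive C] [MonoidalLinear ℂ C] [UnitaryFusionCategory C]

attribute [local simp] UnitaryFusionCategory.dag_dag UnitaryFusionCategory.dag_id
  UnitaryFusionCategory.dag_comp UnitaryFusionCategory.dag_add
  UnitaryFusionCategory.dag_smul UnitaryFusionCategory.dag_whiskerLeft
  UnitaryFusionCategory.dag_whiskerRight UnitaryFusionCategory.dag_associator
  UnitaryFusionCategory.dag_leftUnitor UnitaryFusionCategory.dag_rightUnitor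
  dag_associator_inv dag_leftUnitor_inv dag_rightUnitor_inv

/-- The mate `kb ⟶ xb` of `f : x ⟶ k`, with respect to a coevaluation `R` of `x` and an evaluation
`rb†` of `k`. -/
def mate {x xb k kb : C} (R : 𝟙_ C ⟶ xb ⊗ x) (rb : 𝟙_ C ⟶ k ⊗ kb) (f : x ⟶ k) : kb ⟶ xb :=
  (λ_ kb).inv ≫ R ▷ kb ≫ (α_ _ _ _).hom ≫ xb ◁ (f ▷ kb ≫ dag rb) ≫ (ρ_ xb).hom

theorem comp_mate {x xb k kb : C} (R : 𝟙_ C ⟶ xb ⊗ x) {r : 𝟙_ C ⟶ kb ⊗ k} {rb : 𝟙_ C ⟶ k ⊗ kb}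
    (hk : ConjEquations r rb) (f : x ⟶ k) : r ≫ mate R rb f ▷ k = R ≫ xb ◁ f := by
  unfold mate
  calc
    _ = 𝟙 _ ⊗≫ (𝟙_ C ◁ r ≫ (R ≫ xb ◁ f) ▷ (kb ⊗ k)) ⊗≫ (xb ◁ dag rb ▷ k) ⊗≫ 𝟙 _ := by monoidal
    _ = 𝟙 _ ⊗≫ (R ≫ xb ◁ f) ⊗≫ xb ◁ (k ◁ r ≫ (α_ _ _ _).inv ≫ dag rb ▷ k) ⊗≫ 𝟙 _ := by
      rw [whisker_exchange]; monoidal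
    _ = _ := by rw [hk.left]; monoidal

/-- A morphism `kb ⟶ xb` can be recovered from its composite with the coevaluation of `k`. -/
theorem coev_whisker_injective {k kb xb : C} {r : 𝟙_ C ⟶ kb ⊗ k} {rb : 𝟙_ C ⟶ k ⊗ kb}
    (hk : ConjEquations r rb) {f g : kb ⟶ xb} (h : r ≫ f ▷ k = r ≫ g ▷ k) : f = g := by
  have key : ∀ f : kb ⟶ xb,
      f = 𝟙 _ ⊗≫ (r ≫ f ▷ k) ▷ kb ⊗≫ xb ◁ dag rb ⊗≫ 𝟙 _ := by
    intro f
    symm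
    calc
      _ = 𝟙 _ ⊗≫ r ▷ kb ⊗≫ (f ▷ (k ⊗ kb) ≫ xb ◁ dag rb) ⊗≫ 𝟙 _ := by monoidal
      _ = 𝟙 _ ⊗≫ (r ▷ kb ≫ (α_ _ _ _).hom ≫ kb ◁ dag rb) ⊗≫ f ⊗≫ 𝟙 _ := by
        rw [← whisker_exchange]; monoidal
      _ = _ := by rw [hk.symm.left_dag]; monoidal
  rw [key f, key g, h]

/-- Every morphism `kb ⟶ xb` is a mate. -/
theorem exists_eq_mate {x xb k kb : C} {R : 𝟙_ C ⟶ xb ⊗ x} {Rb : 𝟙_ C ⟶ x ⊗ xb}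
    (hx : ConjEquations R Rb) {r : 𝟙_ C ⟶ kb ⊗ k} {rb : 𝟙_ C ⟶ k ⊗ kb}
    (hk : ConjEquations r rb) (e : kb ⟶ xb) : ∃ f : x ⟶ k, e = mate R rb f := by
  refine ⟨𝟙 _ ⊗≫ x ◁ (r ≫ e ▷ k) ⊗≫ dag Rb ▷ k ⊗≫ 𝟙 _, ?_⟩
  apply coev_whisker_injective hk
  rw [comp_mate R hk]
  symm
  calc
    _ = 𝟙 _ ⊗≫ (R ▷ 𝟙_ C ≫ (xb ⊗ x) ◁ (r ≫ e ▷ k)) ⊗≫ (xb ◁ dag Rb) ▷ k ⊗≫ 𝟙 _ := by monoidal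
    _ = 𝟙 _ ⊗≫ (r ≫ e ▷ k) ⊗≫ (R ▷ xb ≫ (α_ _ _ _).hom ≫ xb ◁ dag Rb) ▷ k ⊗≫ 𝟙 _ := by
      rw [← whisker_exchange]; monoidal
    _ = _ := by rw [hx.symm.left_dag]; monoidal

theorem comp_dag_mate {x xb k kb : C} {r : 𝟙_ C ⟶ kb ⊗ k} {rb : 𝟙_ C ⟶ k ⊗ kb}
    (hk : ConjEquations r rb) (Rb : 𝟙_ C ⟶ x ⊗ xb) (g : k ⟶ x) :
    rb ≫ k ◁ dag (mate r Rb g) = Rb ≫ dag g ▷ xb := by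
  simp only [mate, UnitaryFusionCategory.dag_comp, UnitaryFusionCategory.dag_whiskerLeft,
    UnitaryFusionCategory.dag_whiskerRight, UnitaryFusionCategory.dag_associator,
    dag_leftUnitor_inv, UnitaryFusionCategory.dag_rightUnitor, UnitaryFusionCategory.dag_dag]
  calc
    _ = 𝟙 _ ⊗≫ (rb ▷ 𝟙_ C ≫ (k ⊗ kb) ◁ (Rb ≫ dag g ▷ xb)) ⊗≫ k ◁ dag r ▷ xb ⊗≫ 𝟙 _ := by
      monoidal
    _ = 𝟙 _ ⊗≫ (Rb ≫ dag g ▷ xb) ⊗≫ (rb ▷ k ≫ (α_ _ _ _).hom ≫ k ◁ dag r) ▷ xb ⊗≫ 𝟙 _ := by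
      rw [← whisker_exchange]; monoidal
    _ = _ := by rw [hk.left_dag]; monoidal

theorem mate_sum {x xb k kb : C} (R : 𝟙_ C ⟶ xb ⊗ x) (rb : 𝟙_ C ⟶ k ⊗ kb) {n : ℕ}
    (c : Fin n → ℂ) (f : Fin n → (x ⟶ k)) :
    mate R rb (∑ a, c a • f a) = ∑ a, c a • mate R rb (f a) := by
  simp [mate, sum_whiskerRight, whiskerLeft_sum,
    Preadditive.sum_comp, Preadditive.comp_sum]

/-- A matrix `G` with `∑_c |G_ac|² = 1` and `G_aa ≥ 1` for all `a` is the identity matrix. -/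
theorem eq_one_of_row_norm {n : ℕ} (G : Fin n → Fin n → ℂ)
    (h1 : ∀ a, ∑ c, G a c * (starRingEnd ℂ) (G a c) = 1)
    (h2 : ∀ a, ((G a a).re : ℂ) = G a a ∧ 1 ≤ (G a a).re) (a b : Fin n) :
    G a b = if a = b then 1 else 0 := by
  have h3 : ∑ c, Complex.normSq (G a c) = 1 := by
    have h := h1 a
    simp only [Complex.mul_conj] at h
    exact_mod_cast h
  have h4 : Complex.normSq (G a a) + ∑ c ∈ Finset.univ.erase a, Complex.normSq (G a c) = 1 := by
    rw [Finset.add_sum_erase _ (fun c => Complex.normSq (G a c)) (Finset.mem_univ a), h3]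
  have h5 : Complex.normSq (G a a) = (G a a).re * (G a a).re := by
    rw [← Complex.normSq_ofReal, (h2 a).1]
  have h6 : 0 ≤ ∑ c ∈ Finset.univ.erase a, Complex.normSq (G a c) :=
    Finset.sum_nonneg fun c _ => Complex.normSq_nonneg _
  have h7 := (h2 a).2
  have h8 : (G a a).re = 1 := by nlinarith
  split_ifs with hab
  · rw [← hab, ← (h2 a).1, h8, Complex.ofReal_one]
  · rw [h5, h8] at h4
    have h9 : ∑ c ∈ Finset.univ.erase a, Complex.normSq (G a c) = 0 := by linarith
    exact Complex.normSq_eq_zero.mp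
      ((Finset.sum_eq_zero_iff_of_nonneg fun c _ => Complex.normSq_nonneg _).mp h9 b
        (Finset.mem_erase.mpr ⟨fun h => hab h.symm, Finset.mem_univ b⟩))

theorem trace_smul {x xb : C} (R : 𝟙_ C ⟶ xb ⊗ x) (c : ℂ) :
    R ≫ (c • 𝟙 xb) ▷ x ≫ dag R = c • (R ≫ dag R) := by
  simp

/-- If the left and right traces on `End x` agree, then the trace of `v_a† v_b` is that of
`v_b v_a†`, for an orthonormal basis `v` of the space of morphisms from a simple object `k` to `x`.
The two mates of `v_a†` have the same Gram matrix `G` by the equality of the traces, and they are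
dual to each other; hence `G² = 1`, and the positivity of `G` forces `G = 1`. -/
theorem trace_dag_comp {x xb k kb : C} {R : 𝟙_ C ⟶ xb ⊗ x} {Rb : 𝟙_ C ⟶ x ⊗ xb}
    (hx : ConjEquations R Rb) {r : 𝟙_ C ⟶ kb ⊗ k} {rb : 𝟙_ C ⟶ k ⊗ kb}
    (hk : ConjEquations r rb) (hkb : Simple kb) {d : ℂ} (hd0 : d ≠ 0)
    (hd : r ≫ dag r = d • 𝟙 (𝟙_ C)) (hd' : rb ≫ dag rb = d • 𝟙 (𝟙_ C))
    (htr : ∀ f : x ⟶ x, R ≫ xb ◁ f ≫ dag R = Rb ≫ f ▷ xb ≫ dag Rb) {n : ℕ}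
    (w : Fin n → (k ⟶ x)) (horth : ∀ a b, w a ≫ dag (w b) = if a = b then 𝟙 k else 0)
    (hspan : ∀ f : k ⟶ x, ∃ c : Fin n → ℂ, f = ∑ a, c a • w a) (a b : Fin n) :
    R ≫ xb ◁ (dag (w a) ≫ w b) ≫ dag R = if a = b then d • 𝟙 (𝟙_ C) else 0 := by
  have hunit : Simple (𝟙_ C) := UnitaryFusionCategory.simple_unit
  -- the two mates of `v_a†` are `E a` and `dag (E' a)`
  let E : Fin n → (kb ⟶ xb) := fun a => mate R rb (dag (w a))
  let E' : Fin n → (xb ⟶ kb) := fun a => mate r Rb (w a)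
  have hE : ∀ a, r ≫ E a ▷ k = R ≫ xb ◁ dag (w a) := fun a => comp_mate R hk _
  have hE' : ∀ a, R ≫ E' a ▷ x = r ≫ kb ◁ w a := fun a => comp_mate r hx _
  have hEd : ∀ a, dag (E a) ▷ k ≫ dag r = xb ◁ w a ≫ dag R := fun a => by
    simpa using congrArg dag (hE a)
  have hE'd : ∀ a, rb ≫ k ◁ dag (E' a) = Rb ≫ dag (w a) ▷ xb := fun a => comp_dag_mate hk _ _
  have hE'dd : ∀ a, k ◁ E' a ≫ dag rb = w a ▷ xb ≫ dag Rb := fun a => by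
    simpa using congrArg dag (hE'd a)
  have hcancel : ∀ s t : ℂ, s • d • 𝟙 (𝟙_ C) = t • d • 𝟙 (𝟙_ C) → s = t := fun s t h => by
    rw [smul_smul, smul_smul] at h
    exact mul_right_cancel₀ hd0 (smul_id_injective h)
  -- the Gram matrix of the mates
  have hG : ∀ a b, ∃ c : ℂ, E a ≫ dag (E b) = c • 𝟙 kb := fun a b => exists_eq_smul_id hkb _
  choose G hG using hG
  have htrG : ∀ a b, R ≫ xb ◁ (dag (w a) ≫ w b) ≫ dag R = G a b • d • 𝟙 (𝟙_ C) := by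
    intro a b
    rw [MonoidalCategory.whiskerLeft_comp, Category.assoc, ← hEd, ← Category.assoc, ← hE, ← hd,
      ← trace_smul, ← hG]
    simp
  have hG' : ∀ a b, dag (E' a) ≫ E' b = G a b • 𝟙 kb := by
    intro a b
    obtain ⟨c, hc⟩ := exists_eq_smul_id hkb (dag (E' a) ≫ E' b)
    have h1 : c • d • 𝟙 (𝟙_ C) = G a b • d • 𝟙 (𝟙_ C) := by
      rw [← htrG, htr, comp_whiskerRight, Category.assoc, ← hE'dd, ← Category.assoc, ← hE'd, ← hd',
        Category.assoc, ← MonoidalCategory.whiskerLeft_comp_assoc, hc]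
      simp
    rw [hc, hcancel _ _ h1]
  -- the two families of mates are dual to each other
  have hdual : ∀ a b, E a ≫ E' b = (if a = b then 1 else 0 : ℂ) • 𝟙 kb := by
    intro a b
    obtain ⟨c, hc⟩ := exists_eq_smul_id hkb (E a ≫ E' b)
    have h1 : c • d • 𝟙 (𝟙_ C) = (if a = b then 1 else 0 : ℂ) • d • 𝟙 (𝟙_ C) := by
      rw [← hd, ← trace_smul, ← hc, comp_whiskerRight, Category.assoc, ← Category.assoc r, hE,
        Category.assoc, whisker_exchange_assoc, ← Category.assoc, hE', Category.assoc,
        ← MonoidalCategory.whiskerLeft_comp_assoc, horth]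
      split_ifs with h1 h2 h2
      · simp
      · exact absurd h1.symm h2
      · exact absurd h2.symm h1
      · simp
    rw [hc, hcancel _ _ h1]
  have hexp : ∀ a, ∃ c : Fin n → ℂ, dag (E a) = ∑ b, c b • E' b := by
    intro a
    obtain ⟨f, hf⟩ := exists_eq_mate hk hx (dag (E a))
    obtain ⟨c, hc⟩ := hspan f
    exact ⟨c, by rw [hf, hc, mate_sum]⟩
  have hEE' : ∀ a, dag (E a) = ∑ b, G b a • E' b := by
    intro a
    obtain ⟨c, hc⟩ := hexp a
    rw [hc]
    refine Finset.sum_congr rfl fun b _ => ?_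
    congr 1
    apply smul_id_injective (X := kb)
    rw [← hG, hc, Preadditive.comp_sum]
    simp [hdual]
  -- `G` is Hermitian and `G² = 1`
  have hrow : ∀ a, ∑ c, G a c * (starRingEnd ℂ) (G a c) = 1 := by
    intro a
    apply smul_id_injective (X := kb)
    have h1 : E a ≫ E' a = ∑ c, (starRingEnd ℂ) (G c a) • (G c a) • 𝟙 kb := by
      rw [← UnitaryFusionCategory.dag_dag (E a), hEE', dag_sum, Preadditive.sum_comp]
      refine Finset.sum_congr rfl fun c _ => ?_
      rw [UnitaryFusionCategory.dag_smul, Linear.smul_comp, hG']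
    have h2 : ∀ c, (starRingEnd ℂ) (G c a) = G a c := by
      intro c
      apply smul_id_injective (X := kb)
      rw [← hG]
      have := congrArg dag (hG c a)
      simpa using this.symm
    have h3 : ∀ c, G c a = (starRingEnd ℂ) (G a c) := fun c => by rw [← h2, Complex.conj_conj]
    rw [hdual, if_pos rfl] at h1
    rw [h1, Finset.sum_smul]
    refine Finset.sum_congr rfl fun c _ => ?_
    rw [h2, h3, smul_smul]
  have hdiag : ∀ a, ((G a a).re : ℂ) = G a a ∧ 1 ≤ (G a a).re := by
    intro a
    have h1 : dag (E a) - E' a = dag (E a - dag (E' a)) := by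
      rw [dag_sub, UnitaryFusionCategory.dag_dag]
    have h2 : dag (E' a) ≫ dag (E a) = 𝟙 kb := by
      have := congrArg dag (hdual a a)
      simpa using this
    have h3 : (E a - dag (E' a)) ≫ dag (E a - dag (E' a)) = (2 * G a a - 2) • 𝟙 kb := by
      rw [← h1, Preadditive.comp_sub, Preadditive.sub_comp, Preadditive.sub_comp, hG, hG', h2,
        hdual, if_pos rfl]
      module
    obtain ⟨h4, h5⟩ := scalar_nonneg (id_nonzero kb) _ _ h3
    simp only [Complex.sub_re, Complex.mul_re, Complex.re_ofNat, Complex.im_ofNat, zero_mul,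
      sub_zero] at h4 h5
    refine ⟨?_, by linarith⟩
    push_cast at h4
    linear_combination h4 / 2
  rw [htrG, eq_one_of_row_norm G hrow hdiag]
  split_ifs <;> simp

end Mates

/-! ### Fusion of a closed string -/

section Fusion

variable {C : Type u} [Category.{v} C] [MonoidalCategory C] [Preadditive C] [Linear ℂ C]
  [MonoidalPreadditive C] [MonoidalLinear ℂ C] [UnitaryFusionCategory C]

attribute [local simp] UnitaryFusionCategory.dag_dag UnitaryFusionCategory.dag_id
  UnitaryFusionCategory.dag_comp UnitaryFusionCategory.dag_add
  UnitaryFusionCategory.dag_smul UnitaryFusionCategory.dag_whiskerLeft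
  UnitaryFusionCategory.dag_whiskerRight UnitaryFusionCategory.dag_associator
  UnitaryFusionCategory.dag_leftUnitor UnitaryFusionCategory.dag_rightUnitor
  dag_associator_inv dag_leftUnitor_inv dag_rightUnitor_inv

namespace IrrData

variable (D : IrrData C)

theorem conjEquations (i : Fin D.n) : ConjEquations (D.R i) (D.Rb i) := by
  have key : ∀ {x xb : C} (R : 𝟙_ C ⟶ xb ⊗ x) (Rb : 𝟙_ C ⟶ x ⊗ xb),
      (ρ_ x).inv ≫ x ◁ R ≫ (α_ _ _ _).inv ≫ dag Rb ▷ x ≫ (λ_ x).hom = 𝟙 x →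
      x ◁ R ≫ (α_ _ _ _).inv ≫ dag Rb ▷ x = (ρ_ x).hom ≫ (λ_ x).inv := by
    intro x xb R Rb h
    rw [Iso.eq_comp_inv, ← cancel_epi (ρ_ x).inv, Iso.inv_hom_id, ← h]
    simp only [Category.assoc]
  exact ⟨key _ _ (D.conj_left i), key _ _ (D.conj_right i)⟩

theorem exists_dim (i : Fin D.n) : ∃ d : ℂ, D.R i ≫ dag (D.R i) = d • 𝟙 (𝟙_ C) :=
  exists_eq_smul_id UnitaryFusionCategory.simple_unit _

/-- The quantum dimension of the simple object `D.obj i`. -/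
def dim (i : Fin D.n) : ℂ := (D.exists_dim i).choose

theorem coev_dag (i : Fin D.n) : D.R i ≫ dag (D.R i) = D.dim i • 𝟙 (𝟙_ C) :=
  (D.exists_dim i).choose_spec

theorem coev_dag' (i : Fin D.n) : D.Rb i ≫ dag (D.Rb i) = D.dim i • 𝟙 (𝟙_ C) := by
  rw [← D.balanced, D.coev_dag]

theorem dim_ne_zero (i : Fin D.n) : D.dim i ≠ 0 := by
  intro h
  have h1 := D.coev_dag i
  rw [h, zero_smul] at h1
  have h2 : D.R i = 0 := UnitaryFusionCategory.positive _ h1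
  have h3 := D.conj_left i
  rw [h2, MonoidalPreadditive.whiskerLeft_zero, Limits.zero_comp, Limits.comp_zero] at h3
  have := D.simple i
  exact id_nonzero _ h3.symm

theorem dim_real (i : Fin D.n) : ((D.dim i).re : ℂ) = D.dim i := by
  have := UnitaryFusionCategory.simple_unit (C := C)
  exact (scalar_nonneg (id_nonzero (𝟙_ C)) _ _ (D.coev_dag i)).1

/-- The sum of the squares of the quantum dimensions. -/
def globalDim : ℂ := ∑ i, D.dim i * D.dim i

theorem globalDim_ne_zero : D.globalDim ≠ 0 := by
  obtain ⟨i, -⟩ := D.exists_iso _ UnitaryFusionCategory.simple_unit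
  have h : D.globalDim = ((∑ i, (D.dim i).re * (D.dim i).re : ℝ) : ℂ) := by
    simp only [globalDim, Complex.ofReal_sum, Complex.ofReal_mul, D.dim_real]
  rw [h, Complex.ofReal_ne_zero]
  apply ne_of_gt
  apply Finset.sum_pos' (fun j _ => mul_self_nonneg _)
  refine ⟨i, Finset.mem_univ i, ?_⟩
  apply mul_self_pos.mpr
  intro h0
  apply D.dim_ne_zero i
  rw [← D.dim_real, h0, Complex.ofReal_zero]

theorem eq_zero_of_ne {i j : Fin D.n} (h : i ≠ j) (f : D.obj i ⟶ D.obj j) : f = 0 := by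
  by_contra hf
  exact h (D.eq_of_iso i j (isIso_of_simple (D.simple i) (D.simple j) f hf))

theorem trace_balanced (i : Fin D.n) (g : D.obj i ⟶ D.obj i) :
    D.R i ≫ D.obj (D.bar i) ◁ g ≫ dag (D.R i) = D.Rb i ≫ g ▷ D.obj (D.bar i) ≫ dag (D.Rb i) := by
  obtain ⟨c, rfl⟩ := exists_eq_smul_id (D.simple i) g
  simp [D.balanced]

theorem trace_nested_balanced (i j : Fin D.n) (f : D.obj i ⊗ D.obj j ⟶ D.obj i ⊗ D.obj j) :
    nestedCoev (D.R i) (D.R j) ≫ (D.obj (D.bar j) ⊗ D.obj (D.bar i)) ◁ f ≫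
        dag (nestedCoev (D.R i) (D.R j)) =
      nestedCoev (D.Rb j) (D.Rb i) ≫ f ▷ (D.obj (D.bar j) ⊗ D.obj (D.bar i)) ≫
        dag (nestedCoev (D.Rb j) (D.Rb i)) := by
  rw [trace_nested_left, trace_nested_right, trace_balanced, trace_exchange, trace_balanced]

theorem exists_eq_sum_vertex {i j k : Fin D.n} (f : D.obj k ⟶ D.obj i ⊗ D.obj j) :
    ∃ c : Fin (D.N i j k) → ℂ, f = ∑ a, c a • D.v i j k a := by
  have h : ∀ a, ∃ c : ℂ, f ≫ dag (D.v i j k a) = c • 𝟙 (D.obj k) := fun a =>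
    exists_eq_smul_id (D.simple k) _
  choose c hc using h
  refine ⟨c, ?_⟩
  conv_lhs => rw [← Category.comp_id f, ← D.v_complete i j]
  rw [Preadditive.comp_sum, Finset.sum_eq_single k]
  · rw [Preadditive.comp_sum]
    refine Finset.sum_congr rfl fun a _ => ?_
    rw [← Category.assoc, hc, Linear.smul_comp, Category.id_comp]
  · intro l _ hl
    rw [Preadditive.comp_sum]
    refine Finset.sum_eq_zero fun a _ => ?_
    rw [← Category.assoc, D.eq_zero_of_ne hl.symm (f ≫ _), Limits.zero_comp]
  · simp

/-- The vertex `x ⟶ k ⊗ ȳ` obtained from the adjoint of a vertex `k ⟶ x ⊗ y` by bending `y`. -/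
def bend {i j k : Fin D.n} (f : D.obj k ⟶ D.obj i ⊗ D.obj j) :
    D.obj i ⟶ D.obj k ⊗ D.obj (D.bar j) :=
  (ρ_ _).inv ≫ D.obj i ◁ D.Rb j ≫ (α_ _ _ _).inv ≫ dag f ▷ D.obj (D.bar j)

theorem bend_comp_dag {i j k : Fin D.n} (a b : Fin (D.N i j k)) :
    D.bend (D.v i j k a) ≫ dag (D.bend (D.v i j k b)) =
      (if a = b then D.dim k / D.dim i else 0 : ℂ) • 𝟙 (D.obj i) := by
  have h1 : D.bend (D.v i j k a) ≫ dag (D.bend (D.v i j k b)) =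
      rightClosure (D.Rb j) (dag (D.v i j k a) ≫ D.v i j k b) := by
    simp only [bend, rightClosure, UnitaryFusionCategory.dag_comp,
      UnitaryFusionCategory.dag_whiskerLeft, UnitaryFusionCategory.dag_whiskerRight,
      dag_associator_inv, dag_rightUnitor_inv, UnitaryFusionCategory.dag_dag, comp_whiskerRight,
      Category.assoc]
  have h2 := trace_dag_comp ((D.conjEquations i).nested (D.conjEquations j)) (D.conjEquations k)
    (D.simple (D.bar k)) (D.dim_ne_zero k) (D.coev_dag k) (D.coev_dag' k)
    (D.trace_nested_balanced i j) (D.v i j k) (D.v_orthonormal i j k) D.exists_eq_sum_vertex a b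
  rw [D.trace_nested_balanced, trace_nested_right, ← h1] at h2
  obtain ⟨c, hc⟩ := exists_eq_smul_id (D.simple i)
    (D.bend (D.v i j k a) ≫ dag (D.bend (D.v i j k b)))
  rw [hc] at h2 ⊢
  congr 1
  simp only [MonoidalLinear.smul_whiskerRight, id_whiskerRight, Linear.comp_smul,
    Linear.smul_comp, Category.id_comp, D.coev_dag', smul_smul] at h2
  have := UnitaryFusionCategory.simple_unit (C := C)
  split_ifs at h2 ⊢
  · exact eq_div_of_mul_eq (D.dim_ne_zero i) (smul_id_injective h2)
  · rw [← zero_smul ℂ (𝟙 (𝟙_ C))] at h2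
    exact (mul_eq_zero.mp (smul_id_injective h2)).resolve_right (D.dim_ne_zero i)

theorem exists_eq_sum_bend {i j k : Fin D.n} (w : D.obj i ⟶ D.obj k ⊗ D.obj (D.bar j)) :
    ∃ c : Fin (D.N i j k) → ℂ, w = ∑ a, c a • D.bend (D.v i j k a) := by
  let f : D.obj k ⟶ D.obj i ⊗ D.obj j :=
    (ρ_ _).inv ≫ D.obj k ◁ D.R j ≫ (α_ _ _ _).inv ≫ dag w ▷ D.obj j
  obtain ⟨c, hc⟩ := D.exists_eq_sum_vertex f
  have h1 : D.bend f = w := by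
    simp only [bend, f, UnitaryFusionCategory.dag_comp,
      UnitaryFusionCategory.dag_whiskerLeft, UnitaryFusionCategory.dag_whiskerRight,
      dag_associator_inv, dag_rightUnitor_inv, UnitaryFusionCategory.dag_dag]
    calc
      _ = 𝟙 _ ⊗≫ (D.obj i ◁ D.Rb j ≫ w ▷ (D.obj j ⊗ D.obj (D.bar j))) ⊗≫
          (D.obj k ◁ dag (D.R j)) ▷ D.obj (D.bar j) ⊗≫ 𝟙 _ := by monoidal
      _ = 𝟙 _ ⊗≫ w ⊗≫ D.obj k ◁ (D.obj (D.bar j) ◁ D.Rb j ≫ (α_ _ _ _).inv ≫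
          dag (D.R j) ▷ D.obj (D.bar j)) ⊗≫ 𝟙 _ := by
        rw [whisker_exchange]; monoidal
      _ = _ := by rw [(D.conjEquations j).right]; monoidal
  refine ⟨fun a => (starRingEnd ℂ) (c a), ?_⟩
  rw [← h1, hc]
  simp [bend, dag_sum, sum_whiskerRight, Preadditive.comp_sum]

/-- The rescaled vertices `x ⟶ k ⊗ ȳ` resolve the identity of `k ⊗ ȳ`. -/
theorem bend_complete (j k : Fin D.n) :
    ∑ i, ∑ a, (D.dim i / D.dim k) • (dag (D.bend (D.v i j k a)) ≫ D.bend (D.v i j k a)) =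
      𝟙 (D.obj k ⊗ D.obj (D.bar j)) := by
  set S := ∑ i, ∑ a, (D.dim i / D.dim k) •
    (dag (D.bend (D.v i j k a)) ≫ D.bend (D.v i j k a)) with hS
  have h1 : ∀ i a, D.bend (D.v i j k a) ≫ S = D.bend (D.v i j k a) := by
    intro i a
    rw [hS, Preadditive.comp_sum, Finset.sum_eq_single i]
    · rw [Preadditive.comp_sum, Finset.sum_eq_single a]
      · rw [Linear.comp_smul, ← Category.assoc, bend_comp_dag, if_pos rfl, Linear.smul_comp,
          Category.id_comp, smul_smul, div_mul_div_cancel₀ (D.dim_ne_zero k),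
          div_self (D.dim_ne_zero i), one_smul]
      · intro b _ hb
        rw [Linear.comp_smul, ← Category.assoc, bend_comp_dag, if_neg hb.symm]
        simp
      · simp
    · intro l _ hl
      rw [Preadditive.comp_sum]
      refine Finset.sum_eq_zero fun b _ => ?_
      rw [Linear.comp_smul, ← Category.assoc, D.eq_zero_of_ne hl.symm (_ ≫ _), Limits.zero_comp,
        smul_zero]
    · simp
  have h2 : ∀ i (w : D.obj i ⟶ D.obj k ⊗ D.obj (D.bar j)), w ≫ S = w := by
    intro i w
    obtain ⟨c, rfl⟩ := D.exists_eq_sum_bend w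
    simp [Preadditive.sum_comp, h1]
  rw [← Category.id_comp S, ← D.v_complete k (D.bar j)]
  simp [Preadditive.sum_comp, h2]

/-- Fusing a closed string `y` with a parallel string `k` into simple strings `x`. -/
theorem sum_vertex_whiskerLeft (j k : Fin D.n) {P Q : C} (f : D.obj j ⊗ P ⟶ D.obj j ⊗ Q) :
    ∑ i, ∑ a, D.dim i • ((D.v i j k a ▷ P) ≫ (α_ _ _ _).hom ≫ (D.obj i ◁ f) ≫
      (α_ _ _ _).inv ≫ (dag (D.v i j k a) ▷ Q)) =
      D.dim k • (D.obj k ◁ leftClosure (D.R j) f) := by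
  have h1 : D.obj k ◁ leftClosure (D.R j) f =
      (𝟙 _ ⊗≫ (D.obj k ◁ D.R j) ▷ P ⊗≫ 𝟙 _) ≫
        (𝟙 (D.obj k ⊗ D.obj (D.bar j)) ▷ (D.obj j ⊗ P)) ≫
        ((D.obj k ⊗ D.obj (D.bar j)) ◁ f ⊗≫ (D.obj k ◁ dag (D.R j)) ▷ Q ⊗≫ 𝟙 _) := by
    unfold leftClosure
    monoidal
  have h2 : ∀ i (f : D.obj k ⟶ D.obj i ⊗ D.obj j),
      f = (ρ_ _).inv ≫ D.obj k ◁ D.R j ≫ (α_ _ _ _).inv ≫ dag (D.bend f) ▷ D.obj j := by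
    intro i f
    symm
    simp only [bend, UnitaryFusionCategory.dag_comp,
      UnitaryFusionCategory.dag_whiskerLeft, UnitaryFusionCategory.dag_whiskerRight,
      dag_associator_inv, dag_rightUnitor_inv, UnitaryFusionCategory.dag_dag]
    calc
      _ = 𝟙 _ ⊗≫ (D.obj k ◁ D.R j ≫ f ▷ (D.obj (D.bar j) ⊗ D.obj j)) ⊗≫
          (D.obj i ◁ dag (D.Rb j)) ▷ D.obj j ⊗≫ 𝟙 _ := by monoidal
      _ = 𝟙 _ ⊗≫ f ⊗≫ D.obj i ◁ (D.obj j ◁ D.R j ≫ (α_ _ _ _).inv ≫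
          dag (D.Rb j) ▷ D.obj j) ⊗≫ 𝟙 _ := by
        rw [whisker_exchange]; monoidal
      _ = _ := by rw [(D.conjEquations j).left]; monoidal
  have h3 : ∀ i (f : D.obj k ⟶ D.obj i ⊗ D.obj j),
      dag f = D.bend f ▷ D.obj j ≫ (α_ _ _ _).hom ≫ D.obj k ◁ dag (D.R j) ≫ (ρ_ _).hom := by
    intro i f
    conv_lhs => rw [h2 i f]
    simp
  have h4 : ∀ i (u : D.obj i ⟶ D.obj k ⊗ D.obj (D.bar j)),
      ((ρ_ _).inv ≫ D.obj k ◁ D.R j ≫ (α_ _ _ _).inv ≫ dag u ▷ D.obj j) ▷ P ≫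
        (α_ _ _ _).hom ≫ (D.obj i ◁ f) ≫ (α_ _ _ _).inv ≫
        (u ▷ D.obj j ≫ (α_ _ _ _).hom ≫ D.obj k ◁ dag (D.R j) ≫ (ρ_ _).hom) ▷ Q =
      (𝟙 _ ⊗≫ (D.obj k ◁ D.R j) ▷ P ⊗≫ 𝟙 _) ≫ (dag u ≫ u) ▷ (D.obj j ⊗ P) ≫
        ((D.obj k ⊗ D.obj (D.bar j)) ◁ f ⊗≫ (D.obj k ◁ dag (D.R j)) ▷ Q ⊗≫ 𝟙 _) := by
    intro i u
    calc
      _ = 𝟙 _ ⊗≫ (D.obj k ◁ D.R j) ▷ P ⊗≫ dag u ▷ (D.obj j ⊗ P) ≫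
          (D.obj i ◁ f ≫ u ▷ (D.obj j ⊗ Q)) ⊗≫ (D.obj k ◁ dag (D.R j)) ▷ Q ⊗≫ 𝟙 _ := by
        monoidal
      _ = _ := by rw [whisker_exchange]; monoidal
  rw [h1, ← D.bend_complete j k]
  simp only [sum_whiskerRight, Preadditive.comp_sum, Preadditive.sum_comp, Finset.smul_sum]
  refine Finset.sum_congr rfl fun i _ => Finset.sum_congr rfl fun a _ => ?_
  simp only [MonoidalLinear.smul_whiskerRight, Linear.comp_smul, Linear.smul_comp, smul_smul]
  rw [mul_div_cancel₀ _ (D.dim_ne_zero k), ← h4, ← h2, ← h3]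

end IrrData

end Fusion

/-! ### Tubes over an arbitrary object -/

section ObjTubes

variable {C : Type u} [Category.{v} C] [MonoidalCategory C] [Preadditive C] [Linear ℂ C]
  [MonoidalPreadditive C] [MonoidalLinear ℂ C] [UnitaryFusionCategory C]

attribute [local simp] UnitaryFusionCategory.dag_dag UnitaryFusionCategory.dag_id
  UnitaryFusionCategory.dag_comp UnitaryFusionCategory.dag_add
  UnitaryFusionCategory.dag_smul UnitaryFusionCategory.dag_whiskerLeft
  UnitaryFusionCategory.dag_whiskerRight UnitaryFusionCategory.dag_associator
  UnitaryFusionCategory.dag_leftUnitor UnitaryFusionCategory.dag_rightUnitor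
  dag_associator_inv dag_leftUnitor_inv dag_rightUnitor_inv

/-- The tubes `⨁_x C(x ⊗ P ⟶ P ⊗ x)` over an arbitrary object `P`. -/
def ObjTube (D : IrrData C) (P : C) : Type v := ∀ i : Fin D.n, (D.obj i ⊗ P ⟶ P ⊗ D.obj i)

/-- The composite `(x ⊗ y) ⊗ P ⟶ P ⊗ (x ⊗ y)` with `g` below and `f` on top. -/
def objStack {P x y : C} (f : x ⊗ P ⟶ P ⊗ x) (g : y ⊗ P ⟶ P ⊗ y) :
    (x ⊗ y) ⊗ P ⟶ P ⊗ (x ⊗ y) :=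
  (α_ _ _ _).hom ≫ (x ◁ g) ≫ (α_ _ _ _).inv ≫ (f ▷ y) ≫ (α_ _ _ _).hom

theorem objStack_assoc {P x y z : C} (f : x ⊗ P ⟶ P ⊗ x) (g : y ⊗ P ⟶ P ⊗ y)
    (h : z ⊗ P ⟶ P ⊗ z) :
    objStack (objStack f g) h =
      (α_ x y z).hom ▷ P ≫ objStack f (objStack g h) ≫ P ◁ (α_ x y z).inv := by
  unfold objStack
  monoidal

theorem objStack_naturality_left {P x x' y : C} (w : x' ⟶ x) (f : x ⊗ P ⟶ P ⊗ x)
    (g : y ⊗ P ⟶ P ⊗ y) :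
    objStack (w ▷ P ≫ f ≫ P ◁ dag w) g =
      (w ▷ y) ▷ P ≫ objStack f g ≫ P ◁ (dag w ▷ y) := by
  unfold objStack
  calc
    _ = (α_ _ _ _).hom ≫ (x' ◁ g ≫ w ▷ (P ⊗ y)) ⊗≫ f ▷ y ⊗≫ P ◁ dag w ▷ y ⊗≫ 𝟙 _ := by monoidal
    _ = _ := by rw [whisker_exchange]; monoidal

theorem objStack_naturality_right {P x y y' : C} (w : y' ⟶ y) (f : x ⊗ P ⟶ P ⊗ x)
    (g : y ⊗ P ⟶ P ⊗ y) :
    objStack f (w ▷ P ≫ g ≫ P ◁ dag w) =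
      (x ◁ w) ▷ P ≫ objStack f g ≫ P ◁ (x ◁ dag w) := by
  unfold objStack
  calc
    _ = 𝟙 _ ⊗≫ x ◁ w ▷ P ⊗≫ x ◁ g ⊗≫ ((x ⊗ P) ◁ dag w ≫ f ▷ y') ⊗≫ 𝟙 _ := by monoidal
    _ = _ := by rw [whisker_exchange]; monoidal

theorem objStack_sum_left {P x y : C} {J : Type*} (s : Finset J) (f : J → (x ⊗ P ⟶ P ⊗ x))
    (g : y ⊗ P ⟶ P ⊗ y) : objStack (∑ a ∈ s, f a) g = ∑ a ∈ s, objStack (f a) g := by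
  simp [objStack, sum_whiskerRight, Preadditive.comp_sum, Preadditive.sum_comp]

theorem objStack_sum_right {P x y : C} {J : Type*} (s : Finset J) (f : x ⊗ P ⟶ P ⊗ x)
    (g : J → (y ⊗ P ⟶ P ⊗ y)) : objStack f (∑ a ∈ s, g a) = ∑ a ∈ s, objStack f (g a) := by
  simp [objStack, whiskerLeft_sum, Preadditive.comp_sum, Preadditive.sum_comp]

/-- Resolving a string `X` into copies of a simple string `m` does not depend on the choice of the
vertices `m ⟶ X`. -/
theorem resolve_independent {m X P Q : C} (hm : Simple m) {I J : Type*} [Fintype I] [Fintype J]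
    (w : I → (m ⟶ X)) (u : J → (m ⟶ X)) (hw : ∀ f : m ⟶ X, f = ∑ a, (f ≫ dag (w a)) ≫ w a)
    (hu : ∀ f : m ⟶ X, f = ∑ a, (f ≫ dag (u a)) ≫ u a) (F : X ⊗ P ⟶ Q ⊗ X) :
    ∑ a, w a ▷ P ≫ F ≫ Q ◁ dag (w a) = ∑ b, u b ▷ P ≫ F ≫ Q ◁ dag (u b) := by
  have h : ∀ a b, ∃ c : ℂ, w a ≫ dag (u b) = c • 𝟙 m := fun a b => exists_eq_smul_id hm _
  choose c hc using h
  have h1 : ∀ a, w a = ∑ b, c a b • u b := fun a => by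
    conv_lhs => rw [hu (w a)]
    simp [hc]
  have h2 : ∀ b, dag (u b) = ∑ a, c a b • dag (w a) := fun b => by
    conv_lhs => rw [hw (u b)]
    rw [dag_sum]
    refine Finset.sum_congr rfl fun a _ => ?_
    simp only [UnitaryFusionCategory.dag_comp, UnitaryFusionCategory.dag_dag]
    rw [← Category.comp_id (dag (w a)), ← Linear.comp_smul, ← hc]
    simp
  have h3 : ∀ a, w a ▷ P ≫ F ≫ Q ◁ dag (w a) =
      ∑ b, c a b • (u b ▷ P ≫ F ≫ Q ◁ dag (w a)) := fun a => by
    conv_lhs => rw [h1 a, sum_whiskerRight, Preadditive.sum_comp]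
    rw [← h1 a]
    simp
  rw [Finset.sum_congr rfl fun a _ => h3 a, Finset.sum_comm]
  refine Finset.sum_congr rfl fun b _ => ?_
  rw [h2 b, whiskerLeft_sum, Preadditive.comp_sum, Preadditive.comp_sum]
  simp

variable (D : IrrData C)

theorem IrrData.vertex_expand {k x y : Fin D.n} (f : D.obj k ⟶ D.obj x ⊗ D.obj y) :
    f = ∑ a, (f ≫ dag (D.v x y k a)) ≫ D.v x y k a := by
  conv_lhs => rw [← Category.comp_id f, ← D.v_complete x y, Preadditive.comp_sum]
  rw [Finset.sum_eq_single k]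
  · simp [Preadditive.comp_sum]
  · intro l _ hl
    rw [Preadditive.comp_sum]
    refine Finset.sum_eq_zero fun a _ => ?_
    rw [← Category.assoc, D.eq_zero_of_ne hl.symm (f ≫ _), Limits.zero_comp]
  · simp

theorem sum_reorder {M : Type*} [AddCommMonoid M] {n : ℕ} {B : Fin n → Type*}
    [∀ k, Fintype (B k)] {E : Fin n → Fin n → Fin n → Type*} [∀ i j k, Fintype (E i j k)]
    (F : ∀ k, B k → ∀ i j, E i j k → M) :
    ∑ k, ∑ b, ∑ i, ∑ j, ∑ a, F k b i j a = ∑ i, ∑ j, ∑ k, ∑ a, ∑ b, F k b i j a := by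
  have h : ∀ k, ∑ b, ∑ i, ∑ j, ∑ a, F k b i j a = ∑ i, ∑ j, ∑ a, ∑ b, F k b i j a := fun k => by
    rw [Finset.sum_comm]
    refine Finset.sum_congr rfl fun i _ => ?_
    rw [Finset.sum_comm]
    exact Finset.sum_congr rfl fun j _ => Finset.sum_comm
  rw [Finset.sum_congr rfl fun k _ => h k, Finset.sum_comm]
  exact Finset.sum_congr rfl fun i _ => Finset.sum_comm

/-- The product of tubes over `P`, defined as in the tube algebra. -/
def objMul {P : C} (f g : ObjTube D P) : ObjTube D P := fun k => ∑ i, ∑ j, ∑ a,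
  (D.v i j k a ▷ P) ≫ objStack (f i) (g j) ≫ (P ◁ dag (D.v i j k a))

/-- Both sides resolve the triple of strings `x ⊗ y ⊗ z` into simple strings, through vertices of
the two possible bracketings; this does not depend on the bracketing by `resolve_independent`. -/
theorem objMul_assoc {P : C} (f g h : ObjTube D P) :
    objMul D (objMul D f g) h = objMul D f (objMul D g h) := by
  funext m
  have hl : ∀ i j l,
      ∑ s : (Σ k, Fin (D.N i j k) × Fin (D.N k l m)),
        (D.v s.1 l m s.2.2 ≫ D.v i j s.1 s.2.1 ▷ D.obj l) ▷ P ≫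
          objStack (objStack (f i) (g j)) (h l) ≫
            P ◁ dag (D.v s.1 l m s.2.2 ≫ D.v i j s.1 s.2.1 ▷ D.obj l) =
      ∑ s : (Σ k, Fin (D.N j l k) × Fin (D.N i k m)),
        (D.v i s.1 m s.2.2 ≫ D.obj i ◁ D.v j l s.1 s.2.1 ≫ (α_ _ _ _).inv) ▷ P ≫
          objStack (objStack (f i) (g j)) (h l) ≫
            P ◁ dag (D.v i s.1 m s.2.2 ≫ D.obj i ◁ D.v j l s.1 s.2.1 ≫ (α_ _ _ _).inv) := by
    intro i j l
    apply resolve_independent (D.simple m)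
      (fun s : (Σ k, Fin (D.N i j k) × Fin (D.N k l m)) =>
        D.v s.1 l m s.2.2 ≫ D.v i j s.1 s.2.1 ▷ D.obj l)
      (fun s : (Σ k, Fin (D.N j l k) × Fin (D.N i k m)) =>
        D.v i s.1 m s.2.2 ≫ D.obj i ◁ D.v j l s.1 s.2.1 ≫ (α_ _ _ _).inv)
    · intro F
      conv_lhs => rw [← Category.comp_id F, ← id_whiskerRight, ← D.v_complete i j]
      rw [Fintype.sum_sigma, sum_whiskerRight, Preadditive.comp_sum]
      refine Finset.sum_congr rfl fun k _ => ?_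
      rw [Fintype.sum_prod_type, sum_whiskerRight, Preadditive.comp_sum]
      refine Finset.sum_congr rfl fun a _ => ?_
      rw [comp_whiskerRight, ← Category.assoc,
        D.vertex_expand (F ≫ dag (D.v i j k a) ▷ D.obj l), Preadditive.sum_comp]
      simp
    · intro F
      have : F = (F ≫ (α_ _ _ _).hom ≫ D.obj i ◁ 𝟙 _) ≫ (α_ _ _ _).inv := by simp
      conv_lhs => rw [this, ← D.v_complete j l]
      rw [Fintype.sum_sigma, whiskerLeft_sum, Preadditive.comp_sum, Preadditive.comp_sum,
        Preadditive.sum_comp]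
      refine Finset.sum_congr rfl fun k _ => ?_
      rw [Fintype.sum_prod_type, whiskerLeft_sum, Preadditive.comp_sum, Preadditive.comp_sum,
        Preadditive.sum_comp]
      refine Finset.sum_congr rfl fun a _ => ?_
      rw [MonoidalCategory.whiskerLeft_comp, ← Category.assoc, ← Category.assoc,
        D.vertex_expand ((F ≫ (α_ _ _ _).hom) ≫ D.obj i ◁ dag (D.v j l k a)),
        Preadditive.sum_comp, Preadditive.sum_comp]
      simp
  have e1 : objMul D (objMul D f g) h m = ∑ l, ∑ i, ∑ j,
      ∑ s : (Σ k, Fin (D.N i j k) × Fin (D.N k l m)),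
        (D.v s.1 l m s.2.2 ≫ D.v i j s.1 s.2.1 ▷ D.obj l) ▷ P ≫
          objStack (objStack (f i) (g j)) (h l) ≫
            P ◁ dag (D.v s.1 l m s.2.2 ≫ D.v i j s.1 s.2.1 ▷ D.obj l) := by
    change ∑ k, ∑ l, ∑ b, (D.v k l m b ▷ P) ≫ objStack (∑ i, ∑ j, ∑ a,
      (D.v i j k a ▷ P) ≫ objStack (f i) (g j) ≫ (P ◁ dag (D.v i j k a))) (h l) ≫
        (P ◁ dag (D.v k l m b)) = _
    rw [Finset.sum_comm]
    refine Finset.sum_congr rfl fun l _ => ?_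
    simp only [objStack_sum_left, objStack_naturality_left, Preadditive.comp_sum,
      Preadditive.sum_comp, Fintype.sum_sigma, Fintype.sum_prod_type]
    rw [sum_reorder]
    simp
  have e2 : objMul D f (objMul D g h) m = ∑ i, ∑ j, ∑ l,
      ∑ s : (Σ k, Fin (D.N j l k) × Fin (D.N i k m)),
        (D.v i s.1 m s.2.2 ≫ D.obj i ◁ D.v j l s.1 s.2.1 ≫ (α_ _ _ _).inv) ▷ P ≫
          objStack (objStack (f i) (g j)) (h l) ≫
            P ◁ dag (D.v i s.1 m s.2.2 ≫ D.obj i ◁ D.v j l s.1 s.2.1 ≫ (α_ _ _ _).inv) := by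
    change ∑ i, ∑ k, ∑ b, (D.v i k m b ▷ P) ≫ objStack (f i) (∑ j, ∑ l, ∑ a,
      (D.v j l k a ▷ P) ≫ objStack (g j) (h l) ≫ (P ◁ dag (D.v j l k a))) ≫
        (P ◁ dag (D.v i k m b)) = _
    refine Finset.sum_congr rfl fun i _ => ?_
    simp only [objStack_sum_right, objStack_naturality_right, Preadditive.comp_sum,
      Preadditive.sum_comp, Fintype.sum_sigma, Fintype.sum_prod_type]
    rw [sum_reorder]
    simp [objStack_assoc, ← comp_whiskerRight_assoc, ← MonoidalCategory.whiskerLeft_comp]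
  rw [e1, e2]
  simp only [hl]
  rw [Finset.sum_comm]
  exact Finset.sum_congr rfl fun i _ => Finset.sum_comm

end ObjTubes

/-! ### Pairings and averages -/

section Pairing

variable {C : Type u} [Category.{v} C] [MonoidalCategory C] [Preadditive C] [Linear ℂ C]
  [MonoidalPreadditive C] [MonoidalLinear ℂ C] [UnitaryFusionCategory C]

attribute [local simp] UnitaryFusionCategory.dag_dag UnitaryFusionCategory.dag_id
  UnitaryFusionCategory.dag_comp UnitaryFusionCategory.dag_add
  UnitaryFusionCategory.dag_smul UnitaryFusionCategory.dag_whiskerLeft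
  UnitaryFusionCategory.dag_whiskerRight UnitaryFusionCategory.dag_associator
  UnitaryFusionCategory.dag_leftUnitor UnitaryFusionCategory.dag_rightUnitor
  dag_associator_inv dag_leftUnitor_inv dag_rightUnitor_inv

theorem braiding_inv_naturality (z : Center C) {U V : C} (f : U ⟶ V) :
    f ▷ z.1 ≫ (z.2.β V).inv = (z.2.β U).inv ≫ z.1 ◁ f := by
  rw [Iso.comp_inv_eq, Category.assoc, Iso.eq_inv_comp, z.2.naturality]

theorem braiding_inv_tensor (z : Center C) (x y : C) :
    (z.2.β (x ⊗ y)).inv = (α_ _ _ _).hom ≫ x ◁ (z.2.β y).inv ≫ (α_ _ _ _).inv ≫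
      (z.2.β x).inv ▷ y ≫ (α_ _ _ _).hom := by
  rw [← cancel_epi (z.2.β (x ⊗ y)).hom, Iso.hom_inv_id, z.2.monoidal]
  simp

theorem leftClosure_whiskerLeft {x xb : C} {R : 𝟙_ C ⟶ xb ⊗ x} {d : ℂ}
    (hd : R ≫ dag R = d • 𝟙 (𝟙_ C)) {P Q : C} (f : P ⟶ Q) :
    leftClosure R (x ◁ f) = d • f := by
  unfold leftClosure
  calc
    _ = 𝟙 _ ⊗≫ (R ▷ P ≫ (xb ⊗ x) ◁ f) ⊗≫ dag R ▷ Q ⊗≫ 𝟙 _ := by monoidal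
    _ = (λ_ P).inv ≫ 𝟙_ C ◁ f ≫ (R ≫ dag R) ▷ Q ≫ (λ_ Q).hom := by
      rw [← whisker_exchange]; monoidal
    _ = _ := by rw [hd]; simp

theorem comp_leftClosure {x xb : C} (R : 𝟙_ C ⟶ xb ⊗ x) {P Q S : C} (g : S ⟶ P)
    (f : x ⊗ P ⟶ x ⊗ Q) : leftClosure R (x ◁ g ≫ f) = g ≫ leftClosure R f := by
  unfold leftClosure
  calc
    _ = 𝟙 _ ⊗≫ (R ▷ S ≫ (xb ⊗ x) ◁ g) ⊗≫ xb ◁ f ⊗≫ dag R ▷ Q ⊗≫ 𝟙 _ := by monoidal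
    _ = _ := by rw [← whisker_exchange]; monoidal

theorem leftClosure_comp {x xb : C} (R : 𝟙_ C ⟶ xb ⊗ x) {P Q S : C} (g : Q ⟶ S)
    (f : x ⊗ P ⟶ x ⊗ Q) : leftClosure R (f ≫ x ◁ g) = leftClosure R f ≫ g := by
  unfold leftClosure
  calc
    _ = 𝟙 _ ⊗≫ R ▷ P ⊗≫ xb ◁ f ⊗≫ ((xb ⊗ x) ◁ g ≫ dag R ▷ S) ⊗≫ 𝟙 _ := by monoidal
    _ = _ := by rw [whisker_exchange]; monoidal

theorem leftClosure_smul {x xb : C} (R : 𝟙_ C ⟶ xb ⊗ x) {P Q : C} (c : ℂ) (f : x ⊗ P ⟶ x ⊗ Q) :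
    leftClosure R (c • f) = c • leftClosure R f := by simp [leftClosure]

theorem leftClosure_zero {x xb : C} (R : 𝟙_ C ⟶ xb ⊗ x) (P Q : C) :
    leftClosure R (0 : x ⊗ P ⟶ x ⊗ Q) = 0 := by simp [leftClosure]

theorem leftClosure_sub {x xb : C} (R : 𝟙_ C ⟶ xb ⊗ x) {P Q : C} (f g : x ⊗ P ⟶ x ⊗ Q) :
    leftClosure R (f - g) = leftClosure R f - leftClosure R g := by
  have h : ∀ f' : x ⊗ P ⟶ x ⊗ Q, leftClosure R (f' + g) = leftClosure R f' + leftClosure R g :=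
    fun f' => by simp [leftClosure]
  rw [eq_sub_iff_add_eq, ← h, sub_add_cancel]

theorem leftClosure_sum {x xb : C} (R : 𝟙_ C ⟶ xb ⊗ x) {P Q : C} {J : Type*} (s : Finset J)
    (f : J → (x ⊗ P ⟶ x ⊗ Q)) : leftClosure R (∑ a ∈ s, f a) = ∑ a ∈ s, leftClosure R (f a) := by
  simp [leftClosure, whiskerLeft_sum, Preadditive.comp_sum, Preadditive.sum_comp]

/-- A positive morphism with vanishing partial trace vanishes. -/
theorem eq_zero_of_leftClosure {x xb : C} {R : 𝟙_ C ⟶ xb ⊗ x} {Rb : 𝟙_ C ⟶ x ⊗ xb}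
    (h : ConjEquations R Rb) {P S : C} (g : S ⟶ x ⊗ P) (hg : leftClosure R (dag g ≫ g) = 0) :
    g = 0 := by
  let w : P ⟶ xb ⊗ S := (λ_ P).inv ≫ R ▷ P ≫ (α_ _ _ _).hom ≫ xb ◁ dag g
  have h1 : w = 0 := by
    apply UnitaryFusionCategory.positive
    rw [← hg]
    simp [w, leftClosure]
  -- `g†` is recovered from `w` by bending the string `x` back
  have h2 : dag g = 𝟙 _ ⊗≫ x ◁ w ⊗≫ dag Rb ▷ S ⊗≫ 𝟙 _ := by
    symm
    simp only [w]
    calc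
      _ = 𝟙 _ ⊗≫ x ◁ R ▷ P ⊗≫ ((x ⊗ xb) ◁ dag g ≫ dag Rb ▷ S) ⊗≫ 𝟙 _ := by monoidal
      _ = 𝟙 _ ⊗≫ (x ◁ R ≫ (α_ _ _ _).inv ≫ dag Rb ▷ x) ▷ P ⊗≫ dag g ⊗≫ 𝟙 _ := by
        rw [whisker_exchange]; monoidal
      _ = _ := by rw [h.left]; monoidal
  rw [← UnitaryFusionCategory.dag_dag g, h2, h1]
  simp [monoidalComp, dag_zero]

variable (D : IrrData C)

/-- The tube-valued pairing of `a : P ⟶ F(z)` and `b : F(z) ⟶ Q`: the `x`-string, weighted by the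
quantum dimension of `x`, crosses the `z`-strand between `a` and `b`. -/
def tubePairing (z : Center C) {P Q : C} (a : P ⟶ z.1) (b : z.1 ⟶ Q) (i : Fin D.n) :
    D.obj i ⊗ P ⟶ Q ⊗ D.obj i :=
  D.dim i • (D.obj i ◁ a ≫ (z.2.β (D.obj i)).inv ≫ b ▷ D.obj i)

/-- The right action of tubes over `P` on `C(P ⟶ F(z))`. -/
def objAct (z : Center C) {P : C} (a : P ⟶ z.1) (f : ObjTube D P) : P ⟶ z.1 :=
  ∑ i, leftClosure (D.R i) (f i ≫ a ▷ D.obj i ≫ (z.2.β (D.obj i)).hom)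

/-- The average of a morphism `F(z) ⟶ F(w)` over all encircling strings. -/
def average (z w : Center C) (t : z.1 ⟶ w.1) : z.1 ⟶ w.1 :=
  ∑ i, D.dim i • leftClosure (D.R i)
    ((z.2.β (D.obj i)).inv ≫ t ▷ D.obj i ≫ (w.2.β (D.obj i)).hom)

theorem objStack_pairing (z : Center C) {P x y k : C} (a : P ⟶ z.1) (b : z.1 ⟶ P)
    (g : y ⊗ P ⟶ P ⊗ y) (p : x ⊗ y ⟶ k) :
    objStack (x ◁ a ≫ (z.2.β x).inv ≫ b ▷ x) g ≫ P ◁ p =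
      ((α_ _ _ _).hom ≫ x ◁ (g ≫ a ▷ y ≫ (z.2.β y).hom) ≫ (α_ _ _ _).inv ≫ p ▷ z.1) ≫
        (z.2.β k).inv ≫ b ▷ k := by
  unfold objStack
  calc
    _ = (α_ _ _ _).hom ≫ x ◁ (g ≫ a ▷ y) ≫ (α_ _ _ _).inv ≫ (z.2.β x).inv ▷ y ≫
        (α_ _ _ _).hom ≫ (b ▷ (x ⊗ y) ≫ P ◁ p) := by monoidal
    _ = (α_ _ _ _).hom ≫ x ◁ (g ≫ a ▷ y) ≫ (α_ _ _ _).inv ≫ (z.2.β x).inv ▷ y ≫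
        (α_ _ _ _).hom ≫ z.1 ◁ p ≫ b ▷ k := by rw [whisker_exchange]
    _ = (α_ _ _ _).hom ≫ x ◁ (g ≫ a ▷ y ≫ (z.2.β y).hom) ≫ (α_ _ _ _).inv ≫
        (z.2.β (x ⊗ y)).inv ≫ z.1 ◁ p ≫ b ▷ k := by
      rw [braiding_inv_tensor]
      simp
    _ = _ := by
      rw [← Category.assoc (z.2.β (x ⊗ y)).inv, ← braiding_inv_naturality]
      simp

/-- The pairing intertwines the action of tubes with their multiplication. -/
theorem pairing_mul (z : Center C) {P : C} (a : P ⟶ z.1) (b : z.1 ⟶ P) (g : ObjTube D P) :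
    objMul D (tubePairing D z a b) g = tubePairing D z (objAct D z a g) b := by
  funext k
  have h : ∀ i j c, (D.v i j k c ▷ P) ≫ objStack (tubePairing D z a b i) (g j) ≫
      (P ◁ dag (D.v i j k c)) =
      (D.dim i • ((D.v i j k c ▷ P) ≫ (α_ _ _ _).hom ≫
        D.obj i ◁ (g j ≫ a ▷ D.obj j ≫ (z.2.β (D.obj j)).hom) ≫ (α_ _ _ _).inv ≫
          dag (D.v i j k c) ▷ z.1)) ≫ (z.2.β (D.obj k)).inv ≫ b ▷ D.obj k := by
    intro i j c
    have h1 : ∀ F : D.obj i ⊗ P ⟶ P ⊗ D.obj i, objStack (D.dim i • F) (g j) =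
        D.dim i • objStack F (g j) := fun F => by simp [objStack]
    rw [tubePairing, h1, Linear.smul_comp, Linear.comp_smul, Linear.smul_comp, objStack_pairing]
    simp only [Category.assoc]
  change ∑ i, ∑ j, ∑ c, (D.v i j k c ▷ P) ≫ objStack (tubePairing D z a b i) (g j) ≫
      (P ◁ dag (D.v i j k c)) = _
  simp only [h, ← Preadditive.sum_comp]
  rw [Finset.sum_comm]
  simp only [D.sum_vertex_whiskerLeft]
  rw [← Finset.smul_sum, ← whiskerLeft_sum, Linear.smul_comp]
  rfl

/-- The action of a pairing is an average. -/
theorem objAct_pairing (z w : Center C) {P Q : C} (a : P ⟶ z.1) (b : z.1 ⟶ Q) (c : Q ⟶ w.1) :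
    ∑ i, leftClosure (D.R i) (tubePairing D z a b i ≫ c ▷ D.obj i ≫ (w.2.β (D.obj i)).hom) =
      a ≫ average D z w (b ≫ c) := by
  rw [average, Preadditive.comp_sum]
  refine Finset.sum_congr rfl fun i _ => ?_
  rw [Linear.comp_smul, ← comp_leftClosure, tubePairing, Linear.smul_comp]
  rw [leftClosure_smul]
  simp

/-- The pairings with a generating family separate the vectors. -/
theorem pairing_eq_zero (z : Center C) {P Q : C} (a : P ⟶ z.1) {J : Type*} [Fintype J]
    (b : J → (z.1 ⟶ Q)) (c : J → (Q ⟶ z.1)) (hbc : ∑ s, b s ≫ c s = 𝟙 z.1) (i : Fin D.n)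
    (h : ∀ s, tubePairing D z a (b s) i = 0) : a = 0 := by
  have h1 : ∀ s, D.obj i ◁ a ≫ (z.2.β (D.obj i)).inv ≫ (b s ≫ c s) ▷ D.obj i = 0 := by
    intro s
    have := h s
    rw [tubePairing, smul_eq_zero_iff_right (D.dim_ne_zero i)] at this
    rw [comp_whiskerRight, ← Category.assoc, ← Category.assoc, Category.assoc (D.obj i ◁ a), this,
      Limits.zero_comp]
  have h2 : D.obj i ◁ a = 0 := by
    have h3 : D.obj i ◁ a ≫ (z.2.β (D.obj i)).inv = 0 := by
      rw [← Category.comp_id (D.obj i ◁ a ≫ _), ← id_whiskerRight, ← hbc, sum_whiskerRight,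
        Preadditive.comp_sum]
      exact Finset.sum_eq_zero fun s _ => by rw [Category.assoc, h1]
    rw [← Category.comp_id (D.obj i ◁ a), ← Iso.inv_hom_id (z.2.β (D.obj i)), ← Category.assoc, h3,
      Limits.zero_comp]
  have h4 := leftClosure_whiskerLeft (D.coev_dag i) a
  rw [h2, eq_comm] at h4
  rw [leftClosure_zero, smul_eq_zero_iff_right (D.dim_ne_zero i)] at h4
  exact h4

theorem average_central_comp (z z' w : Center C) (s : z ⟶ z') (t : z'.1 ⟶ w.1) :
    average D z w (s.f ≫ t) = s.f ≫ average D z' w t := by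
  rw [average, average, Preadditive.comp_sum]
  refine Finset.sum_congr rfl fun i _ => ?_
  rw [Linear.comp_smul, ← comp_leftClosure]
  congr 2
  rw [comp_whiskerRight, Iso.inv_comp_eq, ← s.comm_assoc]
  simp

theorem average_comp_central (z w w' : Center C) (t : z.1 ⟶ w.1) (s : w ⟶ w') :
    average D z w' (t ≫ s.f) = average D z w t ≫ s.f := by
  rw [average, average, Preadditive.sum_comp]
  refine Finset.sum_congr rfl fun i _ => ?_
  rw [Linear.smul_comp, ← leftClosure_comp]
  simp

theorem average_id (z : Center C) : average D z z (𝟙 z.1) = D.globalDim • 𝟙 z.1 := by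
  rw [average, IrrData.globalDim, Finset.sum_smul]
  refine Finset.sum_congr rfl fun i _ => ?_
  rw [id_whiskerRight, Category.id_comp, Iso.inv_hom_id, ← MonoidalCategory.whiskerLeft_id,
    leftClosure_whiskerLeft (D.coev_dag i), smul_smul]

/-- Every object is a direct summand of a sum of copies of `Y`. -/
theorem IrrData.exists_generate (X : C) : ∃ (n : ℕ) (b : Fin n → (X ⟶ D.Y)) (c : Fin n → (D.Y ⟶ X)),
    ∑ s, b s ≫ c s = 𝟙 X := by
  obtain ⟨n, S, w, hS, -, -, hw⟩ := UnitaryFusionCategory.semisimple X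
  choose i hi using fun s => D.exists_iso (S s) (hS s)
  refine ⟨n, fun s => dag (w s) ≫ (hi s).some.hom ≫ D.inc (i s),
    fun s => dag (D.inc (i s)) ≫ (hi s).some.inv ≫ w s, ?_⟩
  rw [← hw]
  refine Finset.sum_congr rfl fun s _ => ?_
  rw [Category.assoc, Category.assoc, ← Category.assoc (D.inc (i s)), D.inc_isometry]
  simp

end Pairing

/-! ### Algebras and modules in the center, seen in the category -/

section Underlying

variable {C : Type u} [Category.{v} C] [MonoidalCategory C] [Preadditive C] [Linear ℂ C]
  [MonoidalPreadditive C] [MonoidalLinear ℂ C] [UnitaryFusionCategory C]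

attribute [local simp] UnitaryFusionCategory.dag_dag UnitaryFusionCategory.dag_id
  UnitaryFusionCategory.dag_comp UnitaryFusionCategory.dag_add
  UnitaryFusionCategory.dag_smul UnitaryFusionCategory.dag_whiskerLeft
  UnitaryFusionCategory.dag_whiskerRight UnitaryFusionCategory.dag_associator
  UnitaryFusionCategory.dag_leftUnitor UnitaryFusionCategory.dag_rightUnitor
  dag_associator_inv dag_leftUnitor_inv dag_rightUnitor_inv

variable (A : Center C) [MonObj A]

theorem unitHom_multHom : unitHom A ▷ A.1 ≫ multHom A = (λ_ A.1).hom :=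
  congrArg Center.Hom.f (MonObj.one_mul A)

theorem multHom_unitHom : A.1 ◁ unitHom A ≫ multHom A = (ρ_ A.1).hom :=
  congrArg Center.Hom.f (MonObj.mul_one A)

theorem multHom_assoc :
    multHom A ▷ A.1 ≫ multHom A = (α_ _ _ _).hom ≫ A.1 ◁ multHom A ≫ multHom A :=
  congrArg Center.Hom.f (MonObj.mul_assoc A)

theorem unitHom_central (U : C) :
    unitHom A ▷ U ≫ (A.2.β U).hom = (λ_ U).hom ≫ (ρ_ U).inv ≫ U ◁ unitHom A := by
  have h := (MonObj.one (X := A)).comm U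
  exact h.trans (Category.assoc _ _ _)

theorem multHom_central (U : C) :
    multHom A ▷ U ≫ (A.2.β U).hom = (α_ _ _ _).hom ≫ A.1 ◁ (A.2.β U).hom ≫ (α_ _ _ _).inv ≫
      (A.2.β U).hom ▷ A.1 ≫ (α_ _ _ _).hom ≫ U ◁ multHom A := by
  have h := (MonObj.mul (X := A)).comm U
  refine h.trans ?_
  change ((α_ _ _ _).hom ≫ A.1 ◁ (A.2.β U).hom ≫ (α_ _ _ _).inv ≫
      (A.2.β U).hom ▷ A.1 ≫ (α_ _ _ _).hom) ≫ U ◁ multHom A = _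
  simp only [Category.assoc]

variable {A} (M : Mod (Center C) A)

theorem unitHom_actionHom : unitHom A ▷ M.X.1 ≫ actionHom M = (λ_ M.X.1).hom :=
  congrArg Center.Hom.f (ModObj.one_smul (M := A) M.X)

theorem multHom_actionHom :
    multHom A ▷ M.X.1 ≫ actionHom M = (α_ _ _ _).hom ≫ A.1 ◁ actionHom M ≫ actionHom M :=
  congrArg Center.Hom.f (ModObj.mul_smul (M := A) M.X)

theorem actionHom_central (U : C) :
    actionHom M ▷ U ≫ (M.X.2.β U).hom = (α_ _ _ _).hom ≫ A.1 ◁ (M.X.2.β U).hom ≫ (α_ _ _ _).inv ≫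
      (A.2.β U).hom ▷ M.X.1 ≫ (α_ _ _ _).hom ≫ U ◁ actionHom M := by
  have h := (ModObj.smul (M := A) (X := M.X)).comm U
  refine h.trans ?_
  change ((α_ _ _ _).hom ≫ A.1 ◁ (M.X.2.β U).hom ≫ (α_ _ _ _).inv ≫
      (A.2.β U).hom ▷ M.X.1 ≫ (α_ _ _ _).hom) ≫ U ◁ actionHom M = _
  simp only [Category.assoc]

theorem actionHom_central_inv (U : C) :
    U ◁ actionHom M ≫ (M.X.2.β U).inv = (α_ _ _ _).inv ≫ (A.2.β U).inv ▷ M.X.1 ≫ (α_ _ _ _).hom ≫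
      A.1 ◁ (M.X.2.β U).inv ≫ (α_ _ _ _).inv ≫ actionHom M ▷ U := by
  rw [Iso.comp_inv_eq]
  simp only [Category.assoc]
  rw [actionHom_central]
  simp

end Underlying

/-! ### The `A`-tube algebra as `A`-linear tubes over `A ⊗ Y` -/

section Linearize

variable {C : Type u} [Category.{v} C] [MonoidalCategory C] [Preadditive C] [Linear ℂ C]
  [MonoidalPreadditive C] [MonoidalLinear ℂ C] [UnitaryFusionCategory C]

attribute [local simp] UnitaryFusionCategory.dag_dag UnitaryFusionCategory.dag_id
  UnitaryFusionCategory.dag_comp UnitaryFusionCategory.dag_add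
  UnitaryFusionCategory.dag_smul UnitaryFusionCategory.dag_whiskerLeft
  UnitaryFusionCategory.dag_whiskerRight UnitaryFusionCategory.dag_associator
  UnitaryFusionCategory.dag_leftUnitor UnitaryFusionCategory.dag_rightUnitor
  dag_associator_inv dag_leftUnitor_inv dag_rightUnitor_inv

variable (A : Center C) [MonObj A]

/-- `A`-linearity of a morphism `U ⊗ P ⟶ Q ⊗ U` with respect to actions `s` and `t` of `F(A)` on `P`
and `Q`: the `A`-strand passes the string `U` by the half-braiding. -/
def IsLinearTube {P Q U : C} (s : A.1 ⊗ P ⟶ P) (t : A.1 ⊗ Q ⟶ Q) (f : U ⊗ P ⟶ Q ⊗ U) : Prop :=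
  U ◁ s ≫ f = (α_ _ _ _).inv ≫ (A.2.β U).inv ▷ P ≫ (α_ _ _ _).hom ≫ A.1 ◁ f ≫
    (α_ _ _ _).inv ≫ t ▷ U

/-- The action of `F(A)` on the free module `F(A) ⊗ P`. -/
def freeAction (P : C) : A.1 ⊗ (A.1 ⊗ P) ⟶ A.1 ⊗ P := (α_ _ _ _).inv ≫ multHom A ▷ P

/-- The inclusion of `P` into the free module `F(A) ⊗ P`. -/
def freeUnit (P : C) : P ⟶ A.1 ⊗ P := (λ_ P).inv ≫ unitHom A ▷ P

theorem freeUnit_freeAction (P : C) : A.1 ◁ freeUnit A P ≫ freeAction A P = 𝟙 _ := by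
  unfold freeUnit freeAction
  calc
    _ = 𝟙 _ ⊗≫ (A.1 ◁ unitHom A ≫ multHom A) ▷ P ⊗≫ 𝟙 _ := by monoidal
    _ = _ := by rw [multHom_unitHom]; monoidal

theorem freeUnit_freeAction' (P : C) : freeUnit A (A.1 ⊗ P) ≫ freeAction A P = 𝟙 _ := by
  unfold freeUnit freeAction
  calc
    _ = 𝟙 _ ⊗≫ (unitHom A ▷ A.1 ≫ multHom A) ▷ P ⊗≫ 𝟙 _ := by monoidal
    _ = _ := by rw [unitHom_multHom]; monoidal

theorem freeUnit_naturality {P Q : C} (f : P ⟶ Q) :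
    f ≫ freeUnit A Q = freeUnit A P ≫ A.1 ◁ f := by
  unfold freeUnit
  rw [Category.assoc, ← whisker_exchange, ← Category.assoc, ← Category.assoc,
    leftUnitor_inv_naturality]

theorem freeAction_assoc (P : C) : multHom A ▷ (A.1 ⊗ P) ≫ freeAction A P =
    (α_ _ _ _).hom ≫ A.1 ◁ freeAction A P ≫ freeAction A P := by
  unfold freeAction
  calc
    _ = 𝟙 _ ⊗≫ (multHom A ▷ A.1 ≫ multHom A) ▷ P ⊗≫ 𝟙 _ := by monoidal
    _ = _ := by rw [multHom_assoc]; monoidal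

/-- The `A`-linear extension of a morphism `U ⊗ P ⟶ F(A) ⊗ (P ⊗ U)` to the free modules. -/
def linearize {P U : C} (f : U ⊗ P ⟶ A.1 ⊗ (P ⊗ U)) : U ⊗ (A.1 ⊗ P) ⟶ (A.1 ⊗ P) ⊗ U :=
  (α_ _ _ _).inv ≫ (A.2.β U).inv ▷ P ≫ (α_ _ _ _).hom ≫ A.1 ◁ f ≫ freeAction A (P ⊗ U) ≫
    (α_ _ _ _).inv

/-- The restriction of a morphism between free modules to the generators. -/
def delinearize {P U : C} (f : U ⊗ (A.1 ⊗ P) ⟶ (A.1 ⊗ P) ⊗ U) : U ⊗ P ⟶ A.1 ⊗ (P ⊗ U) :=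
  U ◁ freeUnit A P ≫ f ≫ (α_ _ _ _).hom

/-- The unit strand passes every string `U` freely. -/
theorem whiskerLeft_freeUnit (P U : C) :
    U ◁ freeUnit A P ≫ (α_ _ _ _).inv ≫ (A.2.β U).inv ▷ P ≫ (α_ _ _ _).hom =
      freeUnit A (U ⊗ P) := by
  have h : (ρ_ U).inv ≫ U ◁ unitHom A ≫ (A.2.β U).inv = (λ_ U).inv ≫ unitHom A ▷ U := by
    rw [← cancel_epi (λ_ U).hom, ← Category.assoc, ← Category.assoc, Iso.comp_inv_eq,
      Category.assoc, ← unitHom_central]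
    simp
  unfold freeUnit
  calc
    _ = 𝟙 _ ⊗≫ ((ρ_ U).inv ≫ U ◁ unitHom A ≫ (A.2.β U).inv) ▷ P ⊗≫ 𝟙 _ := by monoidal
    _ = _ := by rw [h]; monoidal

theorem delinearize_linearize {P U : C} (f : U ⊗ P ⟶ A.1 ⊗ (P ⊗ U)) :
    delinearize A (linearize A f) = f := by
  unfold delinearize linearize
  simp only [Category.assoc, Iso.inv_hom_id, Category.comp_id]
  have h := whiskerLeft_freeUnit A P U
  simp only [← Category.assoc] at h ⊢
  rw [h, ← freeUnit_naturality, Category.assoc, freeUnit_freeAction', Category.comp_id]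

theorem isLinearTube_linearize {P U : C} (f : U ⊗ P ⟶ A.1 ⊗ (P ⊗ U)) :
    IsLinearTube A (freeAction A P) (freeAction A P) (linearize A f) := by
  have h1 : U ◁ multHom A ≫ (A.2.β U).inv = (α_ _ _ _).inv ≫ (A.2.β U).inv ▷ A.1 ≫
      (α_ _ _ _).hom ≫ A.1 ◁ (A.2.β U).inv ≫ (α_ _ _ _).inv ≫ multHom A ▷ U := by
    rw [Iso.comp_inv_eq]
    simp only [Category.assoc]
    rw [multHom_central]
    simp
  unfold IsLinearTube linearize
  calc
    _ = 𝟙 _ ⊗≫ (U ◁ multHom A ≫ (A.2.β U).inv) ▷ P ⊗≫ A.1 ◁ f ≫ freeAction A (P ⊗ U) ⊗≫ 𝟙 _ := by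
      unfold freeAction
      monoidal
    _ = 𝟙 _ ⊗≫ (A.2.β U).inv ▷ (A.1 ⊗ P) ⊗≫ A.1 ◁ (A.2.β U).inv ▷ P ⊗≫
        (multHom A ▷ (U ⊗ P) ≫ A.1 ◁ f) ≫ freeAction A (P ⊗ U) ⊗≫ 𝟙 _ := by
      rw [h1]
      monoidal
    _ = 𝟙 _ ⊗≫ (A.2.β U).inv ▷ (A.1 ⊗ P) ⊗≫ A.1 ◁ (A.2.β U).inv ▷ P ⊗≫
        A.1 ◁ A.1 ◁ f ⊗≫ (multHom A ▷ (A.1 ⊗ (P ⊗ U)) ≫ freeAction A (P ⊗ U)) ⊗≫ 𝟙 _ := by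
      rw [← whisker_exchange]
      monoidal
    _ = _ := by
      rw [freeAction_assoc]
      unfold freeAction
      monoidal

theorem linearize_delinearize {P U : C} (f : U ⊗ (A.1 ⊗ P) ⟶ (A.1 ⊗ P) ⊗ U)
    (hf : IsLinearTube A (freeAction A P) (freeAction A P) f) :
    linearize A (delinearize A f) = f := by
  unfold IsLinearTube at hf
  unfold linearize delinearize
  symm
  calc
    f = U ◁ A.1 ◁ freeUnit A P ≫ U ◁ freeAction A P ≫ f := by
      rw [← MonoidalCategory.whiskerLeft_comp_assoc, freeUnit_freeAction]
      simp
    _ = 𝟙 _ ⊗≫ ((U ⊗ A.1) ◁ freeUnit A P ≫ (A.2.β U).inv ▷ (A.1 ⊗ P)) ⊗≫ A.1 ◁ f ⊗≫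
        freeAction A P ▷ U := by
      rw [hf]
      monoidal
    _ = _ := by
      rw [whisker_exchange]
      unfold freeAction
      monoidal

theorem isLinearTube_objStack {P U V : C} {s : A.1 ⊗ P ⟶ P} {f : U ⊗ P ⟶ P ⊗ U}
    {g : V ⊗ P ⟶ P ⊗ V} (hf : IsLinearTube A s s f) (hg : IsLinearTube A s s g) :
    IsLinearTube A s s (objStack f g) := by
  unfold IsLinearTube at hf hg ⊢
  unfold objStack
  calc
    _ = 𝟙 _ ⊗≫ U ◁ (V ◁ s ≫ g) ⊗≫ f ▷ V ⊗≫ 𝟙 _ := by monoidal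
    _ = 𝟙 _ ⊗≫ U ◁ (A.2.β V).inv ▷ P ⊗≫ (U ⊗ A.1) ◁ g ⊗≫ (U ◁ s ≫ f) ▷ V ⊗≫ 𝟙 _ := by
      rw [hg]
      monoidal
    _ = 𝟙 _ ⊗≫ U ◁ (A.2.β V).inv ▷ P ⊗≫ ((U ⊗ A.1) ◁ g ≫ (A.2.β U).inv ▷ (P ⊗ V)) ⊗≫
        A.1 ◁ f ▷ V ⊗≫ s ▷ (U ⊗ V) ⊗≫ 𝟙 _ := by
      rw [hf]
      monoidal
    _ = _ := by
      rw [whisker_exchange, braiding_inv_tensor]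
      monoidal

theorem isLinearTube_conj {P U V : C} {s : A.1 ⊗ P ⟶ P} {f : U ⊗ P ⟶ P ⊗ U}
    (hf : IsLinearTube A s s f) (w : V ⟶ U) (w' : U ⟶ V) :
    IsLinearTube A s s (w ▷ P ≫ f ≫ P ◁ w') := by
  unfold IsLinearTube at hf ⊢
  calc
    _ = (V ◁ s ≫ w ▷ P) ≫ f ≫ P ◁ w' := by simp
    _ = w ▷ (A.1 ⊗ P) ≫ (U ◁ s ≫ f) ≫ P ◁ w' := by rw [whisker_exchange]; simp
    _ = 𝟙 _ ⊗≫ (w ▷ A.1 ≫ (A.2.β U).inv) ▷ P ⊗≫ A.1 ◁ f ⊗≫ (s ▷ U ≫ P ◁ w') := by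
      rw [hf]
      monoidal
    _ = _ := by
      rw [braiding_inv_naturality, ← whisker_exchange]
      monoidal

theorem isLinearTube_sum {P Q U : C} {s : A.1 ⊗ P ⟶ P} {t : A.1 ⊗ Q ⟶ Q} {J : Type*}
    (S : Finset J) (f : J → (U ⊗ P ⟶ Q ⊗ U)) (hf : ∀ a ∈ S, IsLinearTube A s t (f a)) :
    IsLinearTube A s t (∑ a ∈ S, f a) := by
  unfold IsLinearTube at hf ⊢
  rw [Preadditive.comp_sum, whiskerLeft_sum]
  simp only [Preadditive.comp_sum, Preadditive.sum_comp]
  exact Finset.sum_congr rfl hf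

variable (D : IrrData C)

/-- The tube over `F(A) ⊗ Y` defined by an element of the `A`-tube algebra. -/
def tubeALin (f : TubeA D A) : ObjTube D (A.1 ⊗ D.Y) := fun i => linearize A (f i)

theorem delinearize_objStack {i j : Fin D.n} (f : D.obj i ⊗ D.Y ⟶ A.1 ⊗ (D.Y ⊗ D.obj i))
    (g : D.obj j ⊗ D.Y ⟶ A.1 ⊗ (D.Y ⊗ D.obj j)) :
    delinearize A (objStack (linearize A f) (linearize A g)) = tubeAStack D A f g := by
  have h := delinearize_linearize A g
  unfold delinearize at h ⊢
  unfold objStack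
  calc
    _ = 𝟙 _ ⊗≫ D.obj i ◁ (D.obj j ◁ freeUnit A D.Y ≫ linearize A g ≫ (α_ _ _ _).hom) ⊗≫
        linearize A f ▷ D.obj j ⊗≫ 𝟙 _ := by monoidal
    _ = _ := by
      rw [h]
      unfold linearize freeAction tubeAStack
      monoidal

theorem delinearize_objMul (f g : TubeA D A) (k : Fin D.n) :
    delinearize A (objMul D (tubeALin A D f) (tubeALin A D g) k) = (f * g) k := by
  rw [tubeA_mul_apply]
  unfold objMul tubeALin
  simp only [delinearize, Preadditive.comp_sum, Preadditive.sum_comp]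
  refine Finset.sum_congr rfl fun i _ => Finset.sum_congr rfl fun j _ =>
    Finset.sum_congr rfl fun a _ => ?_
  rw [← delinearize_objStack]
  unfold delinearize
  simp only [Category.assoc]
  rw [whisker_exchange_assoc]
  simp

theorem tubeALin_mul (f g : TubeA D A) :
    tubeALin A D (f * g) = objMul D (tubeALin A D f) (tubeALin A D g) := by
  funext k
  unfold tubeALin
  rw [← delinearize_objMul, linearize_delinearize]
  · rfl
  · exact isLinearTube_sum A _ _ fun i _ => isLinearTube_sum A _ _ fun j _ =>
      isLinearTube_sum A _ _ fun a _ => isLinearTube_conj A (isLinearTube_objStack A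
        (isLinearTube_linearize A _) (isLinearTube_linearize A _)) _ _

/-- Associativity is inherited from the tubes over `F(A) ⊗ Y` through linearization. -/
theorem tubeA_mul_assoc (f g h : TubeA D A) : f * g * h = f * (g * h) := by
  funext k
  rw [← delinearize_objMul, ← delinearize_objMul, tubeALin_mul, tubeALin_mul, objMul_assoc]

theorem tube_mul_assoc (f g h : Tube D) : f * g * h = f * (g * h) :=
  objMul_assoc D (P := D.Y) f g h

end Linearize

/-! ### The action of the `A`-tube algebra -/

section Action

variable {C : Type u} [Category.{v} C] [MonoidalCategory C] [Preadditive C] [Linear ℂ C]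
  [MonoidalPreadditive C] [MonoidalLinear ℂ C] [UnitaryFusionCategory C]

attribute [local simp] UnitaryFusionCategory.dag_dag UnitaryFusionCategory.dag_id
  UnitaryFusionCategory.dag_comp UnitaryFusionCategory.dag_add
  UnitaryFusionCategory.dag_smul UnitaryFusionCategory.dag_whiskerLeft
  UnitaryFusionCategory.dag_whiskerRight UnitaryFusionCategory.dag_associator
  UnitaryFusionCategory.dag_leftUnitor UnitaryFusionCategory.dag_rightUnitor
  dag_associator_inv dag_leftUnitor_inv dag_rightUnitor_inv

variable {A : Center C} [MonObj A]

/-- The `A`-linear extension of `a : P ⟶ F(M)` to the free module on `P`. -/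
def linearExt (M : Mod (Center C) A) {P : C} (a : P ⟶ M.X.1) : A.1 ⊗ P ⟶ M.X.1 :=
  A.1 ◁ a ≫ actionHom M

theorem freeUnit_linearExt (M : Mod (Center C) A) {P : C} (a : P ⟶ M.X.1) :
    freeUnit A P ≫ linearExt M a = a := by
  unfold linearExt
  rw [← Category.assoc, ← freeUnit_naturality, Category.assoc]
  unfold freeUnit
  rw [Category.assoc, unitHom_actionHom, Iso.inv_hom_id, Category.comp_id]

theorem freeAction_linearExt (M : Mod (Center C) A) {P : C} (a : P ⟶ M.X.1) :
    freeAction A P ≫ linearExt M a = A.1 ◁ linearExt M a ≫ actionHom M := by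
  unfold linearExt freeAction
  calc
    _ = (α_ _ _ _).inv ≫ (multHom A ▷ P ≫ A.1 ◁ a) ≫ actionHom M := by simp
    _ = 𝟙 _ ⊗≫ (A.1 ⊗ A.1) ◁ a ≫ (multHom A ▷ M.X.1 ≫ actionHom M) := by
      rw [← whisker_exchange]
      simp [monoidalComp]
    _ = _ := by
      rw [multHom_actionHom]
      monoidal

/-- `A`-linearity of a morphism of `C` from a module to the free module on `P`. It need not be a
morphism of the center: `F(A) ⊗ P` carries no half-braiding. -/
def IsLinearToFree (M : Mod (Center C) A) {P : C} (b : M.X.1 ⟶ A.1 ⊗ P) : Prop :=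
  actionHom M ≫ b = A.1 ◁ b ≫ freeAction A P

theorem isLinearTube_pairing (M : Mod (Center C) A) {P Q U : C} (a : P ⟶ M.X.1)
    {b : M.X.1 ⟶ A.1 ⊗ Q} (hb : IsLinearToFree M b) :
    IsLinearTube A (freeAction A P) (freeAction A Q)
      (U ◁ linearExt M a ≫ (M.X.2.β U).inv ≫ b ▷ U) := by
  unfold IsLinearTube
  unfold IsLinearToFree at hb
  calc
    _ = U ◁ (freeAction A P ≫ linearExt M a) ≫ (M.X.2.β U).inv ≫ b ▷ U := by simp
    _ = U ◁ (A.1 ◁ linearExt M a) ≫ (U ◁ actionHom M ≫ (M.X.2.β U).inv) ≫ b ▷ U := by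
      rw [freeAction_linearExt]
      simp
    _ = 𝟙 _ ⊗≫ ((U ⊗ A.1) ◁ linearExt M a ≫ (A.2.β U).inv ▷ M.X.1) ⊗≫
        A.1 ◁ (M.X.2.β U).inv ⊗≫ (actionHom M ≫ b) ▷ U := by
      rw [actionHom_central_inv]
      monoidal
    _ = _ := by
      rw [whisker_exchange, hb]
      monoidal

variable (D : IrrData C)

/-- The `A`-tube-valued pairing of `a : Y ⟶ F(M)` and an `A`-linear `b : F(M) ⟶ F(A) ⊗ Y`. -/
def tubeAPairing (M : Mod (Center C) A) (a : D.Y ⟶ M.X.1) (b : M.X.1 ⟶ A.1 ⊗ D.Y) : TubeA D A :=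
  fun i => tubePairing D M.X a b i ≫ (α_ _ _ _).hom

theorem delinearize_pairing (z : Center C) (a : A.1 ⊗ D.Y ⟶ z.1) (b : z.1 ⟶ A.1 ⊗ D.Y)
    (i : Fin D.n) : delinearize A (tubePairing D z a b i) =
      tubePairing D z (freeUnit A D.Y ≫ a) b i ≫ (α_ _ _ _).hom := by
  simp [delinearize, tubePairing]

theorem tubeALin_pairing (M : Mod (Center C) A) (a : D.Y ⟶ M.X.1) {b : M.X.1 ⟶ A.1 ⊗ D.Y}
    (hb : IsLinearToFree M b) :
    tubeALin A D (tubeAPairing D M a b) = tubePairing D M.X (linearExt M a) b := by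
  funext i
  have h1 : tubeAPairing D M a b i = delinearize A (tubePairing D M.X (linearExt M a) b i) := by
    rw [delinearize_pairing, freeUnit_linearExt]
    rfl
  have h2 : IsLinearTube A (freeAction A D.Y) (freeAction A D.Y)
      (tubePairing D M.X (linearExt M a) b i) := by
    have := isLinearTube_pairing (U := D.obj i) M a hb
    unfold IsLinearTube at this ⊢
    unfold tubePairing
    simp only [Linear.comp_smul, this, MonoidalLinear.whiskerLeft_smul, Linear.smul_comp]
  unfold tubeALin
  rw [h1, linearize_delinearize A _ h2]

theorem tubeAAct_eq (M : Mod (Center C) A) (a : D.Y ⟶ M.X.1) (f : TubeA D A) :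
    tubeAAct D M a f = freeUnit A D.Y ≫ objAct D M.X (linearExt M a) (tubeALin A D f) := by
  unfold tubeAAct objAct
  rw [Preadditive.comp_sum]
  refine Finset.sum_congr rfl fun i _ => ?_
  rw [← comp_leftClosure]
  have h := delinearize_linearize A (f i)
  change leftClosure (D.R i) (f i ≫ A.1 ◁ a ▷ D.obj i ≫ (α_ _ _ _).inv ≫
    actionHom M ▷ D.obj i ≫ (M.X.2.β (D.obj i)).hom) = _
  congr 1
  conv_lhs => rw [← h]
  unfold delinearize tubeALin linearExt
  simp

/-- The pairing intertwines the action of the `A`-tube algebra with its multiplication. -/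
theorem tubeAPairing_mul (M : Mod (Center C) A) (a : D.Y ⟶ M.X.1) {b : M.X.1 ⟶ A.1 ⊗ D.Y}
    (hb : IsLinearToFree M b) (f : TubeA D A) :
    tubeAPairing D M a b * f = tubeAPairing D M (tubeAAct D M a f) b := by
  funext k
  rw [← delinearize_objMul, tubeALin_pairing D M a hb, pairing_mul, delinearize_pairing,
    ← tubeAAct_eq]
  rfl

theorem tubeAAct_pairing (M N : Mod (Center C) A) (a : D.Y ⟶ M.X.1) (b : M.X.1 ⟶ A.1 ⊗ D.Y)
    (c : D.Y ⟶ N.X.1) :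
    tubeAAct D N c (tubeAPairing D M a b) = a ≫ average D M.X N.X (b ≫ linearExt N c) := by
  rw [← objAct_pairing]
  unfold tubeAAct
  refine Finset.sum_congr rfl fun i _ => ?_
  change leftClosure (D.R i) (tubeAPairing D M a b i ≫ A.1 ◁ c ▷ D.obj i ≫ (α_ _ _ _).inv ≫
    actionHom N ▷ D.obj i ≫ (N.X.2.β (D.obj i)).hom) = _
  congr 1
  unfold tubeAPairing linearExt
  simp

theorem tubeAAct_add (M : Mod (Center C) A) (a : D.Y ⟶ M.X.1) (f g : TubeA D A) :
    tubeAAct D M a (f + g) = tubeAAct D M a f + tubeAAct D M a g := by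
  simp [tubeAAct, tubeA_add_apply, Finset.sum_add_distrib]

theorem tubeAAct_smul (M : Mod (Center C) A) (a : D.Y ⟶ M.X.1) (c : ℂ) (f : TubeA D A) :
    tubeAAct D M a (c • f) = c • tubeAAct D M a f := by
  simp [tubeAAct, tubeA_smul_apply, Finset.smul_sum]

/-- The action of the `A`-tube algebra as a bilinear map. -/
def tubeAActLin (M : Mod (Center C) A) :
    (D.Y ⟶ M.X.1) →ₗ[ℂ] TubeA D A →ₗ[ℂ] (D.Y ⟶ M.X.1) :=
  LinearMap.mk₂ ℂ (tubeAAct D M)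
    (fun a a' f => by simp [tubeAAct, Finset.sum_add_distrib])
    (fun c a f => by simp [tubeAAct, Finset.smul_sum])
    (tubeAAct_add D M) (fun c a f => tubeAAct_smul D M a c f)

theorem average_add (z w : Center C) (s t : z.1 ⟶ w.1) :
    average D z w (s + t) = average D z w s + average D z w t := by
  simp [average, leftClosure, Finset.sum_add_distrib]

theorem average_sum (z w : Center C) {J : Type*} (S : Finset J) (t : J → (z.1 ⟶ w.1)) :
    average D z w (∑ j ∈ S, t j) = ∑ j ∈ S, average D z w (t j) :=
  map_sum (AddMonoidHom.mk' (average D z w) (average_add D z w)) t S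

/-- The `A`-linear splitting of the action of a module, built from `m† ∘ i`. -/
def coaction (M : Mod (Center C) A) : M.X.1 ⟶ A.1 ⊗ M.X.1 :=
  (λ_ _).inv ≫ (unitHom A ≫ dag (multHom A)) ▷ M.X.1 ≫ (α_ _ _ _).hom ≫ A.1 ◁ actionHom M

theorem coaction_actionHom (hA : IsCondensable A) (M : Mod (Center C) A) :
    coaction M ≫ actionHom M = 𝟙 M.X.1 := by
  unfold coaction
  calc
    _ = (λ_ _).inv ≫ (unitHom A ≫ dag (multHom A)) ▷ M.X.1 ≫
        ((α_ _ _ _).hom ≫ A.1 ◁ actionHom M ≫ actionHom M) := by simp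
    _ = (λ_ _).inv ≫ (unitHom A ≫ dag (multHom A) ≫ multHom A) ▷ M.X.1 ≫ actionHom M := by
      rw [← multHom_actionHom]
      simp
    _ = _ := by
      rw [hA.separable, Category.comp_id, unitHom_actionHom, Iso.inv_hom_id]

theorem isLinear_coaction (hA : IsCondensable A) (M : Mod (Center C) A) :
    IsLinearToFree M (coaction M) := by
  have hF := hA.frobenius
  have hF' : dag (multHom A) ▷ A.1 ≫ (α_ _ _ _).hom ≫ A.1 ◁ multHom A =
      multHom A ≫ dag (multHom A) := by
    simpa using congrArg dag hF
  unfold IsLinearToFree coaction freeAction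
  -- both sides are `m†` on the `A`-strand followed by the action
  trans (dag (multHom A) ▷ M.X.1 ≫ (α_ _ _ _).hom ≫ A.1 ◁ actionHom M)
  · calc
      _ = 𝟙 _ ⊗≫ (𝟙_ C ◁ actionHom M ≫ (unitHom A ≫ dag (multHom A)) ▷ M.X.1) ⊗≫
          A.1 ◁ actionHom M := by monoidal
      _ = 𝟙 _ ⊗≫ (unitHom A ≫ dag (multHom A)) ▷ (A.1 ⊗ M.X.1) ⊗≫
          A.1 ◁ ((α_ _ _ _).hom ≫ A.1 ◁ actionHom M ≫ actionHom M) := by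
        rw [whisker_exchange]
        monoidal
      _ = 𝟙 _ ⊗≫ (unitHom A ▷ A.1 ≫ dag (multHom A) ▷ A.1 ≫ (α_ _ _ _).hom ≫
          A.1 ◁ multHom A) ▷ M.X.1 ⊗≫ A.1 ◁ actionHom M := by
        rw [← multHom_actionHom]
        monoidal
      _ = _ := by
        rw [hF', ← Category.assoc (unitHom A ▷ A.1), unitHom_multHom]
        monoidal
  · symm
    calc
      _ = 𝟙 _ ⊗≫ A.1 ◁ (unitHom A ≫ dag (multHom A)) ▷ M.X.1 ⊗≫
          ((A.1 ⊗ A.1) ◁ actionHom M ≫ multHom A ▷ M.X.1) := by monoidal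
      _ = 𝟙 _ ⊗≫ (A.1 ◁ unitHom A ≫ A.1 ◁ dag (multHom A) ≫ (α_ _ _ _).inv ≫
          multHom A ▷ A.1) ▷ M.X.1 ⊗≫ A.1 ◁ actionHom M := by
        rw [whisker_exchange]
        monoidal
      _ = _ := by
        rw [hF, ← Category.assoc (A.1 ◁ unitHom A), multHom_unitHom]
        monoidal

theorem IsLinearToFree.comp {M : Mod (Center C) A} {P Q : C} {b : M.X.1 ⟶ A.1 ⊗ P}
    (hb : IsLinearToFree M b) (c : P ⟶ Q) : IsLinearToFree M (b ≫ A.1 ◁ c) := by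
  unfold IsLinearToFree at hb ⊢
  rw [← Category.assoc, hb]
  unfold freeAction
  calc
    _ = A.1 ◁ b ≫ (α_ _ _ _).inv ≫ (multHom A ▷ P ≫ A.1 ◁ c) := by simp
    _ = _ := by
      rw [← whisker_exchange]
      simp

/-- Every module admits finitely many `A`-linear maps to and from the free module on `Y` that
compose and sum up to the identity. -/
theorem exists_linear_generate (hA : IsCondensable A) (M : Mod (Center C) A) :
    ∃ (n : ℕ) (b : Fin n → (M.X.1 ⟶ D.Y)) (c : Fin n → (D.Y ⟶ M.X.1)),
      ∑ s, b s ≫ c s = 𝟙 M.X.1 ∧ (∀ s, IsLinearToFree M (coaction M ≫ A.1 ◁ b s)) ∧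
        ∑ s, (coaction M ≫ A.1 ◁ b s) ≫ linearExt M (c s) = 𝟙 M.X.1 := by
  obtain ⟨n, b, c, h⟩ := D.exists_generate M.X.1
  refine ⟨n, b, c, h, fun s => (isLinear_coaction hA M).comp _, ?_⟩
  have h1 : ∀ s, (coaction M ≫ A.1 ◁ b s) ≫ linearExt M (c s) =
      coaction M ≫ A.1 ◁ (b s ≫ c s) ≫ actionHom M := fun s => by simp [linearExt]
  simp only [h1, ← Preadditive.comp_sum, ← Preadditive.sum_comp, ← whiskerLeft_sum, h]
  rw [MonoidalCategory.whiskerLeft_id, Category.id_comp, coaction_actionHom hA]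

/-- `K_M` is a right module over the `A`-tube algebra: the pairing turns this into the associativity
of the product, and it separates the vectors of `K_M`. -/
theorem tubeAAct_mul (hA : IsCondensable A) (M : Mod (Center C) A) (a : D.Y ⟶ M.X.1)
    (f g : TubeA D A) :
    tubeAAct D M (tubeAAct D M a f) g = tubeAAct D M a (f * g) := by
  obtain ⟨n, b, c, -, hb, hbc⟩ := exists_linear_generate D hA M
  obtain ⟨i, -⟩ := D.exists_iso _ UnitaryFusionCategory.simple_unit
  rw [← sub_eq_zero]
  refine pairing_eq_zero D M.X _ _ _ hbc i fun s => ?_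
  have h1 : tubeAPairing D M (tubeAAct D M (tubeAAct D M a f) g) (coaction M ≫ A.1 ◁ b s) =
      tubeAPairing D M (tubeAAct D M a (f * g)) (coaction M ≫ A.1 ◁ b s) := by
    rw [← tubeAPairing_mul D M _ (hb s), ← tubeAPairing_mul D M _ (hb s),
      ← tubeAPairing_mul D M _ (hb s), tubeA_mul_assoc]
  have h2 := congrFun h1 i
  unfold tubeAPairing at h2
  rw [cancel_mono] at h2
  have h3 : ∀ x y : D.Y ⟶ M.X.1, tubePairing D M.X (x + y) (coaction M ≫ A.1 ◁ b s) i =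
      tubePairing D M.X x (coaction M ≫ A.1 ◁ b s) i +
        tubePairing D M.X y (coaction M ≫ A.1 ◁ b s) i := fun x y => by
    simp [tubePairing]
  have h4 := h3 (tubeAAct D M (tubeAAct D M a f) g - tubeAAct D M a (f * g))
    (tubeAAct D M a (f * g))
  rw [sub_add_cancel, h2] at h4
  exact left_eq_add.mp (h4.trans (add_comm _ _))

end Action

/-! ### Module morphisms and intertwiners -/

section Intertwiners

variable {C : Type u} [Category.{v} C] [MonoidalCategory C] [Preadditive C] [Linear ℂ C]
  [MonoidalPreadditive C] [MonoidalLinear ℂ C] [UnitaryFusionCategory C]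

attribute [local simp] UnitaryFusionCategory.dag_dag UnitaryFusionCategory.dag_id
  UnitaryFusionCategory.dag_comp UnitaryFusionCategory.dag_add
  UnitaryFusionCategory.dag_smul UnitaryFusionCategory.dag_whiskerLeft
  UnitaryFusionCategory.dag_whiskerRight UnitaryFusionCategory.dag_associator
  UnitaryFusionCategory.dag_leftUnitor UnitaryFusionCategory.dag_rightUnitor
  dag_associator_inv dag_leftUnitor_inv dag_rightUnitor_inv

variable {A : Center C} [MonObj A]

/-- The morphisms of `C` underlying the morphisms `M ⟶ N` of `A`-modules in the center. -/
def moduleHoms (M N : Mod (Center C) A) : Submodule ℂ (M.X.1 ⟶ N.X.1) where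
  carrier := {s | (∀ U, s ▷ U ≫ (N.X.2.β U).hom = (M.X.2.β U).hom ≫ U ◁ s) ∧
    actionHom M ≫ s = A.1 ◁ s ≫ actionHom N}
  add_mem' {s t} hs ht := ⟨fun U => by simp [hs.1 U, ht.1 U], by simp [hs.2, ht.2]⟩
  zero_mem' := ⟨fun U => by simp, by simp⟩
  smul_mem' c s hs := ⟨fun U => by simp [hs.1 U], by simp [hs.2]⟩

/-- The morphism of modules with a given underlying morphism of `C`. -/
def moduleHomMk {M N : Mod (Center C) A} (s : M.X.1 ⟶ N.X.1) (hs : s ∈ moduleHoms M N) : M ⟶ N :=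
  Mod.Hom.mk' (⟨s, hs.1⟩ : M.X ⟶ N.X) (Center.ext _ _ hs.2)

theorem hom_mem_moduleHoms {M N : Mod (Center C) A} (s : M ⟶ N) : s.hom.f ∈ moduleHoms M N :=
  ⟨s.hom.comm, congrArg Center.Hom.f s.isModHom.smul_hom⟩

theorem moduleHoms_comp {M N K : Mod (Center C) A} {s : M.X.1 ⟶ N.X.1} {t : N.X.1 ⟶ K.X.1}
    (hs : s ∈ moduleHoms M N) (ht : t ∈ moduleHoms N K) : s ≫ t ∈ moduleHoms M K :=
  hom_mem_moduleHoms (moduleHomMk s hs ≫ moduleHomMk t ht)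

theorem rightClosure_whiskerRight {x xb : C} {Rb : 𝟙_ C ⟶ x ⊗ xb} {d : ℂ}
    (hd : Rb ≫ dag Rb = d • 𝟙 (𝟙_ C)) {P Q : C} (f : P ⟶ Q) :
    rightClosure Rb (f ▷ x) = d • f := by
  unfold rightClosure
  calc
    _ = 𝟙 _ ⊗≫ (P ◁ Rb ≫ f ▷ (x ⊗ xb)) ⊗≫ Q ◁ dag Rb ⊗≫ 𝟙 _ := by monoidal
    _ = (ρ_ P).inv ≫ f ▷ 𝟙_ C ≫ Q ◁ (Rb ≫ dag Rb) ≫ (ρ_ Q).hom := by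
      rw [whisker_exchange]; monoidal
    _ = _ := by rw [hd]; simp

variable (D : IrrData C)

theorem IrrData.whiskerRight_injective (i : Fin D.n) {P Q : C} {f g : P ⟶ Q}
    (h : f ▷ D.obj i = g ▷ D.obj i) : f = g := by
  have h1 := rightClosure_whiskerRight (D.coev_dag' i) f
  rw [h, rightClosure_whiskerRight (D.coev_dag' i)] at h1
  exact (smul_right_injective _ (D.dim_ne_zero i) h1).symm

/-- Compatibility with the half-braidings can be checked on the simple objects of the list. -/
theorem central_of_simple (z w : Center C) (s : z.1 ⟶ w.1)
    (h : ∀ i, s ▷ D.obj i ≫ (w.2.β (D.obj i)).hom = (z.2.β (D.obj i)).hom ≫ D.obj i ◁ s) (U : C) :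
    s ▷ U ≫ (w.2.β U).hom = (z.2.β U).hom ≫ U ◁ s := by
  obtain ⟨n, S, u, hS, -, -, hu⟩ := UnitaryFusionCategory.semisimple U
  choose i hi using fun l => D.exists_iso (S l) (hS l)
  have key : ∀ (V : C) (p : U ⟶ V) (p' : V ⟶ U),
      s ▷ V ≫ (w.2.β V).hom = (z.2.β V).hom ≫ V ◁ s →
      s ▷ U ≫ w.1 ◁ (p ≫ p') ≫ (w.2.β U).hom = z.1 ◁ (p ≫ p') ≫ (z.2.β U).hom ≫ U ◁ s := by
    intro V p p' hV
    rw [MonoidalCategory.whiskerLeft_comp, MonoidalCategory.whiskerLeft_comp, Category.assoc,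
      Category.assoc, w.2.naturality, ← whisker_exchange_assoc, ← Category.assoc (s ▷ V), hV,
      Category.assoc, whisker_exchange, z.2.naturality_assoc, z.2.naturality_assoc,
      z.2.naturality_assoc]
  have key' : ∀ l, s ▷ U ≫ w.1 ◁ (dag (u l) ≫ u l) ≫ (w.2.β U).hom =
      z.1 ◁ (dag (u l) ≫ u l) ≫ (z.2.β U).hom ≫ U ◁ s := by
    intro l
    have hp : dag (u l) ≫ u l = (dag (u l) ≫ (hi l).some.hom) ≫ (hi l).some.inv ≫ u l := by simp
    rw [hp, key _ _ _ (h (i l))]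
  have h2 : ∀ (q : Center C), ∑ l, q.1 ◁ (dag (u l) ≫ u l) = 𝟙 _ := fun q => by
    rw [← whiskerLeft_sum, hu, MonoidalCategory.whiskerLeft_id]
  calc
    _ = ∑ l, s ▷ U ≫ w.1 ◁ (dag (u l) ≫ u l) ≫ (w.2.β U).hom := by
      rw [← Preadditive.comp_sum, ← Preadditive.sum_comp, h2, Category.id_comp]
    _ = _ := by
      simp only [key']
      rw [← Preadditive.sum_comp, h2, Category.id_comp]

/-- A morphism of `C` that intertwines the actions of the `A`-tube algebra is a morphism of
`A`-modules in the center. Its defect from being one, composed with any map into `x ⊗ Y`, is a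
morphism `B` such that the partial traces over `x` of all composites of `B` with morphisms from
`x ⊗ Y` to its domain vanish. Taking the adjoint of `B` for the latter, `B = 0` by positivity. -/
theorem mem_moduleHoms_of_intertwining (M N : Mod (Center C) A) (s : M.X.1 ⟶ N.X.1)
    (hs : ∀ (a : D.Y ⟶ M.X.1) (f : TubeA D A),
      tubeAAct D M a f ≫ s = tubeAAct D N (a ≫ s) f) : s ∈ moduleHoms M N := by
  classical
  have hact : ∀ (K : Mod (Center C) A) (a : D.Y ⟶ K.X.1) (i : Fin D.n)
      (f : D.obj i ⊗ D.Y ⟶ A.1 ⊗ (D.Y ⊗ D.obj i)),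
      tubeAAct D K a (Pi.single i f : ∀ i : Fin D.n, (D.obj i ⊗ D.Y ⟶ A.1 ⊗ (D.Y ⊗ D.obj i))) =
        leftClosure (D.R i) (f ≫ A.1 ◁ (a ▷ D.obj i) ≫ (α_ _ _ _).inv ≫
          actionHom K ▷ D.obj i ≫ (K.X.2.β (D.obj i)).hom) := by
    intro K a i f
    unfold tubeAAct
    rw [Finset.sum_eq_single i]
    · rw [Pi.single_eq_same]
      rfl
    · intro j _ hj
      rw [Pi.single_eq_of_ne hj]
      simp
    · simp
  obtain ⟨n, b, c, hbc⟩ := D.exists_generate M.X.1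
  obtain ⟨n', b', c', hbc'⟩ := D.exists_generate N.X.1
  -- the two conditions on `s`, combined into one
  have hB : ∀ i, actionHom M ▷ D.obj i ≫ (M.X.2.β (D.obj i)).hom ≫ D.obj i ◁ s =
      (A.1 ◁ s ≫ actionHom N) ▷ D.obj i ≫ (N.X.2.β (D.obj i)).hom := by
    intro i
    rw [← sub_eq_zero]
    set B := actionHom M ▷ D.obj i ≫ (M.X.2.β (D.obj i)).hom ≫ D.obj i ◁ s -
      (A.1 ◁ s ≫ actionHom N) ▷ D.obj i ≫ (N.X.2.β (D.obj i)).hom with hBdef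
    -- the intertwining property for tubes factoring through `b k`, summed over `k`
    have h1 : ∀ g : D.obj i ⊗ D.Y ⟶ (A.1 ⊗ M.X.1) ⊗ D.obj i, leftClosure (D.R i) (g ≫ B) = 0 := by
      intro g
      have h2 : ∀ k, leftClosure (D.R i) ((g ≫ (A.1 ◁ (b k ≫ c k)) ▷ D.obj i) ≫ B) = 0 := by
        intro k
        have h3 := hs (c k) (Pi.single i (g ≫ (A.1 ◁ b k) ▷ D.obj i ≫ (α_ _ _ _).hom) :
          ∀ i : Fin D.n, (D.obj i ⊗ D.Y ⟶ A.1 ⊗ (D.Y ⊗ D.obj i)))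
        rw [hact, hact, ← leftClosure_comp, ← sub_eq_zero, ← leftClosure_sub] at h3
        rw [← h3]
        congr 1
        rw [hBdef, Preadditive.comp_sub]
        simp
      have h4 : g = ∑ k, g ≫ (A.1 ◁ (b k ≫ c k)) ▷ D.obj i := by
        rw [← Preadditive.comp_sum, ← sum_whiskerRight, ← whiskerLeft_sum, hbc]
        simp
      rw [h4, Preadditive.sum_comp, leftClosure_sum]
      exact Finset.sum_eq_zero fun k _ => h2 k
    have h5 : ∀ k, B ≫ D.obj i ◁ b' k = 0 := by
      intro k
      apply eq_zero_of_leftClosure (D.conjEquations i)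
      rw [← Category.assoc, leftClosure_comp, h1, Limits.zero_comp]
    rw [← Category.comp_id B, ← MonoidalCategory.whiskerLeft_id, ← hbc', whiskerLeft_sum,
      Preadditive.comp_sum]
    refine Finset.sum_eq_zero fun k _ => ?_
    rw [MonoidalCategory.whiskerLeft_comp, ← Category.assoc, h5, Limits.zero_comp]
  -- restricting along the unit of `A` isolates the half-braiding from the action
  have hcentral : ∀ U, s ▷ U ≫ (N.X.2.β U).hom = (M.X.2.β U).hom ≫ U ◁ s := by
    apply central_of_simple D
    intro i
    have h6 : ∀ K : Mod (Center C) A, freeUnit A K.X.1 ≫ actionHom K = 𝟙 _ := fun K => by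
      unfold freeUnit
      rw [Category.assoc, unitHom_actionHom, Iso.inv_hom_id]
    have h7 := congrArg (fun t => freeUnit A M.X.1 ▷ D.obj i ≫ t) (hB i)
    simp only [← comp_whiskerRight_assoc] at h7
    rw [h6, ← Category.assoc (freeUnit A M.X.1), ← freeUnit_naturality, Category.assoc, h6] at h7
    simpa using h7.symm
  refine ⟨hcentral, ?_⟩
  obtain ⟨i, -⟩ := D.exists_iso _ UnitaryFusionCategory.simple_unit
  apply D.whiskerRight_injective i
  rw [← cancel_mono (N.X.2.β (D.obj i)).hom, comp_whiskerRight, Category.assoc, hcentral, hB]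

/-- Every vector is reconstructed from its pairings with a finite family of `A`-linear maps. -/
theorem globalDim_smul_eq (M : Mod (Center C) A) {n : ℕ} (b : Fin n → (M.X.1 ⟶ A.1 ⊗ D.Y))
    (c : Fin n → (D.Y ⟶ M.X.1)) (h : ∑ k, b k ≫ linearExt M (c k) = 𝟙 M.X.1) (a : D.Y ⟶ M.X.1) :
    D.globalDim • a = ∑ k, tubeAAct D M (c k) (tubeAPairing D M a (b k)) := by
  simp only [tubeAAct_pairing]
  rw [← Preadditive.comp_sum, ← average_sum, h, average_id]
  simp

/-- Every linear map that intertwines the actions of the `A`-tube algebra is the composition with a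
morphism of modules. -/
theorem exists_moduleHom_of_intertwiner (hA : IsCondensable A) (M N : Mod (Center C) A)
    (S : (D.Y ⟶ M.X.1) →ₗ[ℂ] (D.Y ⟶ N.X.1))
    (hS : ∀ a f, S (tubeAAct D M a f) = tubeAAct D N (S a) f) :
    ∃ s ∈ moduleHoms M N, ∀ a, S a = a ≫ s := by
  obtain ⟨n, b, c, -, hb, hbc⟩ := exists_linear_generate D hA M
  let s : M.X.1 ⟶ N.X.1 := (D.globalDim)⁻¹ •
    ∑ k, average D M.X N.X ((coaction M ≫ A.1 ◁ b k) ≫ linearExt N (S (c k)))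
  have hs : ∀ a, S a = a ≫ s := by
    intro a
    have h1 := congrArg S (globalDim_smul_eq D M _ _ hbc a)
    rw [map_smul, map_sum] at h1
    simp only [hS] at h1
    simp only [tubeAAct_pairing] at h1
    rw [Linear.comp_smul, Preadditive.comp_sum, ← h1, smul_smul,
      inv_mul_cancel₀ D.globalDim_ne_zero, one_smul]
  refine ⟨s, mem_moduleHoms_of_intertwining D M N s fun a f => ?_, hs⟩
  rw [← hs, ← hs, hS]

/-- The category of `A`-modules in the center is von Neumann regular: a regular inverse in `C` is
averaged over `A` and over all encircling strings. -/
theorem exists_regular_moduleHom (D : IrrData C) (hA : IsCondensable A)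
    {M N : Mod (Center C) A} (s : M.X.1 ⟶ N.X.1)
    (hs : s ∈ moduleHoms M N) : ∃ t ∈ moduleHoms N M, s ≫ t ≫ s = s := by
  obtain ⟨t, ht, -⟩ := exists_regular_inverse s
  obtain ⟨n, b, c, hbc, hb, -⟩ := exists_linear_generate D hA N
  let T : N.X.1 ⟶ M.X.1 := average D N.X M.X (coaction N ≫ A.1 ◁ t ≫ actionHom M)
  have hT : ∀ a, a ≫ T = ∑ k, tubeAAct D M (c k ≫ t)
      (tubeAPairing D N a (coaction N ≫ A.1 ◁ b k)) := by
    intro a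
    simp only [tubeAAct_pairing]
    rw [← Preadditive.comp_sum, ← average_sum]
    have h1 : ∀ k, (coaction N ≫ A.1 ◁ b k) ≫ linearExt M (c k ≫ t) =
        coaction N ≫ A.1 ◁ (b k ≫ c k) ≫ A.1 ◁ t ≫ actionHom M := fun k => by simp [linearExt]
    simp only [h1, ← Preadditive.comp_sum, ← Preadditive.sum_comp, ← whiskerLeft_sum, hbc]
    rw [MonoidalCategory.whiskerLeft_id, Category.id_comp]
  have hTmem : T ∈ moduleHoms N M := by
    apply mem_moduleHoms_of_intertwining D
    intro a f
    rw [hT, hT]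
    simp only [← tubeAPairing_mul D N _ (hb _), ← tubeAAct_mul D hA]
    exact (map_sum ((tubeAActLin D M).flip f) _ _).symm
  -- as `s` is a module morphism, it can be moved into the average
  have hTs : s ≫ T ≫ s = D.globalDim • s := by
    let s' : M.X ⟶ N.X := ⟨s, hs.1⟩
    have h1 : s ≫ T ≫ s = average D M.X N.X
        (s ≫ (coaction N ≫ A.1 ◁ t ≫ actionHom M) ≫ s) := by
      have h2 := average_central_comp D M.X N.X N.X s' ((coaction N ≫ A.1 ◁ t ≫ actionHom M) ≫ s)
      have h3 := average_comp_central D N.X M.X N.X (coaction N ≫ A.1 ◁ t ≫ actionHom M) s'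
      rw [h2]
      exact congrArg (fun r => s ≫ r) h3.symm
    have h4 : s ≫ coaction N = coaction M ≫ A.1 ◁ s := by
      unfold coaction
      rw [← Category.assoc, leftUnitor_inv_naturality, Category.assoc, whisker_exchange_assoc]
      simp only [Category.assoc]
      rw [← MonoidalCategory.whiskerLeft_comp, hs.2]
      simp
    have h5 : s ≫ (coaction N ≫ A.1 ◁ t ≫ actionHom M) ≫ s = 𝟙 _ ≫ s := by
      rw [← Category.assoc, ← Category.assoc, h4, Category.assoc, Category.assoc, Category.assoc,
        hs.2, ← MonoidalCategory.whiskerLeft_comp_assoc, ← MonoidalCategory.whiskerLeft_comp_assoc,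
        Category.assoc s t s, ht, ← hs.2, ← Category.assoc, coaction_actionHom hA]
    have h6 := average_comp_central D M.X M.X N.X (𝟙 _) s'
    rw [h1, h5]
    refine h6.trans ?_
    rw [average_id, Linear.smul_comp, Category.id_comp]
  refine ⟨(D.globalDim)⁻¹ • T, Submodule.smul_mem _ _ hTmem, ?_⟩
  rw [Linear.smul_comp, Linear.comp_smul, hTs, smul_smul, inv_mul_cancel₀ D.globalDim_ne_zero,
    one_smul]

end Intertwiners

/-! ### The inclusion of the tube algebra -/

section Inclusion

variable {C : Type u} [Category.{v} C] [MonoidalCategory C] [Preadditive C] [Linear ℂ C]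
  [MonoidalPreadditive C] [MonoidalLinear ℂ C] [UnitaryFusionCategory C]

attribute [local simp] UnitaryFusionCategory.dag_dag UnitaryFusionCategory.dag_id
  UnitaryFusionCategory.dag_comp UnitaryFusionCategory.dag_add
  UnitaryFusionCategory.dag_smul UnitaryFusionCategory.dag_whiskerLeft
  UnitaryFusionCategory.dag_whiskerRight UnitaryFusionCategory.dag_associator
  UnitaryFusionCategory.dag_leftUnitor UnitaryFusionCategory.dag_rightUnitor
  dag_associator_inv dag_leftUnitor_inv dag_rightUnitor_inv

variable (D : IrrData C) (A : Center C) [MonObj A]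

/-- The unit of a connected algebra is, up to a nonzero scalar, an isometry. -/
theorem exists_unitHom_comp_dag (hA : IsCondensable A) :
    ∃ c : ℂ, c ≠ 0 ∧ unitHom A ≫ dag (unitHom A) = c • 𝟙 (𝟙_ C) := by
  obtain ⟨c, hc⟩ := exists_eq_smul_id UnitaryFusionCategory.simple_unit
    (unitHom A ≫ dag (unitHom A))
  refine ⟨c, ?_, hc⟩
  rintro rfl
  rw [zero_smul] at hc
  have h1 := UnitaryFusionCategory.positive _ hc
  have h2 : 𝟙 A.1 = 0 := by
    rw [← Iso.inv_hom_id (λ_ A.1), ← unitHom_multHom, h1]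
    simp
  have h3 : ∀ s : 𝟙_ (Center C) ⟶ A, s = 0 := fun s => by
    apply Center.ext
    exact (Category.comp_id s.f).symm.trans ((congrArg (fun t => s.f ≫ t) h2).trans
      Limits.comp_zero)
  have : Subsingleton (𝟙_ (Center C) ⟶ A) := ⟨fun s t => by rw [h3 s, h3 t]⟩
  have h4 := hA.connected
  rw [Module.finrank_zero_of_subsingleton] at h4
  exact zero_ne_one h4

theorem tubeIncl_apply (f : Tube D) (i : Fin D.n) :
    tubeIncl D A f i = f i ≫ freeUnit A (D.Y ⊗ D.obj i) := rfl

theorem dag_freeUnit (P : C) : dag (freeUnit A P) = dag (unitHom A) ▷ P ≫ (λ_ P).hom := by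
  simp [freeUnit]

theorem tubeIncl_injective (hA : IsCondensable A) : Function.Injective (tubeIncl D A) := by
  obtain ⟨c, hc0, hc⟩ := exists_unitHom_comp_dag A hA
  have h1 : ∀ P : C, freeUnit A P ≫ dag (freeUnit A P) = c • 𝟙 P := fun P => by
    rw [dag_freeUnit]
    unfold freeUnit
    rw [Category.assoc, ← comp_whiskerRight_assoc, hc]
    simp
  intro f g h
  funext i
  have h2 := congrArg (fun t => t ≫ dag (freeUnit A (D.Y ⊗ D.obj i))) (congrFun h i)
  simp only [tubeIncl_apply, Category.assoc, h1, Linear.comp_smul, Category.comp_id] at h2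
  exact smul_right_injective _ hc0 h2

theorem freeUnit_whiskerRight (P U : C) :
    freeUnit A P ▷ U ≫ (α_ _ _ _).hom = freeUnit A (P ⊗ U) := by
  unfold freeUnit
  monoidal

theorem tubeAStack_incl {i j : Fin D.n} (f : D.obj i ⊗ D.Y ⟶ D.Y ⊗ D.obj i)
    (g : D.obj j ⊗ D.Y ⟶ D.Y ⊗ D.obj j) :
    tubeAStack D A (f ≫ freeUnit A _) (g ≫ freeUnit A _) = tubeStack D f g ≫ freeUnit A _ := by
  have h1 := whiskerLeft_freeUnit A (D.Y ⊗ D.obj j) (D.obj i)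
  unfold tubeAStack tubeStack
  calc
    _ = (α_ _ _ _).hom ≫ D.obj i ◁ g ≫ (D.obj i ◁ freeUnit A (D.Y ⊗ D.obj j) ≫ (α_ _ _ _).inv ≫
          (A.2.β (D.obj i)).inv ▷ (D.Y ⊗ D.obj j) ≫ (α_ _ _ _).hom) ≫
        A.1 ◁ ((α_ _ _ _).inv ≫ f ▷ D.obj j ≫ (freeUnit A _ ▷ D.obj j ≫ (α_ _ _ _).hom)) ≫
        freeAction A _ ≫ A.1 ◁ (α_ _ _ _).hom := by
      unfold freeAction
      simp
    _ = (α_ _ _ _).hom ≫ D.obj i ◁ g ≫ (freeUnit A _ ≫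
        A.1 ◁ ((α_ _ _ _).inv ≫ f ▷ D.obj j ≫ freeUnit A ((D.Y ⊗ D.obj i) ⊗ D.obj j))) ≫
        freeAction A _ ≫ A.1 ◁ (α_ _ _ _).hom := by
      rw [h1, freeUnit_whiskerRight]
      simp
    _ = (α_ _ _ _).hom ≫ D.obj i ◁ g ≫ (α_ _ _ _).inv ≫ f ▷ D.obj j ≫
        freeUnit A ((D.Y ⊗ D.obj i) ⊗ D.obj j) ≫ (freeUnit A _ ≫
        freeAction A _) ≫ A.1 ◁ (α_ _ _ _).hom := by
      rw [← freeUnit_naturality]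
      simp
    _ = _ := by
      rw [freeUnit_freeAction', Category.id_comp, ← freeUnit_naturality]
      simp

theorem tubeIncl_mul (f g : Tube D) :
    tubeIncl D A (f * g) = tubeIncl D A f * tubeIncl D A g := by
  funext k
  rw [tubeIncl_apply, tube_mul_apply, tubeA_mul_apply]
  simp only [Preadditive.sum_comp]
  refine Finset.sum_congr rfl fun i _ => Finset.sum_congr rfl fun j _ =>
    Finset.sum_congr rfl fun a _ => ?_
  rw [tubeIncl_apply, tubeIncl_apply, tubeAStack_incl]
  simp only [Category.assoc]
  rw [freeUnit_naturality]

theorem tubeIncl_star (hA : IsCondensable A) (f : Tube D) :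
    tubeIncl D A (star f) = star (tubeIncl D A f) := by
  funext j
  have h1 : dag (multHom A) ≫ A.1 ◁ dag (unitHom A) = (ρ_ A.1).inv := by
    simpa using congrArg dag (multHom_unitHom A)
  -- the adjoint of the unit is central because the half-braiding is unitary
  have h2 : ∀ U P : C, (α_ _ _ _).inv ≫ (A.2.β U).hom ▷ P ≫ (α_ _ _ _).hom ≫
      U ◁ dag (freeUnit A P) = dag (freeUnit A (U ⊗ P)) := fun U P => by
    rw [← whiskerLeft_freeUnit]
    have h3 : dag (A.2.β U).inv = (A.2.β U).hom := by
      rw [← hA.unitary, UnitaryFusionCategory.dag_dag]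
    simp [h3]
  -- bending the adjoint of the unit by `m† ∘ i` gives the unit
  have h4 : ∀ P : C, (λ_ _).inv ≫ (unitHom A ≫ dag (multHom A)) ▷ P ≫ (α_ _ _ _).hom ≫
      A.1 ◁ dag (freeUnit A P) = freeUnit A P := fun P => by
    rw [dag_freeUnit]
    unfold freeUnit
    calc
      _ = (λ_ _).inv ≫ unitHom A ▷ P ≫ (dag (multHom A) ≫ A.1 ◁ dag (unitHom A)) ▷ P ⊗≫ 𝟙 _ := by
        monoidal
      _ = _ := by
        rw [h1]
        monoidal
  change (D.obj j ◁ ((ρ_ D.Y).inv ≫ (D.Y ◁ D.R j) ≫ (α_ _ _ _).inv) ≫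
    (D.obj j ◁ (dag (f (D.bar j)) ▷ D.obj j)) ≫
    (D.obj j ◁ (α_ _ _ _).hom) ≫ (α_ _ _ _).inv ≫
    (dag (D.Rb j) ▷ (D.Y ⊗ D.obj j)) ≫ (λ_ _).hom) ≫ freeUnit A (D.Y ⊗ D.obj j) =
    (λ_ _).inv ≫ ((unitHom A ≫ dag (multHom A)) ▷ (D.obj j ⊗ D.Y)) ≫ (α_ _ _ _).hom ≫
    (A.1 ◁ ((α_ _ _ _).inv ≫ ((A.2.β (D.obj j)).hom ▷ D.Y) ≫ (α_ _ _ _).hom ≫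
      (D.obj j ◁ (A.1 ◁ ((ρ_ D.Y).inv ≫ (D.Y ◁ D.R j) ≫ (α_ _ _ _).inv))) ≫
      (D.obj j ◁ ((α_ _ _ _).inv ≫
        (dag (f (D.bar j) ≫ freeUnit A (D.Y ⊗ D.obj (D.bar j))) ▷ D.obj j) ≫ (α_ _ _ _).hom)) ≫
      (α_ _ _ _).inv ≫ (dag (D.Rb j) ▷ (D.Y ⊗ D.obj j)) ≫ (λ_ _).hom))
  rw [freeUnit_naturality, ← h4]
  have h5 : ∀ {P U : C} (c : D.Y ⟶ P ⊗ U), A.1 ◁ c ≫ (α_ _ _ _).inv ≫ dag (freeUnit A P) ▷ U =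
      dag (freeUnit A D.Y) ≫ c := by
    intro P U c
    rw [dag_freeUnit, dag_freeUnit]
    calc
      _ = (A.1 ◁ c ≫ dag (unitHom A) ▷ (P ⊗ U)) ⊗≫ 𝟙 _ := by monoidal
      _ = _ := by
        rw [whisker_exchange]
        simp [monoidalComp]
  have h6 : D.obj j ◁ (A.1 ◁ ((ρ_ D.Y).inv ≫ (D.Y ◁ D.R j) ≫ (α_ _ _ _).inv)) ≫
      (D.obj j ◁ ((α_ _ _ _).inv ≫
        (dag (f (D.bar j) ≫ freeUnit A (D.Y ⊗ D.obj (D.bar j))) ▷ D.obj j) ≫ (α_ _ _ _).hom)) =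
      D.obj j ◁ dag (freeUnit A D.Y) ≫
        D.obj j ◁ ((ρ_ D.Y).inv ≫ (D.Y ◁ D.R j) ≫ (α_ _ _ _).inv) ≫
        D.obj j ◁ (dag (f (D.bar j)) ▷ D.obj j) ≫ D.obj j ◁ (α_ _ _ _).hom := by
    simp only [← MonoidalCategory.whiskerLeft_comp]
    rw [UnitaryFusionCategory.dag_comp, comp_whiskerRight, ← Category.assoc (dag (freeUnit A D.Y)),
      ← h5]
    simp only [Category.assoc]
  rw [← Category.assoc (D.obj j ◁ (A.1 ◁ _)), h6]
  simp only [← h2, MonoidalCategory.whiskerLeft_comp, Category.assoc]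

theorem freeModule_actionHom (z : Center C) : actionHom (freeModule A z) = freeAction A z.1 := by
  change ((α_ A A z).inv ≫ μ[A] ▷ z).f = _
  rw [Center.comp_f, Center.associator_inv_f]
  rfl

theorem isLinear_free (z : Center C) {P : C} (b : z.1 ⟶ P) :
    IsLinearToFree (freeModule A z) (A.1 ◁ b) := by
  unfold IsLinearToFree
  rw [freeModule_actionHom]
  unfold freeAction
  change ((α_ A.1 A.1 z.1).inv ≫ multHom A ▷ z.1) ≫ A.1 ◁ b =
    A.1 ◁ A.1 ◁ b ≫ (α_ A.1 A.1 P).inv ≫ multHom A ▷ P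
  rw [Category.assoc, ← whisker_exchange]
  simp

/-- The inclusion maps the pairings of `z` to pairings of the free module `Az`. -/
theorem tubeIncl_pairing (z : Center C) (a : D.Y ⟶ z.1) (b : z.1 ⟶ D.Y) :
    tubeIncl D A (tubePairing D z a b) =
      tubeAPairing D (freeModule A z) (unitTensor D A a) (A.1 ◁ b) := by
  funext i
  change tubePairing D z a b i ≫ freeUnit A _ = _
  unfold tubeAPairing tubePairing
  rw [Linear.smul_comp, Linear.smul_comp]
  congr 1
  have h1 : (((freeModule A z).X).2.β (D.obj i)).inv = (α_ _ _ _).inv ≫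
      (A.2.β (D.obj i)).inv ▷ z.1 ≫ (α_ _ _ _).hom ≫ A.1 ◁ (z.2.β (D.obj i)).inv ≫
        (α_ _ _ _).inv := by
    change ((((((α_ _ _ _).inv ≫ (A.2.β (D.obj i)).inv ▷ z.1) ≫ (α_ _ _ _).hom) ≫
      A.1 ◁ (z.2.β (D.obj i)).inv) ≫ (α_ _ _ _).inv)) = _
    simp only [Category.assoc]
  have h2 : unitTensor D A a = a ≫ freeUnit A z.1 := rfl
  rw [h1, h2]
  have h3 := whiskerLeft_freeUnit A z.1 (D.obj i)
  change _ = (D.obj i ◁ (a ≫ freeUnit A z.1 : D.Y ⟶ A.1 ⊗ z.1) ≫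
    ((α_ _ _ _).inv ≫ (A.2.β (D.obj i)).inv ▷ z.1 ≫ (α_ _ _ _).hom ≫
      A.1 ◁ (z.2.β (D.obj i)).inv ≫ (α_ A.1 z.1 (D.obj i)).inv) ≫
    (A.1 ◁ b) ▷ D.obj i) ≫ (α_ A.1 D.Y (D.obj i)).hom
  calc
    _ = D.obj i ◁ a ≫ freeUnit A (D.obj i ⊗ z.1) ≫
        A.1 ◁ ((z.2.β (D.obj i)).inv ≫ b ▷ D.obj i) := by
      rw [← freeUnit_naturality]
      simp
    _ = _ := by
      rw [← h3]
      simp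

theorem tubeAAct_incl (M : Mod (Center C) A) (a : D.Y ⟶ M.X.1) (f : Tube D) :
    tubeAAct D M a (tubeIncl D A f) = tubeAct D M.X a f := by
  unfold tubeAAct tubeAct
  refine Finset.sum_congr rfl fun i _ => ?_
  have h : tubeIncl D A f i ≫ A.1 ◁ (a ▷ D.obj i) ≫ (α_ _ _ _).inv ≫ actionHom M ▷ D.obj i =
      f i ≫ a ▷ D.obj i := by
    have h1 : freeUnit A M.X.1 ≫ actionHom M = 𝟙 _ := by
      unfold freeUnit
      rw [Category.assoc, unitHom_actionHom, Iso.inv_hom_id]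
    rw [tubeIncl_apply, ← freeUnit_whiskerRight]
    calc
      _ = f i ≫ (freeUnit A D.Y ≫ A.1 ◁ a) ▷ D.obj i ≫ actionHom M ▷ D.obj i := by simp
      _ = f i ≫ (a ≫ freeUnit A M.X.1 ≫ actionHom M) ▷ D.obj i := by
        rw [← freeUnit_naturality]
        simp
      _ = _ := by rw [h1, Category.comp_id]
  have h' := congrArg (fun t => t ≫ (M.X.2.β (D.obj i)).hom) h
  simp only [Category.assoc] at h'
  rw [h']

theorem tubeAct_central (z w : Center C) (s : z ⟶ w) (a : D.Y ⟶ z.1) (f : Tube D) :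
    tubeAct D w (a ≫ s.f) f = tubeAct D z a f ≫ s.f := by
  change objAct D w (a ≫ s.f) f = objAct D z a f ≫ s.f
  unfold objAct
  rw [Preadditive.sum_comp]
  refine Finset.sum_congr rfl fun i _ => ?_
  rw [← leftClosure_comp]
  simp

theorem tubeAAct_unitTensor (z : Center C) (a : D.Y ⟶ z.1) (f : Tube D) :
    tubeAAct D (freeModule A z) (unitTensor D A a) (tubeIncl D A f) =
      unitTensor D A (tubeAct D z a f) := by
  rw [tubeAAct_incl]
  have h : ∀ a : D.Y ⟶ z.1,
      unitTensor D A a = a ≫ ((λ_ z).inv ≫ MonObj.one (X := A) ▷ z).f := fun a => by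
    rw [Center.comp_f, Center.leftUnitor_inv_f]
    rfl
  rw [h, h]
  exact tubeAct_central D z (A ⊗ z) _ a f

end Inclusion

/-! ### Right ideals and cyclic vectors -/

section Cyclic

theorem mem_rightIdeal_iff {T : Type v} [NonUnitalNonAssocRing T] [Module ℂ T]
    [SMulCommClass ℂ T T] (hT : ∀ f g h : T, f * g * h = f * (g * h)) {q : T} (hq : q * q = q)
    {h : T} : h ∈ rightIdeal q ↔ q * h = h := by
  constructor
  · rintro ⟨f, rfl⟩
    rw [LinearMap.mulLeft_apply, ← hT, hq]
  · exact fun hh => ⟨h, hh⟩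

variable {C : Type u} [Category.{v} C] [MonoidalCategory C] [Preadditive C] [Linear ℂ C]
  [MonoidalPreadditive C] [MonoidalLinear ℂ C] [UnitaryFusionCategory C]

variable {D : IrrData C}

theorem TubeModuleIso.mul_apply {z : Center C} {q : Tube D} (hq : q * q = q)
    (φ : TubeModuleIso D z q) (a : D.Y ⟶ z.1) : q * (φ.toEquiv a : Tube D) = φ.toEquiv a :=
  (mem_rightIdeal_iff (tube_mul_assoc D) hq).mp (φ.toEquiv a).2

/-- The vector corresponding to `q ∈ q Tube`. -/
theorem TubeModuleIso.exists_cyclic {z : Center C} {q : Tube D} (hq : q * q = q)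
    (φ : TubeModuleIso D z q) :
    ∃ x : D.Y ⟶ z.1, (φ.toEquiv x : Tube D) = q ∧ ∀ a, tubeAct D z x (φ.toEquiv a) = a := by
  refine ⟨φ.toEquiv.symm ⟨q, q, hq⟩, by rw [LinearEquiv.apply_symm_apply], fun a => ?_⟩
  apply φ.toEquiv.injective
  apply Subtype.ext
  rw [φ.map_act, LinearEquiv.apply_symm_apply]
  exact φ.mul_apply hq a

variable {A : Center C} [MonObj A]

theorem TubeAModuleIso.mul_apply {M : Mod (Center C) A} {p : TubeA D A} (hp : p * p = p)
    (φ : TubeAModuleIso D M p) (a : D.Y ⟶ M.X.1) : p * (φ.toEquiv a : TubeA D A) = φ.toEquiv a :=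
  (mem_rightIdeal_iff (tubeA_mul_assoc A D) hp).mp (φ.toEquiv a).2

/-- The vector corresponding to `p ∈ p Tube_A`. -/
theorem TubeAModuleIso.exists_cyclic {M : Mod (Center C) A} {p : TubeA D A} (hp : p * p = p)
    (φ : TubeAModuleIso D M p) :
    ∃ x : D.Y ⟶ M.X.1, (φ.toEquiv x : TubeA D A) = p ∧ ∀ a, tubeAAct D M x (φ.toEquiv a) = a := by
  refine ⟨φ.toEquiv.symm ⟨p, p, hp⟩, by rw [LinearEquiv.apply_symm_apply], fun a => ?_⟩
  apply φ.toEquiv.injective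
  apply Subtype.ext
  rw [φ.map_act, LinearEquiv.apply_symm_apply]
  exact φ.mul_apply hp a

end Cyclic

/-! ### The free module functor on tube algebra modules -/

section Free

variable {C : Type u} [Category.{v} C] [MonoidalCategory C] [Preadditive C] [Linear ℂ C]
  [MonoidalPreadditive C] [MonoidalLinear ℂ C] [UnitaryFusionCategory C]

variable (D : IrrData C)

theorem globalDim_smul_eq_tubeAct (z : Center C) {n : ℕ} (b : Fin n → (z.1 ⟶ D.Y))
    (c : Fin n → (D.Y ⟶ z.1)) (h : ∑ k, b k ≫ c k = 𝟙 z.1) (a : D.Y ⟶ z.1) :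
    D.globalDim • a = ∑ k, tubeAct D z (c k) (tubePairing D z a (b k)) := by
  have h1 : ∀ k, tubeAct D z (c k) (tubePairing D z a (b k)) = a ≫ average D z z (b k ≫ c k) :=
    fun k => objAct_pairing D z z a (b k) (c k)
  simp only [h1]
  rw [← Preadditive.comp_sum, ← average_sum, h, average_id]
  simp

variable (A : Center C) [MonObj A]

theorem linearExt_unitTensor (z : Center C) (a : D.Y ⟶ z.1) :
    linearExt (freeModule A z) (unitTensor D A a) = A.1 ◁ a := by
  unfold linearExt
  rw [freeModule_actionHom]
  change A.1 ◁ (a ≫ freeUnit A z.1) ≫ freeAction A z.1 = _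
  rw [MonoidalCategory.whiskerLeft_comp, Category.assoc, freeUnit_freeAction, Category.comp_id]

theorem sum_linear_free (z : Center C) {n : ℕ} (b : Fin n → (z.1 ⟶ D.Y))
    (c : Fin n → (D.Y ⟶ z.1)) (h : ∑ k, b k ≫ c k = 𝟙 z.1) :
    ∑ k, A.1 ◁ b k ≫ linearExt (freeModule A z) (unitTensor D A (c k)) =
      𝟙 (freeModule A z).X.1 := by
  simp only [linearExt_unitTensor]
  change ∑ k, A.1 ◁ b k ≫ A.1 ◁ c k = 𝟙 (A.1 ⊗ z.1)
  simp only [← MonoidalCategory.whiskerLeft_comp]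
  rw [← whiskerLeft_sum, h, MonoidalCategory.whiskerLeft_id]

variable {A}

/-- The inclusion of the tube algebra implements the free module functor. The inverse of the
isomorphism is the action on the image of the cyclic vector of `K_z`; it is bijective because
`K_{Az}` is generated by `i_A ⊗ K_z`, and because `i_A ⊗ q` is a combination of pairings with the
cyclic vector. -/
theorem exists_freeModule_iso (hA : IsCondensable A) (z : Center C) (q : Tube D) (hq : q * q = q)
    (φ : TubeModuleIso D z q) :
    ∃ ψ : TubeAModuleIso D (freeModule A z) (tubeIncl D A q), ∀ a : D.Y ⟶ z.1,
      (ψ.toEquiv (unitTensor D A a) : TubeA D A) = tubeIncl D A (φ.toEquiv a) := by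
  obtain ⟨x, hx, hxa⟩ := φ.exists_cyclic hq
  obtain ⟨n, b, c, hbc⟩ := D.exists_generate z.1
  have he : tubeIncl D A q * tubeIncl D A q = tubeIncl D A q := by rw [← tubeIncl_mul, hq]
  have hmem : ∀ {h : TubeA D A}, h ∈ rightIdeal (tubeIncl D A q) ↔ tubeIncl D A q * h = h :=
    mem_rightIdeal_iff (tubeA_mul_assoc A D) he
  have hφ : ∀ a : D.Y ⟶ z.1, tubeIncl D A (φ.toEquiv a) ∈ rightIdeal (tubeIncl D A q) := fun a => by
    rw [hmem, ← tubeIncl_mul, φ.mul_apply hq]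
  have hunit : ∀ a : D.Y ⟶ z.1, tubeAAct D (freeModule A z) (unitTensor D A x)
      (tubeIncl D A (φ.toEquiv a)) = unitTensor D A a := fun a => by
    rw [tubeAAct_unitTensor, hxa]
  let χ : rightIdeal (tubeIncl D A q) →ₗ[ℂ] (D.Y ⟶ (freeModule A z).X.1) :=
    tubeAActLin D (freeModule A z) (unitTensor D A x) ∘ₗ (rightIdeal (tubeIncl D A q)).subtype
  have hχ : ∀ h, χ h = tubeAAct D (freeModule A z) (unitTensor D A x) (h : TubeA D A) :=
    fun _ => rfl
  -- a vector is a combination of `i_A ⊗ c k`, acted upon by its pairings with `A ⊗ b k`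
  have hsurj : Function.Surjective χ := by
    intro a
    let f : Fin n → TubeA D A := fun k => tubeIncl D A (φ.toEquiv (c k)) *
      tubeAPairing D (freeModule A z) a (A.1 ◁ b k)
    have hf : ∀ k, f k ∈ rightIdeal (tubeIncl D A q) := fun k => by
      rw [hmem, ← tubeA_mul_assoc, hmem.mp (hφ _)]
    refine ⟨(D.globalDim)⁻¹ • ∑ k, ⟨f k, hf k⟩, ?_⟩
    rw [map_smul, map_sum, inv_smul_eq_iff₀ D.globalDim_ne_zero,
      globalDim_smul_eq D (freeModule A z) _ _ (sum_linear_free D A z b c hbc) a]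
    refine Finset.sum_congr rfl fun k _ => ?_
    rw [hχ, ← tubeAAct_mul D hA, hunit]
  -- expanding `x`, `i_A ⊗ q` is a combination of products with `⟨A ⊗ b k | i_A ⊗ x⟩` on the right,
  -- whose product with `h` is the pairing with `(i_A ⊗ x)·h = 0`
  have hinj : Function.Injective χ := by
    rw [injective_iff_map_eq_zero]
    intro h hh
    have h1 := congrArg (fun a => tubeIncl D A (φ.toEquiv a : Tube D))
      (globalDim_smul_eq_tubeAct D z b c hbc x)
    simp only [map_smul, map_sum, Submodule.coe_smul, Submodule.coe_sum, hx] at h1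
    have h2 : D.globalDim • (h : TubeA D A) = 0 := by
      rw [← hmem.mp h.2, ← smul_mul_assoc, h1, Finset.sum_mul]
      refine Finset.sum_eq_zero fun k _ => ?_
      have h2 : tubeIncl D A (φ.toEquiv (tubeAct D z (c k) (tubePairing D z x (b k)))) =
          tubeIncl D A (φ.toEquiv (c k)) *
            tubeAPairing D (freeModule A z) (unitTensor D A x) (A.1 ◁ b k) := by
        rw [← tubeIncl_pairing]
        exact (congrArg (tubeIncl D A) (φ.map_act _ _)).trans (tubeIncl_mul D A _ _)
      rw [h2, tubeA_mul_assoc, tubeAPairing_mul D _ _ (isLinear_free A z (b k)), ← hχ, hh]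
      have h3 : tubeAPairing D (freeModule A z) 0 (A.1 ◁ b k) = 0 := by
        funext i
        unfold tubeAPairing tubePairing
        simp only [MonoidalPreadditive.whiskerLeft_zero, Limits.zero_comp, smul_zero]
        rfl
      rw [h3, mul_zero]
    exact Subtype.ext ((smul_eq_zero_iff_right D.globalDim_ne_zero).mp h2)
  let e := LinearEquiv.ofBijective χ ⟨hinj, hsurj⟩
  have hact : ∀ a f, (e.symm (tubeAAct D (freeModule A z) a f) : TubeA D A) = e.symm a * f := by
    intro a f
    have hf : (e.symm a : TubeA D A) * f ∈ rightIdeal (tubeIncl D A q) := by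
      rw [hmem, ← tubeA_mul_assoc, hmem.mp (e.symm a).2]
    have h1 : e.symm (tubeAAct D (freeModule A z) a f) = ⟨_, hf⟩ := by
      rw [LinearEquiv.symm_apply_eq]
      change _ = tubeAAct D (freeModule A z) (unitTensor D A x)
        ((e.symm a : TubeA D A) * f)
      rw [← tubeAAct_mul D hA]
      exact congrArg (fun t => tubeAAct D (freeModule A z) t f) (e.apply_symm_apply a).symm
    rw [h1]
  refine ⟨⟨e.symm, hact⟩, fun a => ?_⟩
  have h1 : e.symm (unitTensor D A a) = ⟨_, hφ a⟩ := by
    rw [LinearEquiv.symm_apply_eq]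
    exact (hunit a).symm
  exact congrArg Subtype.val h1

end Free

/-! ### Multiplicities -/

section Multiplicity

variable {C : Type u} [Category.{v} C] [MonoidalCategory C] [Preadditive C] [Linear ℂ C]
  [MonoidalPreadditive C] [MonoidalLinear ℂ C] [UnitaryFusionCategory C]

variable (D : IrrData C) {A : Center C} [MonObj A]

instance finite_moduleHoms (M N : Mod (Center C) A) : Module.Finite ℂ (moduleHoms M N) :=
  have := UnitaryFusionCategory.finite_hom M.X.1 N.X.1
  inferInstance

/-- If `M` has only scalar endomorphisms, then its multiplicity in `N` is the dimension of the
space of morphisms `M ⟶ N`: by von Neumann regularity the composition pairing of morphisms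
`M ⟶ N` and `N ⟶ M` is nondegenerate, so that every basis has a dual family. -/
theorem isMultiplicity_finrank (D : IrrData C) (hA : IsCondensable A) (M N : Mod (Center C) A)
    (hM : ∀ s ∈ moduleHoms M M, ∃ c : ℂ, s = c • 𝟙 M.X.1) (h0 : 𝟙 M.X.1 ≠ 0) :
    IsMultiplicity M N (Module.finrank ℂ (moduleHoms M N)) := by
  -- a functional reading off the scalar of an endomorphism of `M`
  obtain ⟨l, hl⟩ : ∃ l : Module.Dual ℂ (M.X.1 ⟶ M.X.1), l (𝟙 _) = 1 :=
    Module.Projective.exists_dual_eq_one ℂ h0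
  have hlM : ∀ s ∈ moduleHoms M M, s = l s • 𝟙 M.X.1 := by
    intro s hs
    obtain ⟨c, rfl⟩ := hM s hs
    rw [map_smul, hl, smul_eq_mul, _root_.mul_one]
  let B : moduleHoms M N →ₗ[ℂ] Module.Dual ℂ (moduleHoms N M) :=
    ((Linear.comp (S := ℂ) M.X.1 N.X.1 M.X.1).compr₂ l).domRestrict₁₂ _ _
  have hB : ∀ s r, B s r = l (s.1 ≫ r.1) := fun _ _ => rfl
  have hinj : Function.Injective B := by
    rw [injective_iff_map_eq_zero]
    intro s hs
    obtain ⟨t, ht, hst⟩ := exists_regular_moduleHom D hA s.1 s.2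
    have h1 : l (s.1 ≫ t) = 0 := LinearMap.congr_fun hs ⟨t, ht⟩
    have h2 := hlM _ (moduleHoms_comp s.2 ht)
    rw [h1, zero_smul] at h2
    rw [← Category.assoc, h2, Limits.zero_comp] at hst
    exact Subtype.ext hst.symm
  have hsurj : Function.Surjective B.flip := LinearMap.flip_surjective_iff₁.mpr hinj
  constructor
  · let E := Module.finBasis ℂ (moduleHoms M N)
    choose r hr using fun a => hsurj (E.coord a)
    have h1 : ∀ a b, (E a).1 ≫ (r b).1 = (if a = b then (1 : ℂ) else 0) • 𝟙 _ := by
      intro a b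
      rw [hlM _ (moduleHoms_comp (E a).2 (r b).2)]
      have h2 : l ((E a).1 ≫ (r b).1) = E.coord b (E a) := LinearMap.congr_fun (hr b) (E a)
      rw [h2, Module.Basis.coord_apply, Module.Basis.repr_self, Finsupp.single_apply]
    refine ⟨fun a => moduleHomMk _ (E a).2, fun a => moduleHomMk _ (r a).2, fun a => ?_,
      fun a b hab => ?_⟩
    · apply Mod.hom_ext
      apply Center.ext
      have := h1 a a
      rw [if_pos rfl, one_smul] at this
      exact this
    · apply Mod.hom_ext
      apply Center.ext
      have := h1 a b
      rw [if_neg hab, zero_smul] at this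
      exact this
  · rintro k ⟨s, r, h1, h2⟩
    let s' : Fin k → moduleHoms M N := fun a => ⟨(s a).hom.f, hom_mem_moduleHoms (s a)⟩
    have h1' : ∀ a, (s a).hom.f ≫ (r a).hom.f = 𝟙 M.X.1 := fun a =>
      congrArg (fun t : M ⟶ M => t.hom.f) (h1 a)
    have h2' : ∀ a b, a ≠ b → (s a).hom.f ≫ (r b).hom.f = 0 := fun a b hab =>
      congrArg (fun t : M ⟶ M => t.hom.f) (h2 a b hab)
    have hs' : LinearIndependent ℂ s' := by
      rw [Fintype.linearIndependent_iff]
      intro g hg b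
      have h3 : (∑ a, g a • (s a).hom.f) ≫ (r b).hom.f = 0 := by
        have h4 : ∑ a, g a • (s a).hom.f = 0 := by
          simpa [s'] using congrArg Subtype.val hg
        rw [h4, Limits.zero_comp]
      rw [Preadditive.sum_comp, Finset.sum_eq_single b, Linear.smul_comp, h1'] at h3
      · exact (smul_eq_zero_iff_left h0).mp h3
      · intro a _ hab
        rw [Linear.smul_comp, h2' a b hab, smul_zero]
      · simp
    simpa using hs'.fintype_card_le_finrank

theorem tubeAAct_comp (M N : Mod (Center C) A) {s : M.X.1 ⟶ N.X.1} (hs : s ∈ moduleHoms M N)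
    (a : D.Y ⟶ M.X.1) (f : TubeA D A) :
    tubeAAct D N (a ≫ s) f = tubeAAct D M a f ≫ s := by
  unfold tubeAAct
  rw [Preadditive.sum_comp]
  refine Finset.sum_congr rfl fun i _ => ?_
  change leftClosure (D.R i) (f i ≫ A.1 ◁ (a ≫ s) ▷ D.obj i ≫ (α_ _ _ _).inv ≫
      actionHom N ▷ D.obj i ≫ (N.X.2.β (D.obj i)).hom) =
    leftClosure (D.R i) (f i ≫ A.1 ◁ a ▷ D.obj i ≫ (α_ _ _ _).inv ≫
      actionHom M ▷ D.obj i ≫ (M.X.2.β (D.obj i)).hom) ≫ s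
  rw [← leftClosure_comp]
  congr 1
  simp only [Category.assoc]
  rw [← hs.1, ← comp_whiskerRight_assoc, hs.2]
  simp

/-- A module morphism is determined by its value on a cyclic vector. -/
theorem eq_zero_of_cyclic {M N : Mod (Center C) A} {p : TubeA D A} (φ : TubeAModuleIso D M p)
    {x : D.Y ⟶ M.X.1} (hx : ∀ a, tubeAAct D M x (φ.toEquiv a) = a) {s : M.X.1 ⟶ N.X.1}
    (hs : s ∈ moduleHoms M N) (h : x ≫ s = 0) : s = 0 := by
  obtain ⟨n, b, c, hbc⟩ := D.exists_generate M.X.1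
  rw [← Category.id_comp s, ← hbc, Preadditive.sum_comp]
  refine Finset.sum_eq_zero fun k _ => ?_
  rw [Category.assoc, ← hx (c k), ← tubeAAct_comp D M N hs, h]
  have h1 : tubeAAct D N 0 (φ.toEquiv (c k)) = 0 :=
    LinearMap.congr_fun (map_zero (tubeAActLin D N)) _
  rw [h1, Limits.comp_zero]

/-- The module corresponding to a minimal projection has only scalar endomorphisms. -/
theorem exists_eq_smul_of_minimal (M : Mod (Center C) A) {p : TubeA D A}
    (hp : IsMinimalProjection p) (φ : TubeAModuleIso D M p) (s : M.X.1 ⟶ M.X.1)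
    (hs : s ∈ moduleHoms M M) : ∃ c : ℂ, s = c • 𝟙 M.X.1 := by
  have hpp : p * p = p := hp.1.isIdempotentElem
  obtain ⟨x, hx, hxa⟩ := φ.exists_cyclic hpp
  have hxp : tubeAAct D M x p = x := by
    have := hxa x
    rwa [hx] at this
  obtain ⟨c, hc⟩ := hp.2.2 (φ.toEquiv (x ≫ s))
  refine ⟨c, ?_⟩
  rw [← sub_eq_zero]
  have h1 : 𝟙 M.X.1 ∈ moduleHoms M M := hom_mem_moduleHoms (𝟙 M)
  apply eq_zero_of_cyclic D φ hxa (Submodule.sub_mem _ hs (Submodule.smul_mem _ c h1))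
  rw [Preadditive.comp_sub, sub_eq_zero, Linear.comp_smul, Category.comp_id]
  apply φ.toEquiv.injective
  apply Subtype.ext
  rw [map_smul, Submodule.coe_smul, hx, ← hc, φ.mul_apply hpp, ← φ.map_act, tubeAAct_comp D M M hs,
    hxp]

/-- Morphisms `M ⟶ N` correspond to the corner of the `A`-tube algebra cut out by the
idempotents of `N` and of `M`. -/
theorem finrank_corner_eq (hA : IsCondensable A) (M N : Mod (Center C) A) {e p : TubeA D A}
    (he : e * e = e) (hp : p * p = p) (φ : TubeAModuleIso D M p) (ψ : TubeAModuleIso D N e) :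
    Module.finrank ℂ (corner e p) = Module.finrank ℂ (moduleHoms M N) := by
  obtain ⟨x, hx, hxa⟩ := φ.exists_cyclic hp
  have hxp : tubeAAct D M x p = x := by
    have := hxa x
    rwa [hx] at this
  let L : moduleHoms M N →ₗ[ℂ] TubeA D A := (rightIdeal e).subtype ∘ₗ ψ.toEquiv.toLinearMap ∘ₗ
    Linear.leftComp ℂ N.X.1 x ∘ₗ (moduleHoms M N).subtype
  have hL : ∀ s, L s = ψ.toEquiv (x ≫ s.1) := fun _ => rfl
  have hinj : Function.Injective L := by
    rw [injective_iff_map_eq_zero]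
    intro s hs
    have h1 : x ≫ s.1 = 0 := by
      rw [← LinearEquiv.map_eq_zero_iff ψ.toEquiv]
      exact Subtype.ext hs
    exact Subtype.ext (eq_zero_of_cyclic D φ hxa s.2 h1)
  have hrange : LinearMap.range L = corner e p := by
    ext h
    constructor
    · rintro ⟨s, rfl⟩
      refine ⟨L s, ?_⟩
      change e * L s * p = L s
      rw [hL, ψ.mul_apply he, ← ψ.map_act, tubeAAct_comp D M N s.2, hxp]
    · rintro ⟨f, rfl⟩
      change e * f * p ∈ _
      have hmem : e * f * p ∈ rightIdeal e := by
        rw [mem_rightIdeal_iff (tubeA_mul_assoc A D) he, ← tubeA_mul_assoc, ← tubeA_mul_assoc, he]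
      let y := ψ.toEquiv.symm ⟨e * f * p, hmem⟩
      have hy : (ψ.toEquiv y : TubeA D A) = e * f * p := by
        rw [LinearEquiv.apply_symm_apply]
      have hyp : tubeAAct D N y p = y := by
        apply ψ.toEquiv.injective
        apply Subtype.ext
        rw [ψ.map_act, hy, tubeA_mul_assoc, hp]
      -- since `y·p = y`, the intertwiner `a ↦ y·φ(a)` maps the cyclic vector of `K_M` to `y`
      obtain ⟨s, hs, hsy⟩ := exists_moduleHom_of_intertwiner D hA M N
        (tubeAActLin D N y ∘ₗ (rightIdeal p).subtype ∘ₗ φ.toEquiv.toLinearMap) fun a g => by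
          change tubeAAct D N y (φ.toEquiv (tubeAAct D M a g)) =
            tubeAAct D N (tubeAAct D N y (φ.toEquiv a)) g
          rw [φ.map_act, tubeAAct_mul D hA]
      refine ⟨⟨s, hs⟩, ?_⟩
      have h1 : tubeAAct D N y (φ.toEquiv x) = x ≫ s := hsy x
      rw [hx, hyp] at h1
      rw [hL, ← hy, h1]
  rw [← hrange, LinearMap.finrank_range_of_inj hinj]

end Multiplicity

end

theorem mainTheorem3 {C : Type u} [Category.{v} C] [MonoidalCategory C] [Preadditive C]
    [Linear ℂ C] [MonoidalPreadditive C] [MonoidalLinear ℂ C] [UnitaryFusionCategory C]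
    (D : IrrData C) (A : Center C) [MonObj A] (hA : IsCondensable A) :
    (Function.Injective (tubeIncl D A) ∧
      (∀ f g : Tube D, tubeIncl D A (f * g) = tubeIncl D A f * tubeIncl D A g) ∧
      (∀ f : Tube D, tubeIncl D A (star f) = star (tubeIncl D A f))) ∧
    (∀ (z : Center C) (q : Tube D), IsStarProjection q → ∀ φ : TubeModuleIso D z q,
      ∃ ψ : TubeAModuleIso D (freeModule A z) (tubeIncl D A q),
        ∀ ξ : D.Y ⟶ z.1,
          (ψ.toEquiv (unitTensor D A ξ) : TubeA D A) = tubeIncl D A (φ.toEquiv ξ)) ∧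
    (∀ (z : Center C) (q : Tube D), Simple z → IsMinimalProjection q →
      Nonempty (TubeModuleIso D z q) →
      IsStarProjection (tubeIncl D A q) ∧
      ∀ (M : Mod (Center C) A) (p : TubeA D A), Simple M → IsMinimalProjection p →
        Nonempty (TubeAModuleIso D M p) →
        IsMultiplicity M (freeModule A z)
          (Module.finrank ℂ (corner (tubeIncl D A q) p))) := by
  refine ⟨⟨tubeIncl_injective D A hA, tubeIncl_mul D A, tubeIncl_star D A hA⟩,
    fun z q hq φ => exists_freeModule_iso D hA z q hq.isIdempotentElem φ, ?_⟩
  rintro z q - hq ⟨φ⟩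
  have hqq : q * q = q := hq.1.isIdempotentElem
  have he : tubeIncl D A q * tubeIncl D A q = tubeIncl D A q := by rw [← tubeIncl_mul, hqq]
  refine ⟨⟨he, ?_⟩, ?_⟩
  · change star (tubeIncl D A q) = tubeIncl D A q
    rw [← tubeIncl_star D A hA, hq.1.isSelfAdjoint.star_eq]
  rintro M p - hp ⟨φM⟩
  obtain ⟨ψ, -⟩ := exists_freeModule_iso D hA z q hqq φ
  have hpp : p * p = p := hp.1.isIdempotentElem
  rw [finrank_corner_eq D hA M (freeModule A z) he hpp φM ψ]
  refine isMultiplicity_finrank D hA M _ (exists_eq_smul_of_minimal D M hp φM) fun h0 => ?_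
  -- if `F(M)` vanished, then so would the image `p` of the cyclic vector
  obtain ⟨x, hx, -⟩ := φM.exists_cyclic hpp
  apply hp.2.1
  have h1 : x = 0 := by rw [← Category.comp_id x, h0, Limits.comp_zero]
  rw [← hx, h1, map_zero, ZeroMemClass.coe_zero]
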